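/- **Setting.** A *band-diagonal quadrature mirror filter with algebraic coefficients* is a family of unitary $N\times N$ matrices $M_N$, $N=2^n$, $n\ge n_0\ge 1$, for which there are $b\in\mathbb N$, a period $k=2^\ell$ with $\ell\le n_0$, and algebraic numbers $c_{r,\delta}\in\mathbb C$ ($r\in\mathbb Z/k$, $|\delta|<b$), such that the entry of $M_N$ in row $i$ and column $i+\delta \pmod N$ is $c_{i \bmod k,\,\delta}$ for $|\delta|<b$ and all other entries vanish (if $N$ is so small that several $i+\delta$ coincide modulo $N$, the corresponding coefficients are added); rows and columns are counted from $0$. The *discrete wavelet transform* $T=T_N$ of $\mathbb C^N$ defined by the filter is the result of the pyramid algorithm: apply $M_N$; the components of odd index are wavelet coefficients and are put, in order, in the second half of the output; the vector of components of even index is processed in the same way by $M_{N/2}$, and so on, the last matrix applied being $M_{2^{n_0}}$. (The Haar and Daubechies transforms $D_{2m}$ are of this kind.) A *circuit* on a finite set of qubits is a finite sequence of gates from the set NOT, Hadamard, $\mathrm{diag}(1,e^{i\pi/4})$, controlled NOT, controlled $i$-phase, each applied to one or two qubits of the set; its length is the number of gates. $\mathbb C^N=(\mathbb C^2)^{\otimes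 n}$ is the state space of $n$ qubits (basis vectors labelled by binary expansions). For a finite-dimensional space $V$ with a fixed orthonormal basis $B$, $|B|=d$, let $V^N=\mathbb C^N\otimes V$; a function $f:\{0,\dots,N-1\}\to B$ is recorded by $v_f=N^{-1/2}\sum_t |t\rangle\otimes|f(t)\rangle\in V^N$, and operators of $\mathbb C^N$ act on $V^N$ as $S\otimes\mathrm{id}_V$ (vectorized transform). **Statement.** For every such filter there are a polynomial $p$ and, for all $n\ge n_0$ and $\epsilon>0$, a circuit $C_{n,\epsilon}$ on exactly $n$ qubits (no ancilla) such that, with $N=2^n$: 1. $C_{n,\epsilon}$ has length at most $p(n,\log\frac1\epsilon)$, and there is a $z\in\mathbb C$ with $|z|=1$ (a global phase) such that for every $V$ and every function $f:\{0,\dots,N-1\}\to B$, poly-time computable or not, the vector $T'(v_f):=C_{n,\epsilon}v_f$ satisfies $\|T'(v_f)-z\,T(v_f)\|<\epsilon$. The von Neumann measurement of $T'(v_f)$ in the basis $|i\rangle\otimes|j\rangle$, $0\le i<N$, $j\in B$, samples $(i,j)$ from the probability distribution $|T'(v_f)_{i,j}|^2$. 2. If moreover $V=(\mathbb C^2)^{\otimes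 m(n)}$ and $f=f_n:\{0,\dots,2^n-1\}\to\{0,1\}^{m(n)}$, $n\in\mathbb N$, is a family of functions that a Turing machine computes in time polynomial in $n=\log_2 N$, then there is a polynomial $q$ such that for every $n\ge n_0$ there are $a\le q(n)$ and a circuit $P$ of length at most $q(n)$ on $n+m(n)+a$ qubits which prepares $v_f\otimes|0\cdots0\rangle$ exactly from $|0\cdots0\rangle$; for all $\epsilon>0$ the circuit $P$ followed by $C_{n,\epsilon}$ on the first $n$ qubits yields exactly $T'(v_f)\otimes|0\cdots0\rangle$, and measuring its first $n+m(n)$ qubits samples $(i,j)$ from the distribution $|T'(v_f)_{i,j}|^2$. -/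

import Mathlib

noncomputable section

/-! ### Filters and the pyramid algorithm -/

/-- The `2 ^ n × 2 ^ n` cyclically banded matrix with local description `coeff`: row `i` has the
entry `coeff (i mod 2 ^ ℓ) δ` in column `i + δ` for `|δ| < b`, columns being taken modulo `2 ^ n`.
(For `2 * b ≤ 2 ^ n + 1` the columns `i + δ` are distinct; in smaller matrices the entries that
wrap around to the same place are added.) -/
def stencilMatrix (b ℓ : ℕ) (coeff : ZMod (2 ^ ℓ) → ℤ → ℂ) (n : ℕ) :
    Matrix (Fin (2 ^ n)) (Fin (2 ^ n)) ℂ :=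
  fun i j => ∑ δ ∈ Finset.Ioo (-(b : ℤ)) (b : ℤ),
    if (2 : ℤ) ^ n ∣ ((i : ℕ) : ℤ) + δ - ((j : ℕ) : ℤ) then coeff ((i : ℕ) : ZMod (2 ^ ℓ)) δ else 0

/-- A band-diagonal quadrature mirror filter with algebraic coefficients: a family of unitary
`N × N` matrices, `N = 2 ^ n`, `n ≥ n₀`, which are cyclically band-diagonal of band width `b`,
cyclic of period `2 ^ ℓ ∣ N`, and all have the same local description. -/
structure WaveletFilter where
  /-- the entry of row `i` in column `j` can be nonzero only if `|i - j| < b` cyclically -/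
  b : ℕ
  /-- the period is `2 ^ ℓ` -/
  ℓ : ℕ
  /-- the smallest matrix of the family has size `2 ^ n₀` -/
  n₀ : ℕ
  one_le_n₀ : 1 ≤ n₀
  ℓ_le_n₀ : ℓ ≤ n₀
  /-- `coeff r δ` is the entry in row `i` and column `i + δ`, for `i ≡ r` modulo `2 ^ ℓ` -/
  coeff : ZMod (2 ^ ℓ) → ℤ → ℂ
  algebraic : ∀ r δ, IsAlgebraic ℚ (coeff r δ)
  unitary : ∀ n, n₀ ≤ n →
    stencilMatrix b ℓ coeff n ∈ Matrix.unitaryGroup (Fin (2 ^ n)) ℂ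

namespace WaveletFilter

/-- The filter matrix `M_N` for `N = 2 ^ n`. -/
def matrix (F : WaveletFilter) (n : ℕ) : Matrix (Fin (2 ^ n)) (Fin (2 ^ n)) ℂ :=
  stencilMatrix F.b F.ℓ F.coeff n

/-- The pyramid algorithm on data vectors of length `2 ^ n`. Apply the filter matrix; the
components of odd index (counting from `0`) are wavelet coefficients and are put, in order, in the
second half of the output; the components of even index are processed further by the same
algorithm and give the first half. The smallest filter matrix applied has size `2 ^ n₀`. -/
def pyramid (F : WaveletFilter) : (n : ℕ) → (Fin (2 ^ n) → ℂ) → Fin (2 ^ n) → ℂ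
  | 0, X => X
  | n + 1, X =>
    if n + 1 < F.n₀ then X
    else
      let Y := (F.matrix (n + 1)).mulVec X
      fun i =>
        if h : (i : ℕ) < 2 ^ n then
          F.pyramid n (fun j => Y ⟨2 * j, by have := j.isLt; have := pow_succ 2 n; omega⟩) ⟨i, h⟩
        else
          Y ⟨2 * (i - 2 ^ n) + 1, by have := i.isLt; have := pow_succ 2 n; omega⟩

end WaveletFilter

/-! ### States -/

/-- Binary expansion, least significant digit first: the basis state labelled `t` of `n` qubits. -/
def bitsEquiv (n : ℕ) : Fin (2 ^ n) ≃ (Fin n → Bool) :=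
  finFunctionFinEquiv.symm.trans (Equiv.arrowCongr (Equiv.refl _) finTwoEquiv)

/-- The discrete wavelet transform on the state space of `n` qubits. -/
def WaveletFilter.transform (F : WaveletFilter) (n : ℕ) (X : (Fin n → Bool) → ℂ) :
    (Fin n → Bool) → ℂ :=
  fun i => F.pyramid n (fun t => X (bitsEquiv n t)) ((bitsEquiv n).symm i)

/-- A transformation `S` of `ℂ^ι`, applied to `ℂ^ι ⊗ V`, where `V` has the basis `B`:
componentwise for each basis vector of `V`, that is `S ⊗ id`. -/
def onFirst {ι B : Type} (S : (ι → ℂ) → ι → ℂ) (v : EuclideanSpace ℂ (ι × B)) :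
    EuclideanSpace ℂ (ι × B) :=
  WithLp.toLp 2 fun p => S (fun t => v (t, p.2)) p.1

/-- The normalized vector `v_f = 2 ^ (-n / 2) ∑ t, |t⟩ ⊗ |f t⟩` recording a function `f` with
values in the basis `B` of `V`. -/
def functionState {B : Type} [DecidableEq B] (n : ℕ) (f : Fin (2 ^ n) → B) :
    EuclideanSpace ℂ ((Fin n → Bool) × B) :=
  WithLp.toLp 2 fun p => if f ((bitsEquiv n).symm p.1) = p.2 then ((1 / √(2 ^ n) : ℝ) : ℂ) else 0

/-- `μ` is the law of the outcome of the von Neumann measurement, in the state `ψ`, of the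
observable that has value `g j` on the `j`-th basis vector: the outcome `k` has as its probability
the squared norm of the projection of `ψ` to the span of the basis vectors `j` with `g j = k`. -/
def IsMeasurementLaw {ι κ : Type} [Fintype ι] [DecidableEq κ] (g : ι → κ)
    (ψ : EuclideanSpace ℂ ι) (μ : PMF κ) : Prop :=
  ∀ k, μ k = ENNReal.ofReal
    (‖(WithLp.toLp 2 fun j => if g j = k then ψ j else 0 : EuclideanSpace ℂ ι)‖ ^ 2)

/-! ### Quantum circuits -/

/-- The gates, applied to one or two qubits out of the set `Q`: NOT, Hadamard, the `π / 8` gate,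
controlled NOT, and controlled `i`-phase. -/
inductive QGate (Q : Type) : Type
  | not (q : Q) : QGate Q
  | hadamard (q : Q) : QGate Q
  | tgate (q : Q) : QGate Q
  | cnot (control target : Q) (h : control ≠ target) : QGate Q
  | cphase (q r : Q) (h : q ≠ r) : QGate Q

/-- The matrix `U` applied to the qubit `q`, the identity on all others. -/
def oneQubitMatrix {Q : Type} [Fintype Q] [DecidableEq Q] (q : Q) (U : Matrix Bool Bool ℂ) :
    Matrix (Q → Bool) (Q → Bool) ℂ :=
  fun x y => if ∀ s, s ≠ q → x s = y s then U (x q) (y q) else 0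

/-- The matrix `U` applied to the qubits `q`, `r`, the identity on all others. -/
def twoQubitMatrix {Q : Type} [Fintype Q] [DecidableEq Q] (q r : Q)
    (U : Matrix (Bool × Bool) (Bool × Bool) ℂ) : Matrix (Q → Bool) (Q → Bool) ℂ :=
  fun x y => if ∀ s, s ≠ q → s ≠ r → x s = y s then U (x q, x r) (y q, y r) else 0

namespace QGate

/-- The unitary matrix of a gate on the state space of the qubits `Q`. -/
def toMatrix {Q : Type} [Fintype Q] [DecidableEq Q] : QGate Q → Matrix (Q → Bool) (Q → Bool) ℂ
  | not q => oneQubitMatrix q fun x y => if x = !y then 1 else 0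
  | hadamard q =>
      oneQubitMatrix q fun x y => if x && y then -((1 / √2 : ℝ) : ℂ) else ((1 / √2 : ℝ) : ℂ)
  | tgate q => oneQubitMatrix q fun x y =>
      if x = y then (if x then Complex.exp (Real.pi / 4 * Complex.I) else 1) else 0
  | cnot c t _ => twoQubitMatrix c t fun x y =>
      if x.1 = y.1 ∧ x.2 = xor y.1 y.2 then 1 else 0
  | cphase q r _ => twoQubitMatrix q r fun x y =>
      if x = y then (if x.1 && x.2 then Complex.I else 1) else 0

/-- The same gate in a larger set of qubits. -/
def map {Q Q' : Type} (e : Q ↪ Q') : QGate Q → QGate Q'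
  | not q => not (e q)
  | hadamard q => hadamard (e q)
  | tgate q => tgate (e q)
  | cnot c t h => cnot (e c) (e t) (e.injective.ne h)
  | cphase q r h => cphase (e q) (e r) (e.injective.ne h)

end QGate

/-- A circuit on the qubits `Q`: the list of its gates, the first one being applied first. Its
length is the number of gates. There are no other qubits than those in `Q`. -/
abbrev QCircuit (Q : Type) : Type := List (QGate Q)

/-- The unitary matrix of a circuit. -/
def circuitMatrix {Q : Type} [Fintype Q] [DecidableEq Q] :
    QCircuit Q → Matrix (Q → Bool) (Q → Bool) ℂ
  | [] => 1
  | g :: C => circuitMatrix C * g.toMatrix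

/-- The unitary transformation of a circuit. -/
def circuitMap {Q : Type} [Fintype Q] [DecidableEq Q] (C : QCircuit Q) (X : (Q → Bool) → ℂ) :
    (Q → Bool) → ℂ :=
  (circuitMatrix C).mulVec X

/-- The result of a circuit on the initial state in which all qubits are `0`. -/
def circuitOutput {Q : Type} [Fintype Q] [DecidableEq Q] (C : QCircuit Q) :
    EuclideanSpace ℂ (Q → Bool) :=
  WithLp.toLp 2 (circuitMap C fun x => if x = fun _ => false then 1 else 0)

/-! ### Computing a function beforehand -/

/-- The data qubits among the input qubits, value qubits and work qubits. -/
def dataOf {n m a : ℕ} (y : Fin n ⊕ (Fin m ⊕ Fin a) → Bool) : (Fin n → Bool) × (Fin m → Bool) :=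
  (fun i => y (Sum.inl i), fun i => y (Sum.inr (Sum.inl i)))

/-- The state `ψ ⊗ |0 … 0⟩`, with `a` work qubits in the state `0`. -/
def withCleanWork {n m : ℕ} (a : ℕ) (ψ : EuclideanSpace ℂ ((Fin n → Bool) × (Fin m → Bool))) :
    EuclideanSpace ℂ (Fin n ⊕ (Fin m ⊕ Fin a) → Bool) :=
  WithLp.toLp 2 fun y => if ∀ i, y (Sum.inr (Sum.inr i)) = false then ψ (dataOf y) else 0

/-- The family `f n`, with `n`-bit inputs and `m n`-bit values, is computed by a Turing machine in
time polynomial in `n`, from the binary expansion of the input, which consists of `n` bits. -/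
def PolyTimeComputable {m : ℕ → ℕ} (f : ∀ n, Fin (2 ^ n) → Fin (m n) → Bool) : Prop :=
  Nonempty (Turing.TM2ComputableInPolyTime
    (fun s : (n : ℕ) × Fin (2 ^ n) => List.ofFn (bitsEquiv s.1 s.2)) (id : List Bool → List Bool)
    (fun s => List.ofFn (f s.1 s.2)))

end

noncomputable section
namespace WaveletCircuits
open Function

/-! ### Operators on the state space of a set of qubits -/

/-! Cut the indices into blocks of length `2 ^ ℓ`. Then the filter matrix is `∑ j, p j * S ^ (j -
b)`, where `S` is the cyclic shift of the blocks and the square matrices `p j` of size `2 ^ ℓ` are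
the same for every `N` (`bitsOp_stencil_mul`). Unitarity at one size so large that nothing wraps
around says that the matrix polynomial `p(z) = ∑ p j z ^ j` is unitary on the circle
(`paraunitary_of_scales`). Such a polynomial is a finite product of factors `1 - P + z P`, with `P`
the projection to a line, times a constant unitary matrix (`paraunitary_factorization`): if `p 0` is
singular, a unit vector annihilating it from the left splits off a factor and lowers a nonnegative
weight by one; if `p 0` is invertible, `p` is constant. The number of factors does not depend on
`N`. With `S` substituted for `z`, a factor becomes, after a fixed change of basis in the `ℓ` low
qubits, the addition of `1` in the high qubits under the condition that the low ones vanish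
(`exists_reach_lineShift`). Hence a filter matrix takes `O(n)` multiply controlled one-qubit gates.
Each stage of the pyramid algorithm adds one control and a cyclic permutation of the qubits, which
turns even and odd indices into two halves; the whole transform takes `O(n ^ 2)` such gates.

No ancilla is needed to expand these gates. A multiply controlled NOT is a commutator of smaller
ones which borrows a qubit in an unknown state and restores it (`exists_mcx`); controlled phases
follow from `2 s r = s + r - (s xor r)` (`reach_phaseOp_true`), and other controlled gates by
conjugation (`reach_ctrlOp`). What remains are polynomially many classical gates, which have exact
circuits, and one-qubit unitaries.

The latter are approximated as in the theorem of Solovay and Kitaev, with unit quaternions in place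
of SU(2). Words in the Hadamard and `π / 8` gates are dense, because a product of two conjugate `π /
8` gates rotates through an angle incommensurable with `π` (`mem_wordClosure`). If all unit
quaternions are known up to `δ ^ 2`, the remaining error is a commutator of two units at distance at
most `δ` from `1`; replacing these by their approximations leaves an error of order `δ ^ 3`
(`exists_word_of_level`). Everything is isometric, so the errors of the single gates add up. All
this holds up to a global phase and is an estimate of operators, so it passes to `S ⊗ id` and is
uniform in `f`.

For the preparation of `v_f`, one step of a stack machine changes each bit of the configuration
according to boundedly many bits. A polynomial-time machine thus unrolls to a polynomial
straight-line program of NANDs (`exists_slp_of_machine`). Computing reversibly, copying the values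
and uncomputing leaves the work qubits clean; this is applied to the uniform superposition produced
by Hadamard gates. -/

abbrev Op (Z : Type) := Module.End ℂ (Z → ℂ)

/-- The matrix `U` applied to the qubit `q`. -/
def oneOp {Q : Type} [DecidableEq Q] (q : Q) (U : Matrix Bool Bool ℂ) : Op (Q → Bool) where
  toFun X x := ∑ b, U (x q) b * X (update x q b)
  map_add' X Y := by ext x; simp [mul_add]; ring
  map_smul' c X := by ext x; simp; ring

/-- Substitution of a map of the labels. -/
def permOp {Z : Type} (f : Z → Z) : Op Z := LinearMap.funLeft ℂ ℂ f

/-- Multiplication by a function of the label. -/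
def diagOp {Z : Type} (d : Z → ℂ) : Op Z where
  toFun X x := d x * X x
  map_add' X Y := by ext x; simp [mul_add]
  map_smul' c X := by ext x; simp; ring

@[simp] lemma oneOp_apply {Q : Type} [DecidableEq Q] (q : Q) (U : Matrix Bool Bool ℂ)
    (X : (Q → Bool) → ℂ) (x : Q → Bool) :
    oneOp q U X x = ∑ b, U (x q) b * X (update x q b) := rfl

@[simp] lemma permOp_apply {Z : Type} (f : Z → Z) (X : Z → ℂ) (x : Z) :
    permOp f X x = X (f x) := rfl

@[simp] lemma diagOp_apply {Z : Type} (d : Z → ℂ) (X : Z → ℂ) (x : Z) :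
    diagOp d X x = d x * X x := rfl

lemma op_ext {Z : Type} {S T : Op Z} (h : ∀ X x, S X x = T X x) : S = T :=
  LinearMap.ext fun X => funext (h X)

lemma diagOp_mul {Z : Type} (d e : Z → ℂ) :
    diagOp d * diagOp e = diagOp fun x => d x * e x :=
  op_ext fun X x => by simp [mul_assoc]

lemma diagOp_const {Z : Type} (c : ℂ) : diagOp (fun _ : Z => c) = c • (1 : Op Z) :=
  op_ext fun X x => by simp

lemma permOp_diagOp {Z : Type} (f : Z → Z) (hf : Involutive f) (d : Z → ℂ) :
    permOp f * diagOp d * permOp f = diagOp (d ∘ f) :=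
  op_ext fun X x => by simp [hf x]

section
variable {Q : Type} [DecidableEq Q]

lemma oneOp_mul (q : Q) (U V : Matrix Bool Bool ℂ) : oneOp q U * oneOp q V = oneOp q (U * V) :=
  op_ext fun X x => by simp [Matrix.mul_apply]; ring

lemma oneOp_one (q : Q) : oneOp q 1 = 1 :=
  op_ext fun X x => by
    have h : update x q (x q) = x := update_eq_self q x
    cases hx : x q <;> simp [hx] <;> rw [← hx, h] <;> simp

lemma oneOp_sub (q : Q) (U V : Matrix Bool Bool ℂ) : oneOp q (U - V) = oneOp q U - oneOp q V :=
  op_ext fun X x => by simp [sub_eq_add_neg]; ring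

lemma oneOp_smul (q : Q) (c : ℂ) (U : Matrix Bool Bool ℂ) : oneOp q (c • U) = c • oneOp q U :=
  op_ext fun X x => by simp; ring

lemma oneOp_diagonal (q : Q) (d : Bool → ℂ) :
    oneOp q (Matrix.diagonal d) = diagOp fun x => d (x q) :=
  op_ext fun X x => by
    have h : update x q (x q) = x := update_eq_self q x
    cases hx : x q <;> simp [hx] <;> rw [← hx, h] <;> simp

/-- The map of labels belonging to the controlled NOT. -/
def cnotAct (c t : Q) (x : Q → Bool) : Q → Bool := update x t (xor (x t) (x c))

/-- The map of labels belonging to NOT. -/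
def notAct (q : Q) (x : Q → Bool) : Q → Bool := update x q (!x q)

lemma update_bool (x : Q → Bool) (q : Q) (b : Bool) (h : x q = b) : update x q b = x := by
  subst h; simp

lemma notAct_involutive (q : Q) : Involutive (notAct q) := fun x => by simp [notAct]

lemma cnotAct_involutive {c t : Q} (h : c ≠ t) : Involutive (cnotAct c t) := fun x => by
  simp [cnotAct, h]

variable [Fintype Q]

lemma oneQubitMatrix_mulVec (q : Q) (U : Matrix Bool Bool ℂ) :
    (oneQubitMatrix q U).mulVecLin = oneOp q U := by
  refine op_ext fun X x => ?_
  simp only [Matrix.mulVecLin_apply, Matrix.mulVec, dotProduct, oneOp_apply]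
  symm
  refine Fintype.sum_of_injective (fun b => update x q b) (update_injective x q) _ _ ?_ ?_
  · intro y hy
    rw [oneQubitMatrix, if_neg, zero_mul]
    refine fun h => hy ⟨y q, ?_⟩
    ext s
    by_cases hs : s = q
    · subst hs; simp
    · simp [hs, h s hs]
  · intro b
    simp only [oneQubitMatrix, update_self]
    rw [if_pos]
    intro s hs
    simp [hs]

lemma twoQubitMatrix_mulVec (q r : Q) (hqr : q ≠ r) (U : Matrix (Bool × Bool) (Bool × Bool) ℂ)
    (X : (Q → Bool) → ℂ) (x : Q → Bool) :
    (twoQubitMatrix q r U).mulVecLin X x =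
      ∑ b, U (x q, x r) b * X (update (update x q b.1) r b.2) := by
  simp only [Matrix.mulVecLin_apply, Matrix.mulVec, dotProduct]
  symm
  refine Fintype.sum_of_injective (fun b : Bool × Bool => update (update x q b.1) r b.2) ?_ _ _
    ?_ ?_
  · rintro ⟨a, b⟩ ⟨a', b'⟩ h
    have h1 := congrFun h q
    have h2 := congrFun h r
    simp only [ne_eq, hqr, not_false_eq_true, update_of_ne, update_self] at h1 h2
    rw [h1, h2]
  · intro y hy
    rw [twoQubitMatrix, if_neg, zero_mul]
    refine fun h => hy ⟨(y q, y r), ?_⟩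
    ext s
    by_cases hs : s = r
    · subst hs; simp
    by_cases hs' : s = q
    · subst hs'; simp [hs]
    · simp [hs, hs', h s hs' hs]
  · rintro ⟨a, b⟩
    simp only [twoQubitMatrix, update_self, ne_eq, hqr, not_false_eq_true, update_of_ne]
    rw [if_pos]
    intro s hs hs'
    simp [hs, hs']

/-- The operator of a gate. -/
def gateOp (g : QGate Q) : Op (Q → Bool) := g.toMatrix.mulVecLin

/-- The operator of a circuit. -/
def circOp (C : QCircuit Q) : Op (Q → Bool) := (circuitMatrix C).mulVecLin

@[simp] lemma circOp_nil : circOp ([] : QCircuit Q) = 1 := by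
  simp [circOp, circuitMatrix]; rfl

lemma circOp_cons (g : QGate Q) (C : QCircuit Q) : circOp (g :: C) = circOp C * gateOp g := by
  simp [circOp, circuitMatrix, gateOp, Matrix.mulVecLin_mul]; rfl

lemma circOp_singleton (g : QGate Q) : circOp [g] = gateOp g := by simp [circOp_cons]

lemma circOp_append (C D : QCircuit Q) : circOp (C ++ D) = circOp D * circOp C := by
  induction C with
  | nil => simp
  | cons g C ih => rw [List.cons_append, circOp_cons, circOp_cons, ih, mul_assoc]

lemma gateOp_not (q : Q) : gateOp (QGate.not q) = permOp (notAct q) := by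
  refine (oneQubitMatrix_mulVec q _).trans (op_ext fun X x => ?_)
  refine (oneOp_apply _ _ X x).trans ?_
  cases hx : x q <;> simp [hx, notAct]

def hadamardMatrix : Matrix Bool Bool ℂ :=
  fun x y => if x && y then -((1 / √2 : ℝ) : ℂ) else ((1 / √2 : ℝ) : ℂ)

lemma gateOp_hadamard (q : Q) : gateOp (QGate.hadamard q) = oneOp q hadamardMatrix :=
  oneQubitMatrix_mulVec q _

/-- The primitive eighth root of unity `exp (iπ/4)`. -/
def omega : ℂ := Complex.exp (Real.pi / 4 * Complex.I)

lemma gateOp_tgate (q : Q) :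
    gateOp (QGate.tgate q) = oneOp q (Matrix.diagonal fun b => if b then omega else 1) := by
  refine (oneQubitMatrix_mulVec q _).trans ?_
  refine op_ext fun X x => ?_
  simp only [oneOp_apply, Matrix.diagonal, omega]; rfl

lemma gateOp_cnot (c t : Q) (h : c ≠ t) : gateOp (QGate.cnot c t h) = permOp (cnotAct c t) := by
  refine op_ext fun X x => ?_
  refine (twoQubitMatrix_mulVec _ _ h _ X x).trans ?_
  rw [Fintype.sum_prod_type]
  have h1 := fun b => update_bool x c b
  have h2 := fun b => update_bool x t b
  cases hc : x c <;> cases ht : x t <;> simp [hc, ht, cnotAct, h1 _ hc, h2 _ ht]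

lemma gateOp_cphase (c t : Q) (h : c ≠ t) : gateOp (QGate.cphase c t h) =
    diagOp fun x => if x c && x t then Complex.I else 1 := by
  refine op_ext fun X x => ?_
  refine (twoQubitMatrix_mulVec _ _ h _ X x).trans ?_
  rw [Fintype.sum_prod_type]
  have h1 := fun b => update_bool x c b
  have h2 := fun b => update_bool x t b
  cases hc : x c <;> cases ht : x t <;> simp [hc, ht, h1 _ hc, h2 _ ht]

end

/-! ### Norms -/

/-- The Euclidean norm of a function on a finite set. -/
def nrm {Z : Type} [Fintype Z] (X : Z → ℂ) : ℝ := ‖(WithLp.toLp 2 X : EuclideanSpace ℂ Z)‖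

lemma nrm_sq {Z : Type} [Fintype Z] (X : Z → ℂ) : nrm X ^ 2 = ∑ x, ‖X x‖ ^ 2 := by
  rw [nrm, EuclideanSpace.norm_sq_eq]

lemma nrm_nonneg {Z : Type} [Fintype Z] (X : Z → ℂ) : 0 ≤ nrm X := norm_nonneg _

lemma nrm_smul {Z : Type} [Fintype Z] (c : ℂ) (X : Z → ℂ) : nrm (c • X) = ‖c‖ * nrm X := by
  rw [nrm, WithLp.toLp_smul, norm_smul, nrm]

lemma nrm_add_le {Z : Type} [Fintype Z] (X Y : Z → ℂ) : nrm (X + Y) ≤ nrm X + nrm Y := by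
  rw [nrm, WithLp.toLp_add]; exact norm_add_le _ _

/-- `S` multiplies all norms by `c`. -/
def Scales {Z : Type} [Fintype Z] (c : ℝ) (S : Op Z) : Prop := ∀ X, nrm (S X) = c * nrm X

lemma Scales.mul {Z : Type} [Fintype Z] {S T : Op Z} {c d : ℝ} (hS : Scales c S)
    (hT : Scales d T) : Scales (c * d) (S * T) := fun X => by
  rw [Module.End.mul_apply, hS, hT, mul_assoc]

lemma scales_one {Z : Type} [Fintype Z] : Scales 1 (1 : Op Z) := fun X => by simp

lemma scales_of_sq {Z : Type} [Fintype Z] {S : Op Z} {c : ℝ} (hc : 0 ≤ c)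
    (h : ∀ X, ∑ x, ‖S X x‖ ^ 2 = c ^ 2 * ∑ x, ‖X x‖ ^ 2) : Scales c S := fun X => by
  have := h X
  rw [← nrm_sq, ← nrm_sq, ← mul_pow] at this
  exact (pow_left_inj₀ (nrm_nonneg _) (mul_nonneg hc (nrm_nonneg _)) two_ne_zero).1 this

lemma scales_permOp {Z : Type} [Fintype Z] (f : Z → Z) (hf : Bijective f) :
    Scales 1 (permOp f) := scales_of_sq zero_le_one fun X => by
  simpa using Fintype.sum_bijective f hf (fun x => ‖X (f x)‖ ^ 2) (fun x => ‖X x‖ ^ 2) fun x => rfl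

lemma scales_diagOp {Z : Type} [Fintype Z] (d : Z → ℂ) (hd : ∀ x, ‖d x‖ = 1) :
    Scales 1 (diagOp d) := scales_of_sq zero_le_one fun X => by simp [hd]

section
variable {Q : Type} [DecidableEq Q] [Fintype Q]

lemma sum_sum_update (q : Q) (G : (Q → Bool) → ℝ) :
    ∑ x, ∑ b, G (update x q b) = 2 * ∑ x, G x := by
  have h : ∀ x : Q → Bool, ∑ b, G (update x q b) = G x + G (notAct q x) := fun x => by
    have h1 := fun b => update_bool x q b
    cases hx : x q <;> simp [notAct, hx, h1 _ hx, add_comm]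
  simp only [h, Finset.sum_add_distrib, two_mul]
  congr 1
  exact Fintype.sum_bijective _ (notAct_involutive q).bijective _ _ fun x => rfl

lemma norm_sq_bool_mulVec {U : Matrix Bool Bool ℂ} {c : ℝ}
    (hU : U.conjTranspose * U = ((c : ℂ)) • (1 : Matrix Bool Bool ℂ)) (v : Bool → ℂ) :
    ∑ a, ‖∑ b, U a b * v b‖ ^ 2 = c * ∑ b, ‖v b‖ ^ 2 := by
  have h : star (U.mulVec v) ⬝ᵥ U.mulVec v = (c : ℂ) * (star v ⬝ᵥ v) := by
    rw [Matrix.star_mulVec, ← Matrix.dotProduct_mulVec, Matrix.mulVec_mulVec, hU,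
      Matrix.smul_mulVec, Matrix.one_mulVec, dotProduct_smul, smul_eq_mul]
  have e : ∀ w : Bool → ℂ, star w ⬝ᵥ w = ((∑ b, ‖w b‖ ^ 2 : ℝ) : ℂ) := fun w => by
    rw [dotProduct]; push_cast
    exact Finset.sum_congr rfl fun b _ => by
      rw [Pi.star_apply, ← Complex.conj_mul']; rfl
  rw [e, e] at h
  exact_mod_cast h

/-- The labels fall into pairs differing at `q`, and the operator acts on each pair as `U`. The
factor `c` is kept general because differences of unit quaternions also act as multiples of
isometries; this makes the later error estimate exact. -/
lemma scales_oneOp (q : Q) {U : Matrix Bool Bool ℂ} {c : ℝ} (hc : 0 ≤ c)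
    (hU : U.conjTranspose * U = ((c ^ 2 : ℝ) : ℂ) • (1 : Matrix Bool Bool ℂ)) :
    Scales c (oneOp q U) := scales_of_sq hc fun X => by
  have h := sum_sum_update q fun x => ‖oneOp q U X x‖ ^ 2
  have h' := sum_sum_update q fun x => ‖X x‖ ^ 2
  have : ∀ x : Q → Bool, ∑ b, ‖oneOp q U X (update x q b)‖ ^ 2 =
      c ^ 2 * ∑ b, ‖X (update x q b)‖ ^ 2 := fun x => by
    rw [← norm_sq_bool_mulVec hU]; simp
  simp only [this] at h
  rw [← Finset.mul_sum, h'] at h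
  linarith

lemma scales_oneOp_unitary (q : Q) {U : Matrix Bool Bool ℂ}
    (hU : U ∈ Matrix.unitaryGroup Bool ℂ) : Scales 1 (oneOp q U) :=
  scales_oneOp q zero_le_one (by
    rw [← Matrix.star_eq_conjTranspose, Matrix.mem_unitaryGroup_iff'.1 hU]; simp)

lemma sqrt_two_sq : ((√2 : ℝ) : ℂ) ^ 2 = 2 := by
  rw [← Complex.ofReal_pow, Real.sq_sqrt (by norm_num)]; norm_num

lemma sqrt_two_ne : ((√2 : ℝ) : ℂ) ≠ 0 := by simp

lemma hadamard_mul_self : hadamardMatrix * hadamardMatrix = 1 := by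
  have := sqrt_two_sq
  have h0 := sqrt_two_ne
  ext a b
  cases a <;> cases b <;> simp [Matrix.mul_apply, hadamardMatrix] <;> field_simp <;>
    rw [this] <;> norm_num

lemma hadamard_mem : hadamardMatrix ∈ Matrix.unitaryGroup Bool ℂ := by
  rw [Matrix.mem_unitaryGroup_iff]
  convert hadamard_mul_self
  ext a b
  cases a <;> cases b <;> simp [hadamardMatrix]

lemma norm_omega : ‖omega‖ = 1 := by
  have := Complex.norm_exp_ofReal_mul_I (Real.pi / 4)
  rw [omega]; push_cast at this; exact this

lemma scales_gateOp (g : QGate Q) : Scales 1 (gateOp g) := by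
  cases g with
  | not q => rw [gateOp_not]; exact scales_permOp _ (notAct_involutive q).bijective
  | hadamard q => rw [gateOp_hadamard]; exact scales_oneOp_unitary q hadamard_mem
  | tgate q =>
    rw [gateOp_tgate, oneOp_diagonal]
    exact scales_diagOp _ fun x => by cases x q <;> simp [norm_omega]
  | cnot c t h => rw [gateOp_cnot]; exact scales_permOp _ (cnotAct_involutive h).bijective
  | cphase c t h =>
    rw [gateOp_cphase]
    exact scales_diagOp _ fun x => by split_ifs <;> simp

lemma scales_circOp (C : QCircuit Q) : Scales 1 (circOp C) := by
  induction C with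
  | nil => simpa using scales_one
  | cons g C ih => rw [circOp_cons]; simpa using ih.mul (scales_gateOp g)

end

/-! ### Classical reversible gates -/

section
variable {Q : Type} [DecidableEq Q]

/-- NOT, controlled NOT, and the Toffoli gate. -/
inductive CGate (Q : Type) : Type
  | not (q : Q) : CGate Q
  | cnot (c t : Q) (h : c ≠ t) : CGate Q
  | tof (a b t : Q) (hab : a ≠ b) (hat : a ≠ t) (hbt : b ≠ t) : CGate Q

/-- The map of labels belonging to the Toffoli gate. -/
def tofAct (a b t : Q) (x : Q → Bool) : Q → Bool := update x t (xor (x t) (x a && x b))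

/-- The action of a classical gate on labels. -/
def CGate.act : CGate Q → (Q → Bool) → Q → Bool
  | not q => notAct q
  | cnot c t _ => cnotAct c t
  | tof a b t _ _ _ => tofAct a b t

lemma tofAct_involutive {a b t : Q} (hat : a ≠ t) (hbt : b ≠ t) :
    Involutive (tofAct a b t) := fun x => by simp [tofAct, hat, hbt]

lemma CGate.act_involutive (g : CGate Q) : Involutive g.act := by
  cases g with
  | not q => exact notAct_involutive q
  | cnot c t h => exact cnotAct_involutive h
  | tof a b t hab hat hbt => exact tofAct_involutive hat hbt

/-- `k` gates `diag (1, ω)` on the qubit `q`. -/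
def tpow (k : ℕ) (q : Q) : QCircuit Q := List.replicate k (QGate.tgate q)

variable [Fintype Q]

lemma circOp_tpow (k : ℕ) (q : Q) :
    circOp (tpow k q) = diagOp fun x => if x q then omega ^ k else 1 := by
  induction k with
  | zero => simpa [tpow] using (diagOp_const (Z := Q → Bool) 1).symm
  | succ k ih =>
    rw [tpow, List.replicate_succ, circOp_cons, ← tpow, ih, gateOp_tgate, oneOp_diagonal,
      diagOp_mul]
    congr 1
    ext x
    cases x q <;> simp [pow_succ]

/-- A circuit conjugated by a controlled NOT. -/
def conjCnot (c t : Q) (h : c ≠ t) (C : QCircuit Q) : QCircuit Q :=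
  QGate.cnot c t h :: (C ++ [QGate.cnot c t h])

lemma circOp_conjCnot {c t : Q} (h : c ≠ t) {C : QCircuit Q} {d : (Q → Bool) → ℂ}
    (hC : circOp C = diagOp d) : circOp (conjCnot c t h C) = diagOp (d ∘ cnotAct c t) := by
  rw [conjCnot, circOp_cons, circOp_append, circOp_singleton, hC, gateOp_cnot,
    permOp_diagOp _ (cnotAct_involutive h)]

/-- The doubly controlled sign. -/
def cczCircuit (a b t : Q) (hab : a ≠ b) (hat : a ≠ t) (hbt : b ≠ t) : QCircuit Q :=
  tpow 1 a ++ (tpow 1 b ++ (tpow 1 t ++ (conjCnot a b hab (tpow 7 b) ++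
    (conjCnot b t hbt (tpow 7 t) ++ (conjCnot a t hat (tpow 7 t) ++
      conjCnot a t hat (conjCnot b t hbt (tpow 1 t)))))))

lemma omega_pow_four : omega ^ 4 = -1 := by
  rw [omega, ← Complex.exp_nat_mul, ← Complex.exp_pi_mul_I]
  congr 1
  push_cast
  ring

lemma omega_pow_eight : omega ^ 8 = 1 := by
  rw [show 8 = 4 * 2 from rfl, pow_mul, omega_pow_four]; norm_num

/-- The exponents of `omega` add up by `4abt = a + b + t - (a xor b) - (b xor t) - (a xor t) + (a
xor b xor t)` for bits; `omega ^ 4 = -1`, and seven gates act as `omega⁻¹`. -/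
lemma circOp_cczCircuit (a b t : Q) (hab : a ≠ b) (hat : a ≠ t) (hbt : b ≠ t) :
    circOp (cczCircuit a b t hab hat hbt) =
      diagOp fun x => if x a && x b && x t then -1 else 1 := by
  rw [cczCircuit, circOp_append, circOp_append, circOp_append, circOp_append, circOp_append,
    circOp_append, circOp_conjCnot hat (circOp_conjCnot hbt (circOp_tpow 1 t)),
    circOp_conjCnot hab (circOp_tpow 7 b), circOp_conjCnot hbt (circOp_tpow 7 t),
    circOp_conjCnot hat (circOp_tpow 7 t), circOp_tpow, circOp_tpow, circOp_tpow]
  simp only [diagOp_mul]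
  congr 1
  ext x
  have h4 := omega_pow_four
  have h8 := omega_pow_eight
  have h7 : omega * omega ^ 7 = 1 := by rw [← h8]; ring
  have h7' : omega ^ 7 * omega = 1 := by rw [← h8]; ring
  simp only [comp_apply, cnotAct, update_self, ne_eq, hbt, not_false_eq_true, update_of_ne]
  cases x a <;> cases x b <;> cases x t <;> simp [h7, h7']
  · linear_combination omega ^ 8 * h8 + h8
  · linear_combination omega ^ 8 * h8 + h8
  · linear_combination omega ^ 8 * h8 + h8
  · linear_combination h4

lemma oneOp_hadamard_ccz (a b t : Q) (hat : a ≠ t) (hbt : b ≠ t) :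
    oneOp t hadamardMatrix * (diagOp (fun x => if x a && x b && x t then -1 else 1) *
      oneOp t hadamardMatrix) = permOp (tofAct a b t) := by
  refine op_ext fun X x => ?_
  have h2 := sqrt_two_sq
  have h0 := sqrt_two_ne
  have hu := fun c => update_bool x t c
  simp only [Module.End.mul_apply, oneOp_apply, diagOp_apply, permOp_apply, tofAct, update_self,
    update_idem, ne_eq, hat, hbt, not_false_eq_true, update_of_ne, Fintype.sum_bool]
  cases ha : x a <;> cases hb : x b <;> cases ht : x t <;>
    simp [hadamardMatrix, hu _ ht] <;> field_simp <;> rw [h2] <;> ring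

/-- A quantum circuit for a classical gate. -/
def CGate.circuit : CGate Q → QCircuit Q
  | not q => [QGate.not q]
  | cnot c t h => [QGate.cnot c t h]
  | tof a b t hab hat hbt =>
      QGate.hadamard t :: (cczCircuit a b t hab hat hbt ++ [QGate.hadamard t])

lemma CGate.circOp_circuit (g : CGate Q) : circOp g.circuit = permOp g.act := by
  cases g with
  | not q => exact (circOp_singleton _).trans (gateOp_not q)
  | cnot c t h => exact (circOp_singleton _).trans (gateOp_cnot c t h)
  | tof a b t hab hat hbt =>
    rw [circuit, circOp_cons, circOp_append, circOp_singleton, gateOp_hadamard,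
      circOp_cczCircuit, mul_assoc, oneOp_hadamard_ccz a b t hat hbt]
    rfl

lemma CGate.length_circuit (g : CGate Q) : g.circuit.length ≤ 37 := by
  cases g <;> simp [circuit, cczCircuit, tpow, conjCnot]

end

/-! ### Multiply controlled NOT from Toffoli gates -/

section
variable {Q : Type} [DecidableEq Q]

/-- The action of a list of classical gates on labels, the first gate being applied first. -/
def run (L : List (CGate Q)) (x : Q → Bool) : Q → Bool := L.foldl (fun y g => g.act y) x

@[simp] lemma run_nil (x : Q → Bool) : run [] x = x := rfl

@[simp] lemma run_cons (g : CGate Q) (L : List (CGate Q)) (x : Q → Bool) :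
    run (g :: L) x = run L (g.act x) := rfl

@[simp] lemma run_append (L M : List (CGate Q)) (x : Q → Bool) :
    run (L ++ M) x = run M (run L x) := by simp [run]

lemma run_reverse_run (L : List (CGate Q)) (x : Q → Bool) : run L.reverse (run L x) = x := by
  induction L generalizing x with
  | nil => rfl
  | cons g L ih => simp [ih, g.act_involutive x]

/-- NOT of the qubit `t`, controlled by all the qubits of `S`. -/
def mcxAct (S : Finset Q) (t : Q) (x : Q → Bool) : Q → Bool :=
  update x t (xor (x t) (decide (∀ s ∈ S, x s = true)))

lemma all_update_iff {S : Finset Q} {d : Q} (h : d ∉ S) (x : Q → Bool) (c : Bool) :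
    (∀ s ∈ S, update x d c s = true) ↔ ∀ s ∈ S, x s = true :=
  forall₂_congr fun s hs => by rw [update_of_ne (ne_of_mem_of_not_mem hs h)]

/-- The two flips of `t` are controlled by `d` and by `d xor (∧ A)`, each together with all of `B`.
Their sum is `∧ A` and `∧ B`, whatever the value of `d`, and `d` itself is flipped twice. -/
lemma mcxAct_union {A B : Finset Q} {d t : Q} (hdA : d ∉ A) (hdB : d ∉ B) (htA : t ∉ A)
    (htB : t ∉ B) (hdt : d ≠ t) (x : Q → Bool) :
    mcxAct (insert d B) t (mcxAct A d (mcxAct (insert d B) t (mcxAct A d x))) =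
      mcxAct (A ∪ B) t x := by
  simp only [mcxAct, Finset.forall_mem_insert, all_update_iff hdA, all_update_iff hdB,
    all_update_iff htA, all_update_iff htB, update_self, ne_eq, hdt, hdt.symm,
    not_false_eq_true, update_of_ne, Finset.forall_mem_union]
  ext q
  by_cases hd : q = d
  · subst hd; simp [hdt]
  by_cases ht : q = t
  · subst ht
    simp only [Bool.decide_and, update_self, ne_eq, hd, not_false_eq_true, update_of_ne]
    generalize decide (∀ s ∈ A, x s = true) = a
    generalize decide (∀ s ∈ B, x s = true) = b
    cases a <;> cases b <;> cases x d <;> cases x q <;> rfl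
  · simp [hd, ht]

/-- A multiply controlled NOT can be built from Toffoli gates, if there is one more qubit, in any
state. -/
theorem exists_mcx (m : ℕ) : ∀ (S : Finset Q) (t d : Q), S.card = m → t ∉ S → d ∉ S → d ≠ t →
    ∃ L : List (CGate Q), L.length ≤ max 1 ((m - 1) ^ 4) ∧ ∀ x, run L x = mcxAct S t x := by
  induction m using Nat.strong_induction_on with
  | _ m ih =>
    intro S t d hS ht hd hdt
    obtain h3 | h3 := lt_or_ge m 3
    · interval_cases m
      · refine ⟨[CGate.not t], by simp, fun x => ?_⟩
        simp [CGate.act, notAct, mcxAct, Finset.card_eq_zero.1 hS]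
      · obtain ⟨a, rfl⟩ := Finset.card_eq_one.1 hS
        have hat : a ≠ t := by simpa [eq_comm] using ht
        refine ⟨[CGate.cnot a t hat], by simp, fun x => ?_⟩
        simp [CGate.act, cnotAct, mcxAct]
      · obtain ⟨a, b, hab, rfl⟩ := Finset.card_eq_two.1 hS
        simp only [Finset.mem_insert, Finset.mem_singleton, not_or] at ht
        refine ⟨[CGate.tof a b t hab (Ne.symm ht.1) (Ne.symm ht.2)], by simp, fun x => ?_⟩
        simp [CGate.act, tofAct, mcxAct]
    · obtain ⟨A, hAS, hA⟩ := Finset.exists_subset_card_eq (show (m + 1) / 2 ≤ S.card by omega)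
      have hB : (S \ A).card = m - (m + 1) / 2 := by
        rw [Finset.card_sdiff_of_subset hAS, hS, hA]
      have hdB : d ∉ S \ A := fun h => hd (Finset.mem_sdiff.1 h).1
      have htB : t ∉ S \ A := fun h => ht (Finset.mem_sdiff.1 h).1
      have hdA : d ∉ A := fun h => hd (hAS h)
      have htA : t ∉ A := fun h => ht (hAS h)
      have hI : (insert d (S \ A)).card = m - (m + 1) / 2 + 1 := by
        rw [Finset.card_insert_of_notMem hdB, hB]
      obtain ⟨a, ha⟩ : A.Nonempty := Finset.card_pos.1 (by omega)
      -- Each half needs a borrowed qubit of its own: `t` is idle while `d` is flipped, and a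
      -- control `a ∈ A` is idle while `t` is flipped.
      obtain ⟨L₁, hL₁, h₁⟩ := ih _ (by omega) A d t hA hdA htA hdt.symm
      obtain ⟨L₂, hL₂, h₂⟩ := ih _ (by omega) (insert d (S \ A)) t a hI
        (by simp [htB, hdt.symm])
        (by simp only [Finset.mem_insert, not_or, Finset.mem_sdiff, not_and, not_not]
            exact ⟨ne_of_mem_of_not_mem ha hdA, fun _ => ha⟩)
        (ne_of_mem_of_not_mem ha htA)
      refine ⟨L₁ ++ (L₂ ++ (L₁ ++ L₂)), ?_, fun x => ?_⟩
      · have key : ∀ j, j - 1 ≤ m / 2 → max 1 ((j - 1) ^ 4) ≤ (m / 2) ^ 4 := fun j hj =>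
          max_le (Nat.one_le_pow _ _ (by omega)) (Nat.pow_le_pow_left hj 4)
        have k1 := hL₁.trans (key _ (by omega))
        have k2 := hL₂.trans (key _ (by omega))
        -- Four calls with `j - 1` reduced at least by the factor `2 / 3`; the exponent `4` works
        -- because `4 * (2 / 3) ^ 4 < 1`.
        have k3 : 4 * (m / 2) ^ 4 ≤ (m - 1) ^ 4 := by
          obtain h | h := eq_or_lt_of_le h3
          · subst h; norm_num
          · have : 3 * (m / 2) ≤ 2 * (m - 1) := by omega
            have := Nat.pow_le_pow_left this 4
            rw [mul_pow, mul_pow] at this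
            norm_num at this
            omega
        simp only [List.length_append]
        exact le_max_of_le_right (by omega)
      · simp only [run_append, h₁, h₂]
        rw [mcxAct_union hdA hdB htA htB hdt, Finset.union_sdiff_of_subset hAS]

end

/-! ### Words in a monoid -/

/-- `S` is the product of at most `K` elements of `A`. -/
def Reach {M : Type} [Monoid M] (A : Set M) (K : ℕ) (S : M) : Prop :=
  ∃ L : List M, L.length ≤ K ∧ (∀ s ∈ L, s ∈ A) ∧ L.prod = S

section
variable {M N : Type} [Monoid M] [Monoid N] {A B : Set M} {K K' : ℕ} {S T : M}

lemma Reach.mono (h : Reach A K S) (hK : K ≤ K') : Reach A K' S :=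
  let ⟨L, h1, h2⟩ := h; ⟨L, h1.trans hK, h2⟩

lemma reach_one : Reach A 0 (1 : M) := ⟨[], by simp⟩

lemma reach_of_mem (h : S ∈ A) : Reach A 1 S := ⟨[S], by simpa using h⟩

lemma Reach.mul (h : Reach A K S) (h' : Reach A K' T) : Reach A (K + K') (S * T) := by
  obtain ⟨L, h1, h2, rfl⟩ := h
  obtain ⟨L', h1', h2', rfl⟩ := h'
  refine ⟨L ++ L', by simpa using Nat.add_le_add h1 h1', fun s hs => ?_, by simp⟩
  exact (List.mem_append.1 hs).elim (h2 s) (h2' s)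

lemma Reach.pow (h : Reach A K S) (n : ℕ) : Reach A (n * K) (S ^ n) := by
  induction n with
  | zero => simpa using reach_one
  | succ n ih => rw [pow_succ, Nat.succ_mul]; exact ih.mul h

lemma Reach.subst (h : Reach A K S) {C : ℕ} (hAB : ∀ a ∈ A, Reach B C a) :
    Reach B (K * C) S := by
  obtain ⟨L, h1, h2, rfl⟩ := h
  refine Reach.mono ?_ (Nat.mul_le_mul_right C h1)
  clear h1
  induction L with
  | nil => simpa using reach_one
  | cons a L ih =>
    rw [List.prod_cons, List.length_cons, Nat.succ_mul, add_comm]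
    exact (hAB a (h2 a (by simp))).mul (ih fun s hs => h2 s (by simp [hs]))

lemma Reach.map (h : Reach A K S) (f : M →* N) {B : Set N} (hAB : ∀ a ∈ A, f a ∈ B) :
    Reach B K (f S) := by
  obtain ⟨L, h1, h2, rfl⟩ := h
  refine ⟨L.map f, by simpa using h1, ?_, (map_list_prod f L).symm⟩
  intro s hs
  obtain ⟨a, ha, rfl⟩ := List.mem_map.1 hs
  exact hAB a (h2 a ha)

lemma Reach.exists_inv (h : Reach A K S) (hA : ∀ a ∈ A, ∃ b ∈ A, a * b = 1 ∧ b * a = 1) :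
    ∃ T, Reach A K T ∧ S * T = 1 ∧ T * S = 1 := by
  obtain ⟨L, h1, h2, rfl⟩ := h
  suffices ∃ T, Reach A L.length T ∧ L.prod * T = 1 ∧ T * L.prod = 1 from
    let ⟨T, h, h'⟩ := this; ⟨T, h.mono h1, h'⟩
  clear h1
  induction L with
  | nil => exact ⟨1, by simpa using reach_one⟩
  | cons a L ih =>
    obtain ⟨T, hT, h3, h4⟩ := ih fun s hs => h2 s (by simp [hs])
    obtain ⟨b, hb, h5, h6⟩ := hA a (h2 a (by simp))
    refine ⟨T * b, hT.mul (reach_of_mem hb), ?_, ?_⟩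
    · rw [List.prod_cons, mul_assoc, ← mul_assoc _ T, h3, one_mul, h5]
    · rw [List.prod_cons, mul_assoc, ← mul_assoc b, h6, one_mul, h4]

lemma exists_reach_of_mem_closure (h : S ∈ Submonoid.closure A) : ∃ K, Reach A K S := by
  obtain ⟨L, h1, h2⟩ := Submonoid.exists_list_of_mem_closure h
  exact ⟨L.length, L, le_rfl, h1, h2⟩

end

/-! ### Complex reflections -/

section
variable {κ : Type} [Fintype κ] [DecidableEq κ]

/-- The complex reflection which multiplies the vector `w` by `ω`. -/
def reflection (w : κ → ℂ) (ω : ℂ) : Matrix κ κ ℂ :=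
  1 + (ω - 1) • Matrix.vecMulVec w (star w)

/-- The reflections at unit vectors with a factor of modulus `1`. -/
def reflections (κ : Type) [Fintype κ] [DecidableEq κ] : Set (Matrix κ κ ℂ) :=
  {R | ∃ w ω, star w ⬝ᵥ w = 1 ∧ ‖ω‖ = 1 ∧ R = reflection w ω}

lemma reflection_mulVec (w : κ → ℂ) (ω : ℂ) (v : κ → ℂ) :
    (reflection w ω).mulVec v = v + ((ω - 1) * (star w ⬝ᵥ v)) • w := by
  rw [reflection, Matrix.add_mulVec, Matrix.one_mulVec, Matrix.smul_mulVec,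
    Matrix.vecMulVec_mulVec, ← smul_smul, op_smul_eq_smul]

lemma reflection_mul (w : κ → ℂ) (hw : star w ⬝ᵥ w = 1) (ω ω' : ℂ) :
    reflection w ω * reflection w ω' = reflection w (ω * ω') := by
  have h : Matrix.vecMulVec w (star w) * Matrix.vecMulVec w (star w) =
      Matrix.vecMulVec w (star w) := by
    rw [Matrix.vecMulVec_mul_vecMulVec, hw, one_smul]
  simp only [reflection, add_mul, mul_add, one_mul, mul_one, smul_mul_assoc, mul_smul_comm, h]
  module

lemma reflection_one (w : κ → ℂ) : reflection w 1 = 1 := by simp [reflection]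

lemma conjTranspose_reflection (w : κ → ℂ) (ω : ℂ) :
    (reflection w ω).conjTranspose = reflection w (star ω) := by
  simp [reflection, Matrix.conjTranspose_add, Matrix.conjTranspose_smul]

lemma star_mul_self_of_norm {ω : ℂ} (h : ‖ω‖ = 1) : star ω * ω = 1 := by
  have := Complex.conj_mul' ω
  rw [h] at this
  simpa using this

lemma reflection_mem (w : κ → ℂ) (hw : star w ⬝ᵥ w = 1) {ω : ℂ} (h : ‖ω‖ = 1) :
    reflection w ω ∈ Matrix.unitaryGroup κ ℂ := by
  rw [Matrix.mem_unitaryGroup_iff', Matrix.star_eq_conjTranspose, conjTranspose_reflection,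
    reflection_mul w hw, star_mul_self_of_norm h, reflection_one]

/-- The mirror vector is `u = e_x - v`, normalized. With `c = 1 - v x` one has `⟨u, v⟩ = -c` and
`⟨u, u⟩ = c + star c`, so `ω = -star c / c` makes the reflection add exactly `u` to `v`. Basis
vectors orthogonal to `u` stay fixed, which permits treating the columns of a unitary matrix one
after another. -/
lemma exists_reflection (x : κ) (v : κ → ℂ) (hv : star v ⬝ᵥ v = 1) (hx : v ≠ Pi.single x 1) :
    ∃ w ω, star w ⬝ᵥ w = 1 ∧ ‖ω‖ = 1 ∧ (reflection w ω).mulVec v = Pi.single x 1 ∧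
      ∀ y, y ≠ x → v y = 0 → w y = 0 := by
  set u : κ → ℂ := Pi.single x 1 - v with hu
  have huv : star u ⬝ᵥ v = v x - 1 := by
    rw [hu, star_sub, sub_dotProduct, hv, Pi.star_single, single_dotProduct]; simp
  have huu : star u ⬝ᵥ u = (1 - v x) + star (1 - v x) := by
    nth_rewrite 2 [hu]
    rw [dotProduct_sub, huv, hu]
    simp
    ring
  have hu0 : u ≠ 0 := fun h => hx (sub_eq_zero.1 h).symm
  have hpos : 0 < ∑ y, ‖u y‖ ^ 2 := by
    obtain ⟨y, hy⟩ := Function.ne_iff.1 hu0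
    exact Finset.sum_pos' (fun _ _ => by positivity)
      ⟨y, Finset.mem_univ _, by have : 0 < ‖u y‖ := norm_pos_iff.2 hy
                                positivity⟩
  have hN : star u ⬝ᵥ u = ((∑ y, ‖u y‖ ^ 2 : ℝ) : ℂ) := by
    rw [dotProduct]; push_cast
    exact Finset.sum_congr rfl fun b _ => by
      rw [Pi.star_apply, ← Complex.conj_mul']; rfl
  set n : ℝ := ∑ y, ‖u y‖ ^ 2
  have hs : (((√n : ℝ) : ℂ)) * ((√n : ℝ) : ℂ) = (n : ℂ) := by
    rw [← Complex.ofReal_mul, Real.mul_self_sqrt hpos.le]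
  have hs0 : ((√n : ℝ) : ℂ) ≠ 0 := by simpa using (Real.sqrt_pos.2 hpos).ne'
  have hn0 : (n : ℂ) ≠ 0 := by simpa using hpos.ne'
  have hc : 1 - v x ≠ 0 := fun h => by
    rw [huu, h] at hN
    simp at hN
    exact hpos.ne' (by exact_mod_cast hN.symm)
  refine ⟨((√n : ℝ) : ℂ)⁻¹ • u, -(star (1 - v x)) / (1 - v x), ?_, ?_, ?_, ?_⟩
  · rw [star_smul, smul_dotProduct, dotProduct_smul, hN, ← hs]
    simp
    field_simp
  · rw [norm_div, norm_neg, norm_star, div_self (norm_ne_zero_iff.2 hc)]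
  · rw [reflection_mulVec, star_smul, smul_dotProduct, huv, smul_smul]
    have : (-star (1 - v x) / (1 - v x) - 1) * star (((√n : ℝ) : ℂ)⁻¹) • (v x - 1) *
        ((√n : ℝ) : ℂ)⁻¹ = 1 := by
      have e : star (((√n : ℝ) : ℂ)⁻¹) = (((√n : ℝ) : ℂ)⁻¹) := by simp
      rw [e, smul_eq_mul]
      have e2 : (-star (1 - v x) / (1 - v x) - 1) * (v x - 1) = n := by
        rw [← hN, huu]; field_simp; ring
      calc _ = ((-star (1 - v x) / (1 - v x) - 1) * (v x - 1)) *
            (((√n : ℝ) : ℂ)⁻¹ * ((√n : ℝ) : ℂ)⁻¹) := by ring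
        _ = 1 := by rw [e2, ← mul_inv, hs, mul_inv_cancel₀ hn0]
    rw [this, one_smul, hu]
    simp
  · intro y hy hvy
    simp [hu, hvy, hy]

/-- A unitary matrix is a product of complex reflections. -/
theorem reach_reflections (n : ℕ) : ∀ (A : Finset κ), (Aᶜ).card = n →
    ∀ U ∈ Matrix.unitaryGroup κ ℂ, (∀ x ∈ A, U.mulVec (Pi.single x 1) = Pi.single x 1) →
    Reach (reflections κ) n U := by
  induction n with
  | zero =>
    intro A hA U hU h
    have : U = 1 := by
      refine Matrix.ext_of_mulVec_single fun x => ?_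
      rw [h x (by rw [Finset.card_eq_zero, Finset.compl_eq_empty_iff] at hA; simp [hA]),
        Matrix.one_mulVec]
    subst this; exact reach_one
  | succ n ih =>
    intro A hA U hU h
    obtain ⟨x, hx⟩ : (Aᶜ).Nonempty := Finset.card_pos.1 (by omega)
    have hxA : x ∉ A := Finset.mem_compl.1 hx
    have hcard : ((insert x A)ᶜ).card = n := by
      rw [Finset.compl_insert, Finset.card_erase_of_mem hx, hA]; rfl
    by_cases hv : U.mulVec (Pi.single x 1) = Pi.single x 1
    · exact (ih _ hcard U hU fun y hy => by
        obtain rfl | hy := Finset.mem_insert.1 hy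
        exacts [hv, h y hy]).mono n.le_succ
    · have hUU := Matrix.mem_unitaryGroup_iff'.1 hU
      have horth : ∀ a b : κ, star (U.mulVec (Pi.single a 1)) ⬝ᵥ U.mulVec (Pi.single b 1) =
          if b = a then 1 else 0 := fun a b => by
        rw [Matrix.star_mulVec, ← Matrix.dotProduct_mulVec, Matrix.mulVec_mulVec,
          ← Matrix.star_eq_conjTranspose, hUU, Matrix.one_mulVec, Pi.star_single,
          single_dotProduct]
        simp [Pi.single_apply, eq_comm]
      obtain ⟨w, ω, hw, hω, h1, h2⟩ := exists_reflection x _ (by rw [horth]; simp) hv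
      have hfix : ∀ y ∈ A, (reflection w ω).mulVec (Pi.single y 1) = Pi.single y 1 := by
        intro y hy
        have hxy : y ≠ x := ne_of_mem_of_not_mem hy hxA
        have := horth y x
        rw [h y hy, Pi.star_single, single_dotProduct, if_neg hxy.symm] at this
        have hwy := h2 y hxy (by simpa using this)
        rw [reflection_mulVec, dotProduct_single]
        simp [hwy]
      have := ih _ hcard (reflection w ω * U) (mul_mem (reflection_mem w hw hω) hU)
        fun y hy => by
          rw [← Matrix.mulVec_mulVec]
          obtain rfl | hy := Finset.mem_insert.1 hy
          exacts [h1, by rw [h y hy, hfix y hy]]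
      -- The inverse of a reflection is the reflection with the conjugate factor, so `U` costs one
      -- more factor than the matrix with an additional fixed basis vector.
      have hU' : U = reflection w (star ω) * (reflection w ω * U) := by
        rw [← mul_assoc, reflection_mul w hw, star_mul_self_of_norm hω, reflection_one, one_mul]
      rw [hU', add_comm]
      exact (reach_of_mem (A := reflections κ)
        ⟨w, star ω, hw, by simpa using hω, rfl⟩).mul this

end

/-! ### Multiply controlled gates -/

section
variable {Q : Type} [DecidableEq Q]

/-- One-qubit gates, classical gates and global phases. -/
def basicOps (Q : Type) [DecidableEq Q] : Set (Op (Q → Bool)) :=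
  {S | (∃ q, ∃ U ∈ Matrix.unitaryGroup Bool ℂ, S = oneOp q U) ∨
    (∃ g : CGate Q, S = permOp g.act) ∨ ∃ z : ℂ, ‖z‖ = 1 ∧ S = z • (1 : Op (Q → Bool))}

lemma reach_oneOp (q : Q) {U : Matrix Bool Bool ℂ} (hU : U ∈ Matrix.unitaryGroup Bool ℂ) :
    Reach (basicOps Q) 1 (oneOp q U) := reach_of_mem (Or.inl ⟨q, U, hU, rfl⟩)

lemma reach_run (L : List (CGate Q)) : Reach (basicOps Q) L.length (permOp (run L)) := by
  induction L with
  | nil => exact reach_one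
  | cons g L ih =>
    have : permOp (run (g :: L)) = permOp g.act * permOp (run L) := rfl
    rw [this, List.length_cons, add_comm]
    exact (reach_of_mem (A := basicOps Q) (Or.inr (Or.inl ⟨g, rfl⟩))).mul ih

/-- The factor `w` on all labels which agree with `b` on the set `S`. -/
def phaseOp (S : Finset Q) (b : Q → Bool) (w : ℂ) : Op (Q → Bool) :=
  diagOp fun x => if ∀ s ∈ S, x s = b s then w else 1

lemma diagonal_mem {d : Bool → ℂ} (hd : ∀ b, ‖d b‖ = 1) :
    Matrix.diagonal d ∈ Matrix.unitaryGroup Bool ℂ := by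
  rw [Matrix.mem_unitaryGroup_iff', Matrix.star_eq_conjTranspose, Matrix.diagonal_conjTranspose,
    Matrix.diagonal_mul_diagonal, ← Matrix.diagonal_one]
  congr 1
  ext b
  exact star_mul_self_of_norm (hd b)

lemma reach_phaseOp_singleton (s : Q) {w : ℂ} (hw : ‖w‖ = 1) :
    Reach (basicOps Q) 1 (phaseOp {s} (fun _ => true) w) := by
  have : phaseOp {s} (fun _ => true) w =
      oneOp s (Matrix.diagonal fun b => if b then w else 1) := by
    rw [oneOp_diagonal]; simp [phaseOp]
  rw [this]
  exact reach_oneOp s (diagonal_mem fun b => by cases b <;> simp [hw])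

lemma exists_sqrt {w : ℂ} (hw : ‖w‖ = 1) : ∃ v : ℂ, ‖v‖ = 1 ∧ v * v = w := by
  obtain ⟨v, hv⟩ := IsAlgClosed.exists_pow_nat_eq w two_pos
  refine ⟨v, ?_, by rw [← hv, sq]⟩
  have : ‖v‖ ^ 2 = 1 := by rw [← norm_pow, hv, hw]
  exact (pow_eq_one_iff_of_nonneg (norm_nonneg v) two_ne_zero).1 this

lemma mcxAct_involutive {S : Finset Q} {t : Q} (h : t ∉ S) : Involutive (mcxAct S t) := fun x => by
  simp [mcxAct, all_update_iff h]

/-- The number of gates sufficient for a phase on `m` qubits. -/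
def phaseCost (m : ℕ) : ℕ := (m + 1) * (2 * m ^ 4 + 10)

/-- With `w = v ^ 2`, the exponent of `v` is `2st = s + t - (s xor t)`, and the parity is brought to
the qubit `t` by a controlled NOT. -/
lemma reach_phaseOp_pair {s t : Q} (hst : s ≠ t) {w : ℂ} (hw : ‖w‖ = 1) :
    Reach (basicOps Q) 5 (phaseOp {s, t} (fun _ => true) w) := by
  obtain ⟨v, hv, rfl⟩ := exists_sqrt hw
  have hv0 : v ≠ 0 := fun h => by simp [h] at hv
  have e : phaseOp {s, t} (fun _ => true) (v * v) = phaseOp {s} (fun _ => true) v *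
      (phaseOp {t} (fun _ => true) v * (permOp (CGate.cnot s t hst).act *
        phaseOp {t} (fun _ => true) v⁻¹ * permOp (CGate.cnot s t hst).act)) := by
    unfold phaseOp
    rw [permOp_diagOp _ (CGate.act_involutive _), diagOp_mul, diagOp_mul]
    congr 1
    ext x
    simp only [comp_apply, CGate.act, cnotAct, Finset.forall_mem_insert, Finset.mem_singleton,
      forall_eq, update_self]
    cases hs : x s <;> cases ht : x t <;> simp [hv0]
  rw [e]
  have hc : Reach (basicOps Q) 1 (permOp (CGate.cnot s t hst).act) :=
    reach_of_mem (Or.inr (Or.inl ⟨_, rfl⟩))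
  exact (reach_phaseOp_singleton s hv).mul ((reach_phaseOp_singleton t hv).mul
    ((hc.mul (reach_phaseOp_singleton t (by simpa using hv))).mul hc))

lemma reach_phaseOp_true (m : ℕ) : ∀ (S : Finset Q) (w : ℂ), S.card = m → ‖w‖ = 1 →
    Reach (basicOps Q) (phaseCost m) (phaseOp S (fun _ => true) w) := by
  induction m with
  | zero =>
    intro S w hS hw
    refine Reach.mono (K := 1) (reach_of_mem (Or.inr (Or.inr ⟨w, hw, ?_⟩))) (by simp [phaseCost])
    rw [Finset.card_eq_zero.1 hS, ← diagOp_const]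
    simp [phaseOp]
  | succ m ih =>
    intro S w hS hw
    obtain ⟨s, T, hsT, rfl, hT⟩ := Finset.card_eq_succ.1 hS
    obtain rfl | hm := Nat.eq_zero_or_pos m
    · rw [Finset.card_eq_zero.1 hT]
      exact (reach_phaseOp_singleton s hw).mono (by simp [phaseCost])
    · obtain ⟨t, R, htR, rfl, hR⟩ := Finset.card_eq_succ.1
        (show T.card = (m - 1) + 1 by omega)
      have hst : s ≠ t := fun h => hsT (by simp [h])
      have hsR : s ∉ R := fun h => hsT (by simp [h])
      obtain ⟨v, hv, rfl⟩ := exists_sqrt hw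
      have hv0 : v ≠ 0 := fun h => by simp [h] at hv
      -- With `r = ∧ R` and `w = v ^ 2`, the exponent of `v` is `2str = st + tr - t(s xor r)`. The
      -- last term is a two-qubit phase conjugated by the NOT of `s` controlled by `R`, for which
      -- `t` is the borrowed qubit.
      obtain ⟨L, hL, hrun⟩ := exists_mcx (m - 1) R s t hR hsR htR hst.symm
      have hrun' : run L = mcxAct R s := funext hrun
      have e : phaseOp (insert s (insert t R)) (fun _ => true) (v * v) =
          phaseOp {s, t} (fun _ => true) v * (phaseOp (insert t R) (fun _ => true) v *
            (permOp (run L) * phaseOp {s, t} (fun _ => true) v⁻¹ * permOp (run L))) := by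
        unfold phaseOp
        rw [hrun', permOp_diagOp _ (mcxAct_involutive hsR), diagOp_mul, diagOp_mul]
        congr 1
        ext x
        simp only [comp_apply, mcxAct, Finset.forall_mem_insert, Finset.mem_singleton,
          forall_eq, update_self, ne_eq, hst.symm, not_false_eq_true, update_of_ne]
        by_cases h : ∀ i ∈ R, x i = true
        · cases hs : x s <;> cases ht : x t <;> simp only [eq_true h] <;> simp [hv0]
        · cases hs : x s <;> cases ht : x t <;> simp only [h] <;> simp [hv0]
      rw [e]
      have hpair : ∀ {z : ℂ}, ‖z‖ = 1 → Reach (basicOps Q) 5 (phaseOp {s, t} (fun _ => true) z) :=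
        reach_phaseOp_pair hst
      refine ((hpair hv).mul ((ih _ v hT hv).mul
        (((reach_run L).mul (hpair (by simpa using hv))).mul (reach_run L)))).mono ?_
      have h1 : max 1 ((m - 1 - 1) ^ 4) ≤ (m + 1) ^ 4 :=
        max_le (Nat.one_le_pow _ _ (by omega)) (Nat.pow_le_pow_left (by omega) 4)
      have h2 : phaseCost m ≤ (m + 1) * (2 * (m + 1) ^ 4 + 10) := by
        unfold phaseCost
        gcongr
        omega
      have h3 : phaseCost (m + 1) =
          (m + 1) * (2 * (m + 1) ^ 4 + 10) + (2 * (m + 1) ^ 4 + 10) := by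
        unfold phaseCost; ring
      omega

lemma exists_flip (F : Finset Q) : ∃ L : List (CGate Q), L.length = F.card ∧
    ∀ x, run L x = fun q => if q ∈ F then !x q else x q := by
  induction F using Finset.induction_on with
  | empty => exact ⟨[], by simp⟩
  | insert a F ha ih =>
    obtain ⟨L, h1, h2⟩ := ih
    refine ⟨CGate.not a :: L, by simp [h1, ha], fun x => ?_⟩
    rw [run_cons, h2]
    ext q
    by_cases hq : q = a
    · subst hq; simp [CGate.act, notAct, ha]
    · simp [CGate.act, notAct, hq]

lemma reach_phaseOp (S : Finset Q) (b : Q → Bool) {w : ℂ} (hw : ‖w‖ = 1) :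
    Reach (basicOps Q) (2 * S.card + phaseCost S.card) (phaseOp S b w) := by
  obtain ⟨L, h1, h2⟩ := exists_flip (S.filter fun q => b q = false)
  have h2' : run L = fun x q => if q ∈ S.filter (fun q => b q = false) then !x q else x q :=
    funext h2
  have hinv : Involutive (run L) := fun x => by
    rw [h2']; ext q; simp only; split_ifs <;> simp
  have e : phaseOp S b w =
      permOp (run L) * phaseOp S (fun _ => true) w * permOp (run L) := by
    unfold phaseOp
    rw [permOp_diagOp _ hinv]
    congr 1
    ext x
    simp only [comp_apply, h2']
    congr 1
    refine propext (forall₂_congr fun s hs => ?_)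
    cases hb : b s <;> simp [hs, hb]
  have h3 : L.length ≤ S.card := h1.trans_le (Finset.card_filter_le _ _)
  rw [e]
  exact (((reach_run L).mul (reach_phaseOp_true _ S w rfl hw)).mul (reach_run L)).mono (by omega)

/-- The matrix `U` applied to the qubit `t`, on all labels which agree with `b` on the set `S`. -/
def ctrlOp (S : Finset Q) (b : Q → Bool) (t : Q) (U : Matrix Bool Bool ℂ) : Op (Q → Bool) where
  toFun X x := if ∀ s ∈ S, x s = b s then oneOp t U X x else X x
  map_add' X Y := by ext x; rw [map_add, Pi.add_apply, Pi.add_apply, Pi.add_apply]; split_ifs <;> rfl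
  map_smul' c X := by ext x; rw [map_smul]; simp only [Pi.smul_apply]; split_ifs <;> rfl

lemma ctrlOp_apply (S : Finset Q) (b : Q → Bool) (t : Q) (U : Matrix Bool Bool ℂ)
    (X : (Q → Bool) → ℂ) (x : Q → Bool) :
    ctrlOp S b t U X x = if ∀ s ∈ S, x s = b s then oneOp t U X x else X x := rfl

lemma ctrlOp_mul {S : Finset Q} {t : Q} (h : t ∉ S) (b : Q → Bool) (U V : Matrix Bool Bool ℂ) :
    ctrlOp S b t U * ctrlOp S b t V = ctrlOp S b t (U * V) := by
  have hu : ∀ x c, (∀ s ∈ S, update x t c s = b s) ↔ ∀ s ∈ S, x s = b s := fun x c =>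
    forall₂_congr fun s hs => by rw [update_of_ne (ne_of_mem_of_not_mem hs h)]
  refine op_ext fun X x => ?_
  rw [Module.End.mul_apply, ctrlOp_apply, ctrlOp_apply, ctrlOp_apply]
  by_cases hx : ∀ s ∈ S, x s = b s
  · rw [if_pos hx, if_pos hx, ← oneOp_mul, Module.End.mul_apply, oneOp_apply, oneOp_apply]
    exact Finset.sum_congr rfl fun c _ => by rw [ctrlOp_apply, if_pos ((hu x c).2 hx)]
  · rw [if_neg hx, if_neg hx, if_neg hx]

lemma ctrlOp_one (S : Finset Q) (b : Q → Bool) (t : Q) : ctrlOp S b t 1 = 1 :=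
  op_ext fun X x => by rw [ctrlOp_apply, oneOp_one]; simp

lemma ctrlOp_empty (b : Q → Bool) (t : Q) (U : Matrix Bool Bool ℂ) :
    ctrlOp ∅ b t U = oneOp t U := op_ext fun X x => by rw [ctrlOp_apply]; simp

/-- The conjugating gates need no controls: where the condition fails they cancel each other. -/
lemma ctrlOp_conj {S : Finset Q} {t : Q} (h : t ∉ S) (b : Q → Bool)
    {W W' : Matrix Bool Bool ℂ} (hW : W * W' = 1) (D : Matrix Bool Bool ℂ) :
    oneOp t W * ctrlOp S b t D * oneOp t W' = ctrlOp S b t (W * D * W') := by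
  have hu : ∀ x c, (∀ s ∈ S, update x t c s = b s) ↔ ∀ s ∈ S, x s = b s := fun x c =>
    forall₂_congr fun s hs => by rw [update_of_ne (ne_of_mem_of_not_mem hs h)]
  refine op_ext fun X x => ?_
  rw [Module.End.mul_apply, Module.End.mul_apply, ctrlOp_apply, oneOp_apply]
  simp only [ctrlOp_apply, hu]
  by_cases hx : ∀ s ∈ S, x s = b s
  · simp only [if_pos hx]
    rw [← oneOp_mul, ← oneOp_mul, Module.End.mul_apply, Module.End.mul_apply, oneOp_apply]
  · simp only [if_neg hx]
    rw [← oneOp_apply, ← Module.End.mul_apply, oneOp_mul, hW, oneOp_one, Module.End.one_apply]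

lemma ctrlOp_diagonal {S : Finset Q} {t : Q} (h : t ∉ S) (b : Q → Bool) (w : ℂ) :
    ctrlOp S b t (Matrix.diagonal fun c => if c then 1 else w) =
      phaseOp (insert t S) (update b t false) w := by
  refine op_ext fun X x => ?_
  have hu : (∀ s ∈ S, x s = update b t false s) ↔ ∀ s ∈ S, x s = b s :=
    forall₂_congr fun s hs => by rw [update_of_ne (ne_of_mem_of_not_mem hs h)]
  rw [ctrlOp_apply, oneOp_diagonal, phaseOp]
  simp only [diagOp_apply, Finset.forall_mem_insert, update_self, hu]
  by_cases hx : ∀ s ∈ S, x s = b s <;> cases hxt : x t <;> simp only [hx] <;> simp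

/-- A unitary matrix with first column `w`. -/
def firstColumn (w : Bool → ℂ) : Matrix Bool Bool ℂ :=
  fun a b => if b then (if a then star (w false) else -star (w true)) else w a

lemma firstColumn_mem {w : Bool → ℂ} (hw : star w ⬝ᵥ w = 1) :
    firstColumn w ∈ Matrix.unitaryGroup Bool ℂ := by
  rw [Matrix.mem_unitaryGroup_iff']
  simp only [dotProduct, Fintype.sum_bool, Pi.star_apply] at hw
  ext a b
  cases a <;> cases b <;> simp [Matrix.mul_apply, firstColumn] at hw ⊢
  · linear_combination hw
  · ring
  · ring
  · linear_combination hw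

lemma reflection_eq_conj {w : Bool → ℂ} (hw : star w ⬝ᵥ w = 1) (ω : ℂ) :
    reflection w ω = firstColumn w * (Matrix.diagonal fun c => if c then 1 else ω) *
      (firstColumn w).conjTranspose := by
  simp only [dotProduct, Fintype.sum_bool, Pi.star_apply] at hw
  ext a b
  cases a <;> cases b <;>
    simp [Matrix.mul_apply, firstColumn, reflection, Matrix.vecMulVec_apply,
      Matrix.diagonal_apply] at hw ⊢
  · linear_combination - hw
  · ring
  · ring
  · linear_combination - hw

/-- The number of gates sufficient for a multiply controlled gate on `n` qubits. -/
def ctrlCost (n : ℕ) : ℕ := 2 * (2 + (2 * n + phaseCost n))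

lemma phaseCost_mono : Monotone phaseCost := fun m n h => by unfold phaseCost; gcongr

variable [Fintype Q]

theorem reach_ctrlOp {S : Finset Q} {t : Q} (h : t ∉ S) (b : Q → Bool) {U : Matrix Bool Bool ℂ}
    (hU : U ∈ Matrix.unitaryGroup Bool ℂ) :
    Reach (basicOps Q) (ctrlCost (Fintype.card Q)) (ctrlOp S b t U) := by
  let f : Matrix Bool Bool ℂ →* Op (Q → Bool) :=
    { toFun := ctrlOp S b t
      map_one' := ctrlOp_one S b t
      map_mul' := fun U V => (ctrlOp_mul h b U V).symm }
  -- A reflection is a diagonal matrix in a suitable basis, so its controlled version is a multiply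
  -- controlled phase between two uncontrolled changes of basis.
  have h1 : Reach (reflections Bool) 2 U := reach_reflections 2 ∅ (by simp) U hU (by simp)
  have h2 := h1.map f (B := {T | ∃ R ∈ reflections Bool, T = f R}) fun R hR => ⟨R, hR, rfl⟩
  refine h2.subst ?_
  rintro _ ⟨_, ⟨w, ω, hw, hω, rfl⟩, rfl⟩
  have hW := firstColumn_mem hw
  have e : f (reflection w ω) = oneOp t (firstColumn w) *
      phaseOp (insert t S) (update b t false) ω * oneOp t (firstColumn w).conjTranspose := by
    rw [← ctrlOp_diagonal h, ctrlOp_conj h b, ← reflection_eq_conj hw]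
    · rfl
    · exact Matrix.mem_unitaryGroup_iff.1 hW
  rw [e]
  have hcard : (insert t S).card ≤ Fintype.card Q := Finset.card_le_univ _
  have := phaseCost_mono hcard
  exact (((reach_oneOp t hW).mul (reach_phaseOp _ _ hω)).mul
    (reach_oneOp t (Unitary.star_mem hW))).mono (by omega)

end

/-! ### Multiply controlled gates as generators -/

section
variable {Q : Type} [DecidableEq Q]

/-- Multiply controlled one-qubit gates and multiply controlled phases. -/
def mcOps (Q : Type) [DecidableEq Q] : Set (Op (Q → Bool)) :=
  {T | (∃ S b t, ∃ U ∈ Matrix.unitaryGroup Bool ℂ, t ∉ S ∧ T = ctrlOp S b t U) ∨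
    ∃ S b w, ‖w‖ = 1 ∧ T = phaseOp S b w}

lemma mcOps_inv (T : Op (Q → Bool)) (hT : T ∈ mcOps Q) : ∃ T' ∈ mcOps Q, T * T' = 1 ∧ T' * T = 1 := by
  obtain ⟨S, b, t, U, hU, ht, rfl⟩ | ⟨S, b, w, hw, rfl⟩ := hT
  · refine ⟨_, Or.inl ⟨S, b, t, star U, Unitary.star_mem hU, ht, rfl⟩, ?_, ?_⟩
    · rw [ctrlOp_mul ht, Matrix.mem_unitaryGroup_iff.1 hU, ctrlOp_one]
    · rw [ctrlOp_mul ht, Matrix.mem_unitaryGroup_iff'.1 hU, ctrlOp_one]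
  · have h0 : w ≠ 0 := fun h => by simp [h] at hw
    refine ⟨_, Or.inr ⟨S, b, w⁻¹, by simpa using hw, rfl⟩, ?_, ?_⟩ <;>
    · rw [phaseOp, phaseOp, diagOp_mul]
      refine op_ext fun X x => ?_
      rw [diagOp_apply]
      split_ifs <;> simp [h0]

lemma oneOp_mem_mcOps (t : Q) {U : Matrix Bool Bool ℂ} (hU : U ∈ Matrix.unitaryGroup Bool ℂ) :
    oneOp t U ∈ mcOps Q :=
  Or.inl ⟨∅, fun _ => true, t, U, hU, by simp, (ctrlOp_empty _ _ _).symm⟩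

/-- The matrix of NOT. -/
def notMatrix : Matrix Bool Bool ℂ := fun a b => if a = !b then 1 else 0

lemma notMatrix_mem : notMatrix ∈ Matrix.unitaryGroup Bool ℂ := by
  rw [Matrix.mem_unitaryGroup_iff']
  ext a b
  cases a <;> cases b <;> simp [Matrix.mul_apply, notMatrix]

lemma permOp_notAct (q : Q) : permOp (notAct q) = oneOp q notMatrix := by
  refine op_ext fun X x => ?_
  rw [oneOp_apply]
  cases hx : x q <;> simp [hx, notAct, notMatrix]

lemma permOp_cnotAct_mem {c t : Q} (h : c ≠ t) : permOp (cnotAct c t) ∈ mcOps Q := by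
  refine Or.inl ⟨{c}, fun _ => true, t, notMatrix, notMatrix_mem, by simpa using h.symm, ?_⟩
  refine op_ext fun X x => ?_
  rw [ctrlOp_apply, ← permOp_notAct]
  cases hx : x c
  · simp [cnotAct, hx]
  · simp [cnotAct, notAct, hx]

variable [Fintype Q]

lemma scales_of_reach {Z : Type} [Fintype Z] {A : Set (Op Z)} (hA : ∀ a ∈ A, Scales 1 a) {K : ℕ}
    {S : Op Z} (h : Reach A K S) : Scales 1 S := by
  obtain ⟨L, -, h2, rfl⟩ := h
  induction L with
  | nil => exact scales_one
  | cons a L ih =>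
    rw [List.prod_cons]
    simpa using (hA a (h2 a (by simp))).mul (ih fun s hs => h2 s (by simp [hs]))

lemma scales_basicOps (S : Op (Q → Bool)) (h : S ∈ basicOps Q) : Scales 1 S := by
  obtain ⟨q, U, hU, rfl⟩ | ⟨g, rfl⟩ | ⟨z, hz, rfl⟩ := h
  · exact scales_oneOp_unitary q hU
  · exact scales_permOp _ g.act_involutive.bijective
  · rw [← diagOp_const]; exact scales_diagOp _ fun _ => hz

lemma reach_mcOps (T : Op (Q → Bool)) (hT : T ∈ mcOps Q) :
    Reach (basicOps Q) (ctrlCost (Fintype.card Q)) T := by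
  obtain ⟨S, b, t, U, hU, ht, rfl⟩ | ⟨S, b, w, hw, rfl⟩ := hT
  · exact reach_ctrlOp ht b hU
  · have hS : S.card ≤ Fintype.card Q := Finset.card_le_univ S
    have := phaseCost_mono hS
    exact (reach_phaseOp S b hw).mono (by unfold ctrlCost; omega)

lemma scales_mcOps (T : Op (Q → Bool)) (hT : T ∈ mcOps Q) : Scales 1 T :=
  scales_of_reach scales_basicOps (reach_mcOps T hT)

end

lemma star_dotProduct_self {Z : Type} [Fintype Z] (X : Z → ℂ) :
    star X ⬝ᵥ X = ((nrm X ^ 2 : ℝ) : ℂ) := by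
  rw [nrm_sq, dotProduct]; push_cast
  exact Finset.sum_congr rfl fun b _ => by
    rw [Pi.star_apply, ← Complex.conj_mul']; rfl

/-- Polarization, from the norms of `X + Y` and `X + iY`. -/
lemma Scales.dotProduct {Z : Type} [Fintype Z] {T : Op Z} (hT : Scales 1 T) (X Y : Z → ℂ) :
    star (T X) ⬝ᵥ T Y = star X ⬝ᵥ Y := by
  have h : ∀ V, star (T V) ⬝ᵥ T V = star V ⬝ᵥ V := fun V => by
    rw [star_dotProduct_self, star_dotProduct_self, hT, one_mul]
  have h1 := h (X + Y)
  have h2 := h (X + Complex.I • Y)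
  have h3 := h X
  have h4 := h Y
  simp only [map_add, map_smul, star_add, star_smul, add_dotProduct, dotProduct_add,
    smul_dotProduct, dotProduct_smul, h3, h4, smul_eq_mul] at h1 h2
  have hI : star Complex.I = -Complex.I := by simp
  rw [hI] at h2
  have hII := Complex.I_mul_I
  linear_combination (1 / 2 : ℂ) * h1 - (Complex.I / 2) * h2 -
    (1 / 2 : ℂ) * (star X ⬝ᵥ Y - star (T X) ⬝ᵥ T Y - star Y ⬝ᵥ X + star (T Y) ⬝ᵥ T X) * hII

/-! ### Operators on a part of the qubits -/

section
variable {Z C Y : Type}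

/-- An operator on one factor, applied if the other factor satisfies the condition `c`. -/
def lift (e : Z ≃ C × Y) (c : C → Bool) : Op Y →* Op Z where
  toFun S :=
    { toFun := fun X z =>
        if c (e z).1 then S (fun y => X (e.symm ((e z).1, y))) (e z).2 else X z
      map_add' := fun X X' => by
        ext z
        by_cases h : c (e z).1
        · simp only [h, if_true, Pi.add_apply]
          exact congrFun (S.map_add (fun y => X (e.symm ((e z).1, y)))
            fun y => X' (e.symm ((e z).1, y))) _
        · simp [h]
      map_smul' := fun a X => by
        ext z
        by_cases h : c (e z).1
        · simp only [h, if_true, Pi.smul_apply]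
          exact congrFun (S.map_smul a fun y => X (e.symm ((e z).1, y))) _
        · simp [h] }
  map_one' := op_ext fun X z => by simp
  map_mul' S T := op_ext fun X z => by
    by_cases h : c (e z).1 <;> simp [h]

lemma lift_apply (e : Z ≃ C × Y) (c : C → Bool) (S : Op Y) (X : Z → ℂ) (z : Z) :
    lift e c S X z =
      if c (e z).1 then S (fun y => X (e.symm ((e z).1, y))) (e z).2 else X z := rfl

end

section
variable {Q Q' C : Type} [DecidableEq Q] [DecidableEq Q']

/-- The equivalence `e` splits off the qubits embedded by `j`, and the condition `c` says that the
qubits of `R` agree with `b'`. -/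
structure Splits (e : (Q' → Bool) ≃ C × (Q → Bool)) (c : C → Bool) (j : Q ↪ Q') (R : Finset Q')
    (b' : Q' → Bool) : Prop where
  disj : ∀ q, j q ∉ R
  snd : ∀ z q, (e z).2 q = z (j q)
  cond : ∀ z, c (e z).1 = true ↔ ∀ s ∈ R, z s = b' s
  upd : ∀ z q v, e (update z (j q) v) = ((e z).1, update (e z).2 q v)

variable {e : (Q' → Bool) ≃ C × (Q → Bool)} {c : C → Bool} {j : Q ↪ Q'} {R : Finset Q'}
  {b' : Q' → Bool}

lemma Splits.cond_iff (h : Splits e c j R b') (S : Finset Q) (b : Q → Bool) (z : Q' → Bool) :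
    (∀ s ∈ R ∪ S.map j, z s = extend j b b' s) ↔
      c (e z).1 = true ∧ ∀ s ∈ S, (e z).2 s = b s := by
  rw [Finset.forall_mem_union, h.cond]
  refine and_congr (forall₂_congr fun s hs => ?_) ?_
  · rw [extend_apply' _ _ _ fun ⟨a, ha⟩ => h.disj a (ha ▸ hs)]
  · simp [h.snd, j.injective.extend_apply]

/-- The qubits of `R` merely join the controls. Hence imposing a condition on a whole circuit does
not change the number of multiply controlled gates; this is why gates are first counted in `mcOps`
and expanded only at the end. -/
lemma Splits.lift_mem (h : Splits e c j R b') (T : Op (Q → Bool)) (hT : T ∈ mcOps Q) :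
    lift e c T ∈ mcOps Q' := by
  obtain ⟨S, b, t, U, hU, ht, rfl⟩ | ⟨S, b, w, hw, rfl⟩ := hT
  · refine Or.inl ⟨R ∪ S.map j, extend j b b', j t, U, hU, by simp [h.disj, ht], ?_⟩
    refine op_ext fun X z => ?_
    rw [lift_apply, ctrlOp_apply, ctrlOp_apply]
    simp only [h.cond_iff, oneOp_apply]
    by_cases h1 : c (e z).1 = true
    · by_cases h2 : ∀ s ∈ S, (e z).2 s = b s
      · rw [if_pos h1, if_pos h2, if_pos ⟨h1, h2⟩, h.snd]
        refine Finset.sum_congr rfl fun v _ => ?_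
        rw [← h.upd, Equiv.symm_apply_apply]
      · rw [if_pos h1, if_neg h2, if_neg fun h => h2 h.2]
        simp
    · rw [if_neg h1, if_neg fun h => h1 h.1]
  · refine Or.inr ⟨R ∪ S.map j, extend j b b', w, hw, ?_⟩
    refine op_ext fun X z => ?_
    rw [lift_apply]
    simp only [phaseOp, diagOp_apply, h.cond_iff]
    by_cases h1 : c (e z).1 = true
    · by_cases h2 : ∀ s ∈ S, (e z).2 s = b s
      · rw [if_pos h1, if_pos h2, if_pos ⟨h1, h2⟩]; simp
      · rw [if_pos h1, if_neg h2, if_neg fun h => h2 h.2]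
        simp
    · rw [if_neg h1, if_neg fun h => h1 h.1, one_mul]

lemma Splits.reach (h : Splits e c j R b') {K : ℕ} {T : Op (Q → Bool)}
    (hT : Reach (mcOps Q) K T) : Reach (mcOps Q') K (lift e c T) := hT.map _ h.lift_mem

end

/-- The lowest qubit split off. -/
def consSplit (n : ℕ) : (Fin (n + 1) → Bool) ≃ Bool × (Fin n → Bool) where
  toFun z := (z 0, fun i => z i.succ)
  invFun p := Fin.cons p.1 p.2
  left_inv z := Fin.cons_self_tail z
  right_inv p := by simp

@[simp] lemma consSplit_apply (n : ℕ) (z : Fin (n + 1) → Bool) :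
    consSplit n z = (z 0, fun i => z i.succ) := rfl

@[simp] lemma consSplit_symm_apply (n : ℕ) (p : Bool × (Fin n → Bool)) :
    (consSplit n).symm p = Fin.cons p.1 p.2 := rfl

/-- The `ℓ` lowest qubits as the second factor. -/
def lowSplit (ℓ m : ℕ) : (Fin (ℓ + m) → Bool) ≃ (Fin m → Bool) × (Fin ℓ → Bool) where
  toFun z := (fun i => z (Fin.natAdd ℓ i), fun i => z (Fin.castAdd m i))
  invFun p := Fin.append p.2 p.1
  left_inv z := Fin.append_castAdd_natAdd
  right_inv p := by simp

/-- The `ℓ` lowest qubits as the first factor. -/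
def highSplit (ℓ m : ℕ) : (Fin (ℓ + m) → Bool) ≃ (Fin ℓ → Bool) × (Fin m → Bool) :=
  (lowSplit ℓ m).trans (Equiv.prodComm _ _)

lemma splits_cons (n : ℕ) (v : Bool) :
    Splits (consSplit n) (fun b => b == v) (Fin.succEmb n) {0} (fun _ => v) where
  disj q := by simp
  snd z q := rfl
  cond z := by simp
  upd z q v := by
    refine Prod.ext ?_ ?_
    · exact update_of_ne (Fin.succ_ne_zero q).symm v z
    · ext i
      by_cases h : i = q
      · subst h; simp
      · simp [h]

lemma castAdd_ne_natAdd {ℓ m : ℕ} (i : Fin ℓ) (k : Fin m) : Fin.castAdd m i ≠ Fin.natAdd ℓ k := by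
  intro h
  have := congrArg Fin.val h
  simp at this
  omega

lemma splits_low (ℓ m : ℕ) :
    Splits (lowSplit ℓ m) (fun _ => true) (Fin.castAddEmb m) ∅ (fun _ => true) where
  disj q := by simp
  snd z q := rfl
  cond z := by simp
  upd z q v := by
    refine Prod.ext ?_ ?_
    · ext i
      simp [lowSplit, (castAdd_ne_natAdd q i).symm]
    · ext i
      by_cases h : i = q
      · subst h; simp [lowSplit]
      · simp [lowSplit, h]

lemma splits_high (ℓ m : ℕ) :
    Splits (highSplit ℓ m) (fun _ => true) (Fin.natAddEmb ℓ) ∅ (fun _ => true) where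
  disj q := by simp
  snd z q := rfl
  cond z := by simp
  upd z q v := by
    refine Prod.ext ?_ ?_
    · ext i
      simp [lowSplit, highSplit, castAdd_ne_natAdd i q]
    · ext i
      by_cases h : i = q
      · subst h; simp [lowSplit, highSplit]
      · simp [lowSplit, highSplit, h]

lemma splits_high_zero (ℓ m : ℕ) :
    Splits (highSplit ℓ m) (fun y => decide (y = fun _ => false)) (Fin.natAddEmb ℓ)
      (Finset.univ.map (Fin.castAddEmb m)) (fun _ => false) where
  disj q := by simp [castAdd_ne_natAdd]
  snd z q := rfl
  cond z := by simp [highSplit, lowSplit, funext_iff]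
  upd := (splits_high ℓ m).upd


/-! ### All unitary matrices of fixed size -/

lemma Reach.mem {M : Type} [Monoid M] {A : Set M} {K : ℕ} {S : M} (h : Reach A K S)
    {G : Submonoid M} (hA : A ⊆ G) : S ∈ G := by
  obtain ⟨L, -, h2, rfl⟩ := h
  exact Submonoid.list_prod_mem _ fun s hs => hA (h2 s hs)

/-- The basis state `0 … 0`. -/
def zeroState (Q : Type) [DecidableEq Q] [Fintype Q] : (Q → Bool) → ℂ :=
  fun x => if x = fun _ => false then 1 else 0

lemma exists_normalize {Z : Type} [Fintype Z] [Nonempty Z] (v : Z → ℂ) :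
    ∃ u : Z → ℂ, nrm u = 1 ∧ v = ((nrm v : ℝ) : ℂ) • u := by
  classical
  obtain h | h := eq_or_ne (nrm v) 0
  · obtain ⟨z⟩ := ‹Nonempty Z›
    refine ⟨Pi.single z 1, ?_, ?_⟩
    · have : nrm (Pi.single z 1 : Z → ℂ) ^ 2 = 1 := by
        rw [nrm_sq, Finset.sum_eq_single z (fun x _ hx => by simp [hx]) (by simp)]
        simp
      exact (pow_eq_one_iff_of_nonneg (nrm_nonneg _) two_ne_zero).1 this
    · have h2 := nrm_sq v
      rw [h, zero_pow two_ne_zero, eq_comm, Finset.sum_eq_zero_iff_of_nonneg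
        (fun _ _ => by positivity)] at h2
      ext x
      rw [h]
      simpa using h2 x (Finset.mem_univ x)
  · have h0 : ((nrm v : ℝ) : ℂ) ≠ 0 := by simpa using h
    refine ⟨((nrm v : ℝ) : ℂ)⁻¹ • v, ?_, by rw [smul_smul, mul_inv_cancel₀ h0, one_smul]⟩
    rw [nrm_smul, norm_inv, Complex.norm_real, Real.norm_of_nonneg (nrm_nonneg v),
      inv_mul_cancel₀ h]

lemma nrm_sq_cons {n : ℕ} (v : (Fin (n + 1) → Bool) → ℂ) :
    nrm v ^ 2 = nrm (fun y => v (Fin.cons false y)) ^ 2 +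
      nrm (fun y => v (Fin.cons true y)) ^ 2 := by
  rw [nrm_sq, nrm_sq, nrm_sq, ← (consSplit n).symm.sum_comp, Fintype.sum_prod_type,
    Fintype.sum_bool, add_comm]
  rfl

lemma lift_consSplit_apply {n : ℕ} (v : Bool) (S : Op (Fin n → Bool))
    (X : (Fin (n + 1) → Bool) → ℂ) (z : Fin (n + 1) → Bool) :
    lift (consSplit n) (fun b => b == v) S X z =
      if z 0 = v then S (fun y => X (Fin.cons v y)) (Fin.tail z) else X z := by
  rw [lift_apply]
  simp only [consSplit_apply, consSplit_symm_apply, beq_iff_eq]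
  split_ifs with h
  · rw [h]; rfl
  · rfl

/-- Multiply controlled gates can prepare every state. -/
theorem exists_prepare (ℓ : ℕ) : ∀ v : (Fin ℓ → Bool) → ℂ, nrm v = 1 →
    ∃ K, ∃ T, Reach (mcOps (Fin ℓ)) K T ∧ T (zeroState (Fin ℓ)) = v := by
  induction ℓ with
  | zero =>
    intro v hv
    have h1 : ‖v (fun _ => false)‖ = 1 := by
      have := nrm_sq v
      rw [hv, Fintype.sum_unique, eq_comm] at this
      rw [one_pow] at this
      have := (pow_eq_one_iff_of_nonneg (norm_nonneg _) two_ne_zero).1 this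
      exact (congrArg (fun x => ‖v x‖) (Subsingleton.elim _ _)).trans this
    refine ⟨1, _, reach_of_mem (Or.inr ⟨∅, fun _ => true, v (fun _ => false), h1, rfl⟩), ?_⟩
    ext x
    have hx : x = fun _ => false := Subsingleton.elim _ _
    simp [phaseOp, zeroState, hx]
  | succ ℓ ih =>
    intro v hv
    obtain ⟨u, hu, hvu⟩ := exists_normalize fun y => v (Fin.cons false y)
    obtain ⟨u', hu', hvu'⟩ := exists_normalize fun y => v (Fin.cons true y)
    have hsq := nrm_sq_cons v
    rw [hv, one_pow] at hsq
    set α := nrm fun y => v (Fin.cons false y)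
    set β := nrm fun y => v (Fin.cons true y)
    obtain ⟨K, T, hT, hTu⟩ := ih u hu
    obtain ⟨K', T', hT', hTu'⟩ := ih u' hu'
    -- The lowest qubit receives the norms of the two halves as amplitudes; then each normalized
    -- half is prepared under control of that qubit. Complex phases enter only for `ℓ = 0`.
    set w : Bool → ℂ := fun b => if b then (β : ℂ) else (α : ℂ) with hw
    have hw1 : star w ⬝ᵥ w = 1 := by
      have : ((α ^ 2 + β ^ 2 : ℝ) : ℂ) = 1 := by rw [← hsq]; simp
      push_cast at this
      simp [dotProduct, hw]
      linear_combination this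
    refine ⟨K' + (K + 1), lift (consSplit ℓ) (fun b => b == true) T' *
      (lift (consSplit ℓ) (fun b => b == false) T * oneOp 0 (firstColumn w)), ?_, ?_⟩
    · exact ((splits_cons ℓ true).reach hT').mul (((splits_cons ℓ false).reach hT).mul
        (reach_of_mem (oneOp_mem_mcOps 0 (firstColumn_mem hw1))))
    · have h1 : ∀ z, oneOp 0 (firstColumn w) (zeroState (Fin (ℓ + 1))) z =
          w (z 0) * zeroState (Fin ℓ) (Fin.tail z) := by
        intro z
        have e : ∀ b, (update z 0 b = fun _ => false) ↔
            b = false ∧ Fin.tail z = fun _ => false := by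
          intro b
          constructor
          · intro h
            refine ⟨by simpa using congrFun h 0, ?_⟩
            ext i
            simpa [Fin.tail] using congrFun h i.succ
          · rintro ⟨rfl, h⟩
            ext i
            refine Fin.cases (by simp) (fun i => ?_) i
            simpa [Fin.tail] using congrFun h i
        simp only [oneOp_apply, zeroState, Fintype.sum_bool, e]
        simp [firstColumn]
      ext z
      obtain ⟨b, y, rfl⟩ : ∃ b y, z = Fin.cons b y := ⟨z 0, Fin.tail z, (Fin.cons_self_tail z).symm⟩
      rw [Module.End.mul_apply, Module.End.mul_apply]
      cases b
      · rw [lift_consSplit_apply, if_neg (by simp), lift_consSplit_apply, if_pos (by simp)]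
        have : (fun y : Fin ℓ → Bool => oneOp 0 (firstColumn w) (zeroState (Fin (ℓ + 1)))
            (Fin.cons false y)) = (α : ℂ) • zeroState (Fin ℓ) := by
          ext y; rw [h1]; simp [hw]
        rw [this, map_smul, hTu, Fin.tail_cons, ← hvu]
      · rw [lift_consSplit_apply, if_pos (by simp)]
        have : (fun y : Fin ℓ → Bool => lift (consSplit ℓ) (fun b => b == false) T
            (oneOp 0 (firstColumn w) (zeroState (Fin (ℓ + 1)))) (Fin.cons true y)) =
            (β : ℂ) • zeroState (Fin ℓ) := by
          ext y; rw [lift_consSplit_apply, if_neg (by simp), h1]; simp [hw]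
        rw [this, map_smul, hTu', Fin.tail_cons, ← hvu']

lemma zeroState_dotProduct {Q : Type} [DecidableEq Q] [Fintype Q] (Y : (Q → Bool) → ℂ) :
    star (zeroState Q) ⬝ᵥ Y = Y fun _ => false := by
  simp [dotProduct, zeroState, apply_ite]

lemma nrm_eq_one_of_dotProduct {Z : Type} [Fintype Z] {w : Z → ℂ} (hw : star w ⬝ᵥ w = 1) :
    nrm w = 1 := by
  rw [star_dotProduct_self] at hw
  exact (pow_eq_one_iff_of_nonneg (nrm_nonneg w) two_ne_zero).1 (by exact_mod_cast hw)

/-- Every unitary matrix is a product of multiply controlled gates. -/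
theorem exists_reach_unitary {ℓ : ℕ} {U : Matrix (Fin ℓ → Bool) (Fin ℓ → Bool) ℂ}
    (hU : U ∈ Matrix.unitaryGroup (Fin ℓ → Bool) ℂ) :
    ∃ K, Reach (mcOps (Fin ℓ)) K (Matrix.toLinAlgEquiv' U) := by
  have h1 := reach_reflections _ (∅ : Finset (Fin ℓ → Bool)) rfl U hU (by simp)
  let f : Matrix (Fin ℓ → Bool) (Fin ℓ → Bool) ℂ →* Op (Fin ℓ → Bool) :=
    (Matrix.toLinAlgEquiv' : Matrix (Fin ℓ → Bool) (Fin ℓ → Bool) ℂ ≃ₐ[ℂ] _).toMonoidHom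
  refine exists_reach_of_mem_closure
    ((h1.map f (B := Submonoid.closure (mcOps (Fin ℓ))) ?_).mem le_rfl)
  rintro _ ⟨w, ω, hw, hω, rfl⟩
  obtain ⟨K, T, hT, hTw⟩ := exists_prepare ℓ w (nrm_eq_one_of_dotProduct hw)
  obtain ⟨T', hT', h2, h3⟩ := hT.exists_inv mcOps_inv
  have hs := scales_of_reach scales_mcOps hT
  -- Since `T` carries the state `0 … 0` to `w` and is unitary, it carries the phase at that basis
  -- state to the reflection at `w`.
  have e : f (reflection w ω) =
      T * phaseOp Finset.univ (fun _ => false) ω * T' := by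
    refine LinearMap.ext fun X => ?_
    obtain ⟨Y, rfl⟩ : ∃ Y, X = T Y := ⟨T' X, by rw [← Module.End.mul_apply, h2]; rfl⟩
    have hY : T' (T Y) = Y := by rw [← Module.End.mul_apply, h3]; rfl
    rw [Module.End.mul_apply, Module.End.mul_apply, hY]
    have h4 : phaseOp Finset.univ (fun _ => false) ω Y =
        Y + ((ω - 1) * Y fun _ => false) • zeroState (Fin ℓ) := by
      ext x
      simp only [phaseOp, diagOp_apply, Finset.mem_univ, true_imp_iff, zeroState,
        Pi.add_apply, Pi.smul_apply, smul_eq_mul, ← funext_iff (f := x)]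
      split_ifs with h
      · subst h; ring
      · ring
    rw [h4, map_add, map_smul, hTw]
    change (reflection w ω).mulVec (T Y) = _
    rw [reflection_mulVec]
    have := hs.dotProduct (zeroState (Fin ℓ)) Y
    rw [hTw, zeroState_dotProduct] at this
    rw [this]
  have hcl : mcOps (Fin ℓ) ⊆ Submonoid.closure (mcOps (Fin ℓ)) := Submonoid.subset_closure
  rw [e]
  exact mul_mem (mul_mem (hT.mem hcl) (hcl (Or.inr ⟨_, _, ω, hω, rfl⟩))) (hT'.mem hcl)

/-! ### The cyclic shift -/

/-- Addition of `1` modulo `2 ^ m`, the least significant digit being the first. -/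
def incAct : (m : ℕ) → (Fin m → Bool) → Fin m → Bool
  | 0, z => z
  | m + 1, z => Fin.cons (!z 0) (if z 0 then incAct m (Fin.tail z) else Fin.tail z)

lemma reach_incAct (m : ℕ) : Reach (mcOps (Fin m)) m (permOp (incAct m)) := by
  induction m with
  | zero => exact reach_one
  | succ m ih =>
    -- The carry: the higher digits are incremented under control of the lowest one. The control is
    -- free, so each digit costs one gate.
    have : permOp (incAct (m + 1)) = lift (consSplit m) (fun b => b == true) (permOp (incAct m)) *
        permOp (notAct 0) := by
      refine op_ext fun X z => ?_
      rw [Module.End.mul_apply, lift_consSplit_apply]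
      simp only [permOp_apply, incAct]
      have e : ∀ b y, notAct 0 (Fin.cons b y : Fin (m + 1) → Bool) = Fin.cons (!b) y :=
        fun b y => by
          ext i
          refine Fin.cases (by simp [notAct]) (fun i => ?_) i
          simp [notAct]
      obtain ⟨b, y, rfl⟩ : ∃ b y, z = Fin.cons b y :=
        ⟨z 0, Fin.tail z, (Fin.cons_self_tail z).symm⟩
      cases b <;> simp [e]
    rw [this]
    refine ((splits_cons m true).reach ih).mul (reach_of_mem ?_)
    rw [permOp_notAct]
    exact oneOp_mem_mcOps 0 notMatrix_mem

/-! ### Block operators -/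

/-- A matrix on the `ℓ` lowest qubits. -/
def lowHom (ℓ m : ℕ) : Matrix (Fin ℓ → Bool) (Fin ℓ → Bool) ℂ →+* Op (Fin (ℓ + m) → Bool) where
  toFun A := lift (lowSplit ℓ m) (fun _ => true) (Matrix.toLinAlgEquiv' A)
  map_one' := by rw [map_one, map_one]
  map_mul' A B := by rw [map_mul, map_mul]
  map_zero' := op_ext fun X z => by simp [lift_apply]
  map_add' A B := op_ext fun X z => by simp [lift_apply]

/-- The block shift. -/
def blockShift (ℓ m : ℕ) : Op (Fin (ℓ + m) → Bool) :=
  lift (highSplit ℓ m) (fun _ => true) (permOp (incAct m))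

lemma lowHom_apply {ℓ m : ℕ} (A : Matrix (Fin ℓ → Bool) (Fin ℓ → Bool) ℂ)
    (X : (Fin (ℓ + m) → Bool) → ℂ) (y : Fin ℓ → Bool) (q : Fin m → Bool) :
    lowHom ℓ m A X (Fin.append y q) = A.mulVec (fun s => X (Fin.append s q)) y := by
  change lift (lowSplit ℓ m) (fun _ => true) (Matrix.toLinAlgEquiv' A) X _ = _
  rw [lift_apply]
  simp [lowSplit]

lemma blockShift_apply {ℓ m : ℕ} (X : (Fin (ℓ + m) → Bool) → ℂ) (y : Fin ℓ → Bool)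
    (q : Fin m → Bool) :
    blockShift ℓ m X (Fin.append y q) = X (Fin.append y (incAct m q)) := by
  rw [blockShift, lift_apply]
  simp [highSplit, lowSplit]

lemma append_ext {ℓ m : ℕ} {S T : Op (Fin (ℓ + m) → Bool)}
    (h : ∀ X y q, S X (Fin.append y q) = T X (Fin.append y q)) : S = T :=
  op_ext fun X z => by
    have := h X (fun i => z (Fin.castAdd m i)) fun i => z (Fin.natAdd ℓ i)
    rwa [Fin.append_castAdd_natAdd] at this

lemma lowHom_comm_blockShift {ℓ m : ℕ} (A : Matrix (Fin ℓ → Bool) (Fin ℓ → Bool) ℂ) :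
    Commute (lowHom ℓ m A) (blockShift ℓ m) := append_ext fun X y q => by
  rw [Module.End.mul_apply, Module.End.mul_apply, lowHom_apply, blockShift_apply, lowHom_apply]
  congr 1
  ext s
  rw [blockShift_apply]

lemma reach_blockShift (ℓ m : ℕ) : Reach (mcOps (Fin (ℓ + m))) m (blockShift ℓ m) :=
  (splits_high ℓ m).reach (reach_incAct m)

/-- The projection to the line of `v`. -/
def lineProj {κ : Type} (v : κ → ℂ) : Matrix κ κ ℂ := Matrix.vecMulVec v (star v)

/-- The shift of the component in the direction of `v`. -/
theorem exists_reach_lineShift {ℓ : ℕ} (v : (Fin ℓ → Bool) → ℂ) (hv : star v ⬝ᵥ v = 1) :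
    ∃ K, ∀ m, Reach (mcOps (Fin (ℓ + m))) (K + m)
      (lowHom ℓ m (1 - lineProj v) + lowHom ℓ m (lineProj v) * blockShift ℓ m) := by
  obtain ⟨K, T, hT, hTv⟩ := exists_prepare ℓ v (nrm_eq_one_of_dotProduct hv)
  obtain ⟨T', hT', h2, h3⟩ := hT.exists_inv mcOps_inv
  have hs := scales_of_reach scales_mcOps hT
  refine ⟨K + K, fun m => ?_⟩
  -- With `T` mapping the zero state to `v`, the factor is the conjugate under `T` of the shift
  -- restricted to blocks with low qubits `0`. Only the shift depends on `m`.
  have e : lowHom ℓ m (1 - lineProj v) + lowHom ℓ m (lineProj v) * blockShift ℓ m =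
      lift (lowSplit ℓ m) (fun _ => true) T *
        (lift (highSplit ℓ m) (fun y => decide (y = fun _ => false)) (permOp (incAct m)) *
          lift (lowSplit ℓ m) (fun _ => true) T') := by
    refine append_ext fun X y q => ?_
    set Y := lift (lowSplit ℓ m) (fun _ => true) T' X with hY
    have hYq : ∀ q, (fun s => Y (Fin.append s q)) = T' fun s => X (Fin.append s q) := fun q => by
      ext s; rw [hY, lift_apply]; simp [lowSplit]
    have hX : ∀ q, T (fun s => Y (Fin.append s q)) = fun s => X (Fin.append s q) := fun q => by
      rw [hYq, ← Module.End.mul_apply, h2]; rfl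
    have hd : ∀ q, star v ⬝ᵥ (fun s => X (Fin.append s q)) = Y (Fin.append (fun _ => false) q) :=
      fun q => by
        have := hs.dotProduct (zeroState (Fin ℓ)) fun s => Y (Fin.append s q)
        rwa [hTv, zeroState_dotProduct, hX] at this
    have hZ : (fun s => lift (highSplit ℓ m) (fun y => decide (y = fun _ => false))
        (permOp (incAct m)) Y (Fin.append s q)) = (fun s => Y (Fin.append s q)) +
        (Y (Fin.append (fun _ => false) (incAct m q)) - Y (Fin.append (fun _ => false) q)) •
          zeroState (Fin ℓ) := by
      ext s
      rw [lift_apply]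
      simp only [highSplit, lowSplit, Equiv.trans_apply, Equiv.coe_fn_mk, Equiv.prodComm_apply,
        Prod.swap_prod_mk, Fin.append_left, Fin.append_right, decide_eq_true_eq, permOp_apply,
        Equiv.symm_trans_apply, Equiv.prodComm_symm, Equiv.coe_fn_symm_mk, Pi.add_apply,
        Pi.smul_apply, zeroState, smul_eq_mul]
      split_ifs with h
      · obtain rfl : s = fun _ => false := h
        ring
      · ring
    rw [Module.End.mul_apply, Module.End.mul_apply, ← hY, LinearMap.add_apply, Pi.add_apply,
      Module.End.mul_apply, lowHom_apply, lowHom_apply, lift_apply]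
    have hfinal : ∀ V : (Fin (ℓ + m) → Bool) → ℂ,
        T (fun s => V ((lowSplit ℓ m).symm ((lowSplit ℓ m (Fin.append y q)).1, s)))
          (lowSplit ℓ m (Fin.append y q)).2 = T (fun s => V (Fin.append s q)) y := fun V => by
      simp [lowSplit]
    rw [if_pos rfl, hfinal, hZ, map_add, map_smul, hTv, hX, ← hd, ← hd]
    have hb : (fun s => blockShift ℓ m X (Fin.append s q)) =
        fun s => X (Fin.append s (incAct m q)) := by ext s; rw [blockShift_apply]
    rw [hb, lineProj, Matrix.sub_mulVec, Matrix.one_mulVec, Matrix.vecMulVec_mulVec,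
      Matrix.vecMulVec_mulVec, op_smul_eq_smul, op_smul_eq_smul]
    simp only [Pi.add_apply, Pi.sub_apply, Pi.smul_apply, smul_eq_mul]
    ring
  rw [e]
  exact (((splits_low ℓ m).reach hT).mul (((splits_high_zero ℓ m).reach (reach_incAct m)).mul
    ((splits_low ℓ m).reach hT'))).mono (by omega)


/-! ### Factorization of paraunitary sequences of matrices -/

section
variable {κ : Type} [Fintype κ] [DecidableEq κ]

/-- The matrix polynomial with coefficients `p` of degree less than `d` is unitary on the
circle. -/
structure Paraunitary (d : ℕ) (p : ℕ → Matrix κ κ ℂ) : Prop where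
  zero : ∀ j, d ≤ j → p j = 0
  orth : ∀ m, ∑ j ∈ Finset.range d, p j * (p (j + m)).conjTranspose = if m = 0 then 1 else 0

lemma sum_range_shift {A : Type} [AddCommGroup A] (d : ℕ) (f : ℕ → A) (hd : f d = 0) :
    ∑ j ∈ Finset.range d, f (j + 1) = ∑ j ∈ Finset.range d, f j - f 0 := by
  rw [eq_sub_iff_add_eq, ← Finset.sum_range_succ', Finset.sum_range_succ, hd, add_zero]

/-- The degree-like quantity which decreases in the factorization. -/
def weight (d : ℕ) (p : ℕ → Matrix κ κ ℂ) : ℂ :=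
  ∑ j ∈ Finset.range d, (j : ℂ) * ((p j).conjTranspose * p j).trace

lemma weight_nonneg (d : ℕ) (p : ℕ → Matrix κ κ ℂ) : 0 ≤ (weight d p).re := by
  rw [weight, Complex.re_sum]
  refine Finset.sum_nonneg fun j _ => ?_
  have : ((p j).conjTranspose * p j).trace = ((∑ a, ∑ b, ‖p j b a‖ ^ 2 : ℝ) : ℂ) := by
    simp only [Matrix.trace, Matrix.diag, Matrix.mul_apply, Matrix.conjTranspose_apply]
    push_cast
    refine Finset.sum_congr rfl fun a _ => Finset.sum_congr rfl fun b _ => ?_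
    rw [← Complex.conj_mul']; rfl
  rw [this]
  have h : ((j : ℂ) * ((∑ a, ∑ b, ‖p j b a‖ ^ 2 : ℝ) : ℂ)) =
      (((j : ℝ) * ∑ a, ∑ b, ‖p j b a‖ ^ 2 : ℝ) : ℂ) := by push_cast; rfl
  rw [h, Complex.ofReal_re]
  positivity

lemma lineProj_mul_self {v : κ → ℂ} (hv : star v ⬝ᵥ v = 1) :
    lineProj v * lineProj v = lineProj v := by
  rw [lineProj, Matrix.vecMulVec_mul_vecMulVec, hv, one_smul]

lemma conjTranspose_lineProj (v : κ → ℂ) : (lineProj v).conjTranspose = lineProj v := by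
  simp [lineProj]

lemma trace_lineProj {v : κ → ℂ} (hv : star v ⬝ᵥ v = 1) : (lineProj v).trace = 1 := by
  rw [lineProj, Matrix.trace_vecMulVec, dotProduct_comm, hv]

/-- Removal of the factor belonging to `v`. -/
def reduce (v : κ → ℂ) (p : ℕ → Matrix κ κ ℂ) (j : ℕ) : Matrix κ κ ℂ :=
  (1 - lineProj v) * p j + lineProj v * p (j + 1)

variable {d : ℕ} {p : ℕ → Matrix κ κ ℂ} {v : κ → ℂ}

/-- This is multiplication of `p(z)` from the left by `1 - E + z⁻¹ E`, which is unitary on the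
circle; no negative power arises because `E * p 0 = 0`. -/
lemma Paraunitary.reduce (hp : Paraunitary d p) (hv : star v ⬝ᵥ v = 1)
    (h0 : lineProj v * p 0 = 0) : Paraunitary d (reduce v p) where
  zero j hj := by simp [WaveletCircuits.reduce, hp.zero j hj, hp.zero (j + 1) (by omega)]
  orth m := by
    have hE := lineProj_mul_self hv
    have hH := conjTranspose_lineProj v
    set E := lineProj v
    have hE' : E * (1 - E) = 0 := by rw [mul_sub, hE, mul_one, sub_self]
    have hE'' : (1 - E) * E = 0 := by rw [sub_mul, hE, one_mul, sub_self]
    have hE3 : (1 - E) * (1 - E) = 1 - E := by rw [mul_sub, hE'', mul_one, sub_zero]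
    have e : ∀ j, WaveletCircuits.reduce v p j * (WaveletCircuits.reduce v p (j + m)).conjTranspose =
        (1 - E) * (p j * (p (j + m)).conjTranspose) * (1 - E) +
        (1 - E) * (p j * (p (j + (m + 1))).conjTranspose) * E +
        E * (p (j + 1) * (p (j + m)).conjTranspose) * (1 - E) +
        E * (p (j + 1) * (p (j + 1 + m)).conjTranspose) * E := fun j => by
      have : (WaveletCircuits.reduce v p (j + m)).conjTranspose =
          (p (j + m)).conjTranspose * (1 - E) + (p (j + m + 1)).conjTranspose * E := by
        rw [WaveletCircuits.reduce, Matrix.conjTranspose_add, Matrix.conjTranspose_mul,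
          Matrix.conjTranspose_mul, Matrix.conjTranspose_sub, hH, Matrix.conjTranspose_one]
      rw [this, WaveletCircuits.reduce, show j + (m + 1) = j + m + 1 by ring,
        show j + 1 + m = j + m + 1 by ring]
      noncomm_ring
    have hshift : ∀ k, E * ∑ j ∈ Finset.range d, p (j + 1) * (p (j + 1 + k)).conjTranspose =
        E * if k = 0 then 1 else 0 := fun k => by
      rw [sum_range_shift d (fun j => p j * (p (j + k)).conjTranspose) (by simp [hp.zero d le_rfl]),
        mul_sub, hp.orth, ← mul_assoc, h0, zero_mul, sub_zero]
    simp only [e, Finset.sum_add_distrib, ← Finset.sum_mul, ← Finset.mul_sum, hp.orth, hshift]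
    -- The correlation at shift `m - 1`. For `m = 0` it is the adjoint of the relation at shift `1`;
    -- for `m = 1` it is the identity, and `E * (1 - E) = 0`.
    have h3 : E * (∑ j ∈ Finset.range d, p (j + 1) * (p (j + m)).conjTranspose) * (1 - E) = 0 := by
      cases m with
      | zero =>
        have := congrArg Matrix.conjTranspose (hp.orth 1)
        rw [Matrix.conjTranspose_sum] at this
        simp only [Matrix.conjTranspose_mul, Matrix.conjTranspose_conjTranspose] at this
        simp only [add_zero, this]
        simp
      | succ m =>
        have := hshift m
        simp only [show ∀ j, j + (m + 1) = j + 1 + m from fun j => by ring, this]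
        split_ifs
        · rw [mul_one, hE']
        · simp
    rw [h3]
    obtain rfl | hm := eq_or_ne m 0
    · simp [hE, hE3, hE'']
    · simp [hm]

/-- The part of the coefficients in the range of `E` moves one degree down. Its total squared norm
is `tr (E ∑ p j (p j)*) = tr E = 1`, so the weighted degree drops by exactly one. -/
lemma weight_reduce (hp : Paraunitary d p) (hv : star v ⬝ᵥ v = 1) (h0 : lineProj v * p 0 = 0) :
    weight d (reduce v p) = weight d p - 1 := by
  have hE := lineProj_mul_self hv
  have hH := conjTranspose_lineProj v
  have hT := trace_lineProj hv
  set E := lineProj v with hEdef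
  have hE' : E * (1 - E) = 0 := by rw [mul_sub, hE, mul_one, sub_self]
  have hE'' : (1 - E) * E = 0 := by rw [sub_mul, hE, one_mul, sub_self]
  have hE3 : (1 - E) * (1 - E) = 1 - E := by rw [mul_sub, hE'', mul_one, sub_zero]
  set a : ℕ → ℂ := fun j => ((p j).conjTranspose * (E * p j)).trace with ha
  have ha0 : a 0 = 0 := by simp [ha, h0]
  have had : a d = 0 := by simp [ha, hp.zero d le_rfl]
  have e : ∀ j, ((reduce v p j).conjTranspose * reduce v p j).trace =
      ((p j).conjTranspose * p j).trace - a j + a (j + 1) := fun j => by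
    have h1 : (reduce v p j).conjTranspose * reduce v p j =
        (p j).conjTranspose * ((1 - E) * (1 - E)) * p j +
        (p j).conjTranspose * ((1 - E) * E) * p (j + 1) +
        (p (j + 1)).conjTranspose * (E * (1 - E)) * p j +
        (p (j + 1)).conjTranspose * (E * E) * p (j + 1) := by
      rw [reduce, Matrix.conjTranspose_add, Matrix.conjTranspose_mul,
        Matrix.conjTranspose_mul, Matrix.conjTranspose_sub, ← hEdef, hH, Matrix.conjTranspose_one]
      noncomm_ring
    have h2 : (reduce v p j).conjTranspose * reduce v p j =
        (p j).conjTranspose * p j - (p j).conjTranspose * (E * p j) +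
          (p (j + 1)).conjTranspose * (E * p (j + 1)) := by
      rw [h1, hE', hE'', hE3, hE]; noncomm_ring
    rw [h2, Matrix.trace_add, Matrix.trace_sub]
  have hsum : ∑ j ∈ Finset.range d, a j = 1 := by
    have : ∀ j, a j = (E * (p j * (p (j + 0)).conjTranspose)).trace := fun j => by
      rw [ha, add_zero]
      simp only
      rw [Matrix.trace_mul_comm, mul_assoc]
    simp only [this]
    rw [← Matrix.trace_sum, ← Finset.mul_sum, hp.orth, if_pos rfl, mul_one, hT]
  have h1 := sum_range_shift d (fun j => (j : ℂ) * a j) (by simp [had])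
  have h2 := sum_range_shift d a had
  rw [ha0, sub_zero, hsum] at h2
  simp only [Nat.cast_add, Nat.cast_one, add_mul, one_mul, Finset.sum_add_distrib, h2,
    Nat.cast_zero, zero_mul, sub_zero] at h1
  simp only [weight, e, mul_add, mul_sub, Finset.sum_add_distrib, Finset.sum_sub_distrib]
  linear_combination h1

/-- The value of the matrix polynomial `p` at `T`. -/
def polyValue {E : Type} [Ring E] (L : Matrix κ κ ℂ →+* E) (T : E) (d : ℕ)
    (p : ℕ → Matrix κ κ ℂ) : E := ∑ j ∈ Finset.range d, L (p j) * T ^ j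

/-- The coefficients commute with `T`, so the identity `p(z) = (1 - P + z P) q(z)` may be evaluated
at `T`. -/
lemma polyValue_eq {E : Type} [Ring E] (L : Matrix κ κ ℂ →+* E) (T : E)
    (hT : ∀ A, Commute (L A) T) (hp : Paraunitary d p) (hv : star v ⬝ᵥ v = 1)
    (h0 : lineProj v * p 0 = 0) : polyValue L T d p =
      (L (1 - lineProj v) + L (lineProj v) * T) * polyValue L T d (reduce v p) := by
  have hE := lineProj_mul_self hv
  have hE' : lineProj v * (1 - lineProj v) = 0 := by rw [mul_sub, hE, mul_one, sub_self]
  have hE'' : (1 - lineProj v) * lineProj v = 0 := by rw [sub_mul, hE, one_mul, sub_self]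
  have hE3 : (1 - lineProj v) * (1 - lineProj v) = 1 - lineProj v := by
    rw [mul_sub, hE'', mul_one, sub_zero]
  have e : ∀ j, (L (1 - lineProj v) + L (lineProj v) * T) * (L (reduce v p j) * T ^ j) =
      L ((1 - lineProj v) * p j) * T ^ j + L (lineProj v * p (j + 1)) * T ^ (j + 1) := fun j => by
    have h1 : (1 - lineProj v) * reduce v p j = (1 - lineProj v) * p j := by
      rw [reduce, mul_add, ← mul_assoc, ← mul_assoc, hE3, hE'', zero_mul, add_zero]
    have h2 : lineProj v * reduce v p j = lineProj v * p (j + 1) := by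
      rw [reduce, mul_add, ← mul_assoc, ← mul_assoc, hE', hE, zero_mul, zero_add]
    rw [add_mul, ← mul_assoc, ← map_mul, h1, mul_assoc (L (lineProj v)), ← mul_assoc T,
      ← (hT _).eq, mul_assoc _ T, ← pow_succ', ← mul_assoc, ← map_mul, h2]
  rw [polyValue, polyValue, Finset.mul_sum]
  simp only [e, Finset.sum_add_distrib]
  rw [sum_range_shift d (fun j => L (lineProj v * p j) * T ^ j) (by simp [hp.zero d le_rfl]),
    ← add_sub_assoc, ← Finset.sum_add_distrib]
  simp only [← add_mul, ← map_add, h0, map_zero, zero_mul, sub_zero]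
  simp

/-- Downward induction on the degree `j`: once all higher coefficients vanish, the relation at shift
`j` reduces to `p 0 * (p j)* = 0`. -/
lemma Paraunitary.eq_zero (hp : Paraunitary d p) (h0 : (p 0).det ≠ 0) (i : ℕ) :
    ∀ j, 0 < j → d ≤ j + i → p j = 0 := by
  induction i with
  | zero => exact fun j _ hj => hp.zero j hj
  | succ i ih =>
    intro j hj hd
    have h := hp.orth j
    rw [if_neg hj.ne', Finset.sum_eq_single 0
      (fun k _ hk => by rw [ih (k + j) (by omega) (by omega)]; simp)
      (fun hd => by rw [hp.zero 0 (by simpa using hd)]; simp), zero_add] at h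
    have hu : IsUnit (p 0) := (Matrix.isUnit_iff_isUnit_det _).2 (isUnit_iff_ne_zero.2 h0)
    have := hu.mul_right_eq_zero.1 h
    simpa using this

/-- A paraunitary matrix polynomial is a product of factors of degree one and a constant unitary
matrix. -/
theorem paraunitary_factorization (N : ℕ) : ∀ p : ℕ → Matrix κ κ ℂ, Paraunitary d p →
    (weight d p).re < N → ∃ vs : List (κ → ℂ), ∃ U ∈ Matrix.unitaryGroup κ ℂ,
      (∀ v ∈ vs, star v ⬝ᵥ v = 1) ∧
      ∀ {E : Type} [Ring E] (L : Matrix κ κ ℂ →+* E) (T : E), (∀ A, Commute (L A) T) →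
        polyValue L T d p =
          (vs.map fun v => L (1 - lineProj v) + L (lineProj v) * T).prod * L U := by
  induction N with
  | zero =>
    intro p _ hlt
    exact absurd hlt (not_lt.2 (by simpa using weight_nonneg d p))
  | succ N ih =>
    intro p hp hlt
    by_cases h0 : (p 0).det = 0
    · obtain ⟨w, hw, hw0⟩ := Matrix.exists_vecMul_eq_zero_iff.2 h0
      obtain ⟨x, hx⟩ := Function.ne_iff.1 hw
      have : Nonempty κ := ⟨x⟩
      obtain ⟨v, hv, hwv⟩ := exists_normalize (star w)
      have hv1 : star v ⬝ᵥ v = 1 := by rw [star_dotProduct_self, hv]; simp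
      have hn : ((nrm (star w) : ℝ) : ℂ) ≠ 0 := fun h => by
        rw [h, zero_smul] at hwv
        exact hw (by simpa using hwv)
      have hp0 : lineProj v * p 0 = 0 := by
        have h1 : w = star ((nrm (star w) : ℝ) : ℂ) • star v := by
          rw [← star_smul, ← hwv, star_star]
        rw [h1, Matrix.smul_vecMul] at hw0
        have h2 := (smul_eq_zero.1 hw0).resolve_left (by simpa using hn)
        rw [lineProj, Matrix.vecMulVec_mul, h2, Matrix.vecMulVec_zero]
      obtain ⟨vs, U, hU, h1, h2⟩ := ih (reduce v p) (hp.reduce hv1 hp0) (by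
        rw [weight_reduce hp hv1 hp0, Complex.sub_re, Complex.one_re]
        push_cast at hlt
        linarith)
      refine ⟨v :: vs, U, hU, by simpa [hv1] using h1, fun L T hT => ?_⟩
      rw [polyValue_eq L T hT hp hv1 hp0, h2 L T hT, List.map_cons, List.prod_cons, mul_assoc]
    · have hz : ∀ j, 0 < j → p j = 0 := fun j hj => hp.eq_zero h0 d j hj (by omega)
      refine ⟨[], p 0, ?_, by simp, fun L T hT => ?_⟩
      · have h := hp.orth 0
        rw [if_pos rfl, Finset.sum_eq_single 0
          (fun k _ hk => by rw [hz k (by omega)]; simp)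
          (fun hd => by rw [hp.zero 0 (by simpa using hd)]; simp)] at h
        exact Matrix.mem_unitaryGroup_iff.2 h
      · rw [polyValue, Finset.sum_eq_single 0
          (fun k _ hk => by rw [hz k (by omega)]; simp)
          (fun hd => by rw [hp.zero 0 (by simpa using hd)]; simp)]
        simp

end

/-- Uniform bound for the number of gates of a paraunitary block operator. -/
theorem exists_reach_polyValue {ℓ d : ℕ} {p : ℕ → Matrix (Fin ℓ → Bool) (Fin ℓ → Bool) ℂ}
    (hp : Paraunitary d p) : ∃ K, ∀ m, Reach (mcOps (Fin (ℓ + m))) (K * (m + 1))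
      (polyValue (lowHom ℓ m) (blockShift ℓ m) d p) := by
  obtain ⟨N, hN⟩ := exists_nat_gt (weight d p).re
  obtain ⟨vs, U, hU, h1, h2⟩ := paraunitary_factorization N p hp hN
  obtain ⟨K₀, hK₀⟩ := exists_reach_unitary hU
  have h3 : ∃ K, ∀ m, Reach (mcOps (Fin (ℓ + m))) (K * (m + 1))
      (vs.map fun v => lowHom ℓ m (1 - lineProj v) +
        lowHom ℓ m (lineProj v) * blockShift ℓ m).prod := by
    clear h2
    induction vs with
    | nil => exact ⟨0, fun m => by simpa using reach_one⟩
    | cons v vs ih =>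
      obtain ⟨K, hK⟩ := ih fun w hw => h1 w (by simp [hw])
      obtain ⟨K', hK'⟩ := exists_reach_lineShift v (h1 v (by simp))
      refine ⟨K' + 1 + K, fun m => ?_⟩
      rw [List.map_cons, List.prod_cons]
      exact ((hK' m).mul (hK m)).mono (by nlinarith)
  obtain ⟨K, hK⟩ := h3
  refine ⟨K + K₀, fun m => ?_⟩
  rw [h2 _ _ fun A => lowHom_comm_blockShift A]
  exact ((hK m).mul ((splits_low ℓ m).reach hK₀)).mono (by nlinarith)


/-! ### Binary expansions -/

/-- The number with the binary expansion `x`. -/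
def bval {n : ℕ} (x : Fin n → Bool) : ℕ := (bitsEquiv n).symm x

lemma bval_eq_sum {n : ℕ} (x : Fin n → Bool) : bval x = ∑ i, (x i).toNat * 2 ^ (i : ℕ) := by
  have : bval x = (finFunctionFinEquiv fun i => finTwoEquiv.symm (x i) : Fin (2 ^ n)) := rfl
  rw [this, finFunctionFinEquiv_apply]
  refine Finset.sum_congr rfl fun i _ => ?_
  cases x i <;> rfl

lemma bval_lt {n : ℕ} (x : Fin n → Bool) : bval x < 2 ^ n := ((bitsEquiv n).symm x).isLt

lemma bval_injective {n : ℕ} : Injective (bval : (Fin n → Bool) → ℕ) :=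
  Fin.val_injective.comp (bitsEquiv n).symm.injective

lemma bval_cons {n : ℕ} (b : Bool) (x : Fin n → Bool) :
    bval (Fin.cons b x : Fin (n + 1) → Bool) = b.toNat + 2 * bval x := by
  rw [bval_eq_sum, bval_eq_sum, Fin.sum_univ_succ, Finset.mul_sum]
  simp [pow_succ]
  exact Finset.sum_congr rfl fun i _ => by ring

lemma bval_snoc {n : ℕ} (x : Fin n → Bool) (b : Bool) :
    bval (Fin.snoc x b : Fin (n + 1) → Bool) = bval x + 2 ^ n * b.toNat := by
  rw [bval_eq_sum, bval_eq_sum, Fin.sum_univ_castSucc]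
  simp
  ring

lemma bval_append {ℓ m : ℕ} (x : Fin ℓ → Bool) (y : Fin m → Bool) :
    bval (Fin.append x y) = bval x + 2 ^ ℓ * bval y := by
  rw [bval_eq_sum, bval_eq_sum, bval_eq_sum, Fin.sum_univ_add, Finset.mul_sum]
  simp [pow_add]
  exact Finset.sum_congr rfl fun i _ => by ring

lemma bval_incAct (m : ℕ) (q : Fin m → Bool) :
    (2 : ℤ) ^ m ∣ (bval q : ℤ) + 1 - bval (incAct m q) := by
  induction m with
  | zero => simp
  | succ m ih =>
    obtain ⟨b, y, rfl⟩ : ∃ b y, q = Fin.cons b y := ⟨q 0, Fin.tail q, (Fin.cons_self_tail q).symm⟩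
    simp only [incAct, Fin.cons_zero, Fin.tail_cons, bval_cons]
    cases b
    · simp [add_comm]
    · obtain ⟨c, hc⟩ := ih y
      refine ⟨c, ?_⟩
      simp only [Bool.toNat_true, Bool.not_true, Bool.toNat_false, if_true]
      push_cast
      rw [pow_succ]
      linear_combination 2 * hc

lemma bval_incAct_iterate (m j : ℕ) (q : Fin m → Bool) :
    (2 : ℤ) ^ m ∣ (bval q : ℤ) + j - bval ((incAct m)^[j] q) := by
  induction j with
  | zero => simp
  | succ j ih =>
    rw [iterate_succ_apply']
    exact (dvd_add ih (bval_incAct m ((incAct m)^[j] q))).trans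
      (Eq.dvd (by push_cast; ring))

lemma eq_of_dvd_bval {m : ℕ} {q q' : Fin m → Bool}
    (h : (2 : ℤ) ^ m ∣ (bval q : ℤ) - bval q') : q = q' := by
  refine bval_injective ?_
  have h1 := bval_lt q
  have h2 := bval_lt q'
  have h3 : (bval q : ℤ) < 2 ^ m := by exact_mod_cast h1
  have h4 : (bval q' : ℤ) < 2 ^ m := by exact_mod_cast h2
  have := Int.eq_zero_of_abs_lt_dvd h (by rw [abs_lt]; constructor <;> omega)
  omega

lemma incAct_injective (m : ℕ) : Injective (incAct m) := fun q q' h => by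
  have h1 := bval_incAct m q
  have h2 := bval_incAct m q'
  rw [h] at h1
  exact eq_of_dvd_bval ((dvd_sub h1 h2).trans (Eq.dvd (by ring)))

lemma incAct_iterate_eq_iff {m : ℕ} (j : ℕ) (q q' : Fin m → Bool) :
    (incAct m)^[j] q = q' ↔ (2 : ℤ) ^ m ∣ (bval q : ℤ) + j - bval q' := by
  have h := bval_incAct_iterate m j q
  constructor
  · rintro rfl; exact h
  · intro h'
    exact eq_of_dvd_bval ((dvd_sub h' h).trans (Eq.dvd (by ring)))

/-! ### Filter matrices as block operators -/

/-- The operator of a matrix whose indices are written in binary. -/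
def bitsOp {n : ℕ} (A : Matrix (Fin (2 ^ n)) (Fin (2 ^ n)) ℂ) : Op (Fin n → Bool) :=
  (LinearMap.funLeft ℂ ℂ (bitsEquiv n).symm).comp
    (A.mulVecLin.comp (LinearMap.funLeft ℂ ℂ (bitsEquiv n)))

lemma bitsOp_apply {n : ℕ} (A : Matrix (Fin (2 ^ n)) (Fin (2 ^ n)) ℂ) (X : (Fin n → Bool) → ℂ)
    (x : Fin n → Bool) :
    bitsOp A X x = A.mulVec (fun t => X (bitsEquiv n t)) ((bitsEquiv n).symm x) := rfl

lemma scales_bitsOp {n : ℕ} {A : Matrix (Fin (2 ^ n)) (Fin (2 ^ n)) ℂ}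
    (hA : A ∈ Matrix.unitaryGroup (Fin (2 ^ n)) ℂ) : Scales 1 (bitsOp A) := fun X => by
  have h1 : ∀ Y : Fin (2 ^ n) → ℂ, nrm (A.mulVec Y) ^ 2 = nrm Y ^ 2 := fun Y => by
    have : star (A.mulVec Y) ⬝ᵥ A.mulVec Y = star Y ⬝ᵥ Y := by
      rw [Matrix.star_mulVec, ← Matrix.dotProduct_mulVec, Matrix.mulVec_mulVec,
        ← Matrix.star_eq_conjTranspose, Matrix.mem_unitaryGroup_iff'.1 hA, Matrix.one_mulVec]
    rw [star_dotProduct_self, star_dotProduct_self] at this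
    exact_mod_cast this
  have h2 : nrm (bitsOp A X) ^ 2 = nrm X ^ 2 := by
    rw [nrm_sq, nrm_sq, ← (bitsEquiv n).sum_comp fun x => ‖X x‖ ^ 2,
      ← (bitsEquiv n).sum_comp]
    simp only [bitsOp_apply, Equiv.symm_apply_apply]
    rw [← nrm_sq, ← nrm_sq, h1]
  rw [one_mul]
  exact (pow_left_inj₀ (nrm_nonneg _) (nrm_nonneg _) two_ne_zero).1 h2

lemma blockShift_pow_apply {ℓ m : ℕ} (j : ℕ) (X : (Fin (ℓ + m) → Bool) → ℂ) (y : Fin ℓ → Bool)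
    (q : Fin m → Bool) :
    (blockShift ℓ m ^ j) X (Fin.append y q) = X (Fin.append y ((incAct m)^[j] q)) := by
  induction j generalizing q with
  | zero => rfl
  | succ j ih =>
    rw [pow_succ', Module.End.mul_apply, blockShift_apply, ih, ← iterate_succ_apply]

lemma polyValue_apply {ℓ m d : ℕ} (p : ℕ → Matrix (Fin ℓ → Bool) (Fin ℓ → Bool) ℂ)
    (X : (Fin (ℓ + m) → Bool) → ℂ) (r : Fin ℓ → Bool) (q : Fin m → Bool) :
    polyValue (lowHom ℓ m) (blockShift ℓ m) d p X (Fin.append r q) =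
      ∑ s, ∑ j ∈ Finset.range d, p j r s * X (Fin.append s ((incAct m)^[j] q)) := by
  rw [polyValue, LinearMap.sum_apply, Finset.sum_apply, Finset.sum_comm]
  refine Finset.sum_congr rfl fun j _ => ?_
  rw [Module.End.mul_apply, lowHom_apply, Matrix.mulVec, dotProduct]
  simp only [blockShift_pow_apply]

/-- The blocks of a banded matrix. -/
def stencilBlocks (b ℓ : ℕ) (coeff : ZMod (2 ^ ℓ) → ℤ → ℂ) (j : ℕ) :
    Matrix (Fin ℓ → Bool) (Fin ℓ → Bool) ℂ := fun r s =>
  if 2 ^ ℓ * ((j : ℤ) - b) + bval s - bval r ∈ Finset.Ioo (-(b : ℤ)) (b : ℤ) then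
    coeff (bval r : ℕ) (2 ^ ℓ * ((j : ℤ) - b) + bval s - bval r) else 0

lemma appendEquiv_sum {ℓ m : ℕ} (f : (Fin (ℓ + m) → Bool) → ℂ) :
    ∑ z, f z = ∑ s, ∑ q, f (Fin.append s q) := by
  rw [← (highSplit ℓ m).symm.sum_comp, Fintype.sum_prod_type]
  rfl

/-- Row `r` of one block and column `s` of the block at distance `j - b` differ by `δ = 2 ^ ℓ (j -
b) + s - r`. The power `b` of the shift removes negative exponents. The identity also holds at sizes
where entries wrap around, as both sides add them. -/
lemma bitsOp_stencil_mul (b ℓ m : ℕ) (coeff : ZMod (2 ^ ℓ) → ℤ → ℂ) :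
    bitsOp (stencilMatrix b ℓ coeff (ℓ + m)) * blockShift ℓ m ^ b =
      polyValue (lowHom ℓ m) (blockShift ℓ m) (2 * b + 1) (stencilBlocks b ℓ coeff) := by
  refine append_ext fun X r q => ?_
  rw [polyValue_apply, Module.End.mul_apply, bitsOp_apply, Matrix.mulVec, dotProduct,
    ← (bitsEquiv (ℓ + m)).symm.sum_comp, appendEquiv_sum]
  refine Finset.sum_congr rfl fun s _ => ?_
  simp only [Equiv.apply_symm_apply, blockShift_pow_apply]
  change ∑ q', (∑ δ ∈ Finset.Ioo (-(b : ℤ)) (b : ℤ),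
    if (2 : ℤ) ^ (ℓ + m) ∣ (bval (Fin.append r q) : ℤ) + δ - (bval (Fin.append s q') : ℤ)
      then coeff ((bval (Fin.append r q) : ℕ) : ZMod (2 ^ ℓ)) δ else 0) *
      X (Fin.append s ((incAct m)^[b] q')) = _
  have hmod : ((bval (Fin.append r q) : ℕ) : ZMod (2 ^ ℓ)) = (bval r : ℕ) := by
    rw [bval_append]
    push_cast
    have : ((2 : ZMod (2 ^ ℓ)) ^ ℓ) = 0 := by exact_mod_cast ZMod.natCast_self (2 ^ ℓ)
    rw [this, zero_mul, add_zero]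
  simp only [hmod, Finset.sum_mul]
  rw [Finset.sum_comm]
  set g : ℤ → ℂ := fun δ => ∑ q', (if (2 : ℤ) ^ (ℓ + m) ∣
      (bval (Fin.append r q) : ℤ) + δ - (bval (Fin.append s q') : ℤ)
      then coeff ((bval r : ℕ) : ZMod (2 ^ ℓ)) δ else 0) *
      X (Fin.append s ((incAct m)^[b] q')) with hg
  set e : ℕ → ℤ := fun j => 2 ^ ℓ * ((j : ℤ) - b) + bval s - bval r with he
  have hk : (0 : ℤ) < 2 ^ ℓ := by positivity
  have hr : (bval r : ℤ) < 2 ^ ℓ := by exact_mod_cast bval_lt r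
  have hs : (bval s : ℤ) < 2 ^ ℓ := by exact_mod_cast bval_lt s
  have hkey : ∀ j, g (e j) = coeff (bval r : ℕ) (e j) * X (Fin.append s ((incAct m)^[j] q)) := by
    intro j
    have h1 : ∀ q', ((2 : ℤ) ^ (ℓ + m) ∣
        (bval (Fin.append r q) : ℤ) + e j - (bval (Fin.append s q') : ℤ)) ↔
        (incAct m)^[j] q = (incAct m)^[b] q' := fun q' => by
      rw [incAct_iterate_eq_iff, bval_append, bval_append, he]
      push_cast
      have h2 : (bval r : ℤ) + 2 ^ ℓ * bval q + (2 ^ ℓ * ((j : ℤ) - b) + bval s - bval r) -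
          (bval s + 2 ^ ℓ * bval q') = 2 ^ ℓ * ((bval q : ℤ) + j - b - bval q') := by ring
      rw [h2, pow_add, mul_dvd_mul_iff_left hk.ne']
      have h3 := bval_incAct_iterate m b q'
      rw [← dvd_add_left h3]
      ring_nf
    simp only [hg, h1]
    have hbij : Bijective ((incAct m)^[b]) :=
      Finite.injective_iff_bijective.1 ((incAct_injective m).iterate b)
    rw [hbij.sum_comp fun u => (if (incAct m)^[j] q = u then coeff ((bval r : ℕ) : ZMod (2 ^ ℓ)) (e j)
      else 0) * X (Fin.append s u)]
    simp
  symm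
  have hsum : ∑ j ∈ Finset.range (2 * b + 1), stencilBlocks b ℓ coeff j r s *
      X (Fin.append s ((incAct m)^[j] q)) = ∑ j ∈ (Finset.range (2 * b + 1)).filter
        (fun j => e j ∈ Finset.Ioo (-(b : ℤ)) (b : ℤ)), g (e j) := by
    rw [Finset.sum_filter]
    refine Finset.sum_congr rfl fun j _ => ?_
    rw [hkey, stencilBlocks]
    split_ifs <;> simp [he]
  rw [hsum]
  refine Finset.sum_of_injOn e ?_ ?_ ?_ fun _ _ => rfl
  · intro j _ j' _ h
    simp only [he] at h
    have : (2 : ℤ) ^ ℓ * (j : ℤ) = 2 ^ ℓ * j' := by linarith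
    exact_mod_cast mul_left_cancel₀ hk.ne' this
  · intro j hj
    simpa using (Finset.mem_filter.1 hj).2
  -- A `δ` occurring in column residue `s` has the form `2 ^ ℓ t + s - r`, and `|δ| < b` forces `|t|
  -- ≤ b`; thus `2 * b + 1` blocks suffice.
  · intro δ hδ hnot
    refine Finset.sum_eq_zero fun q' _ => ?_
    rw [if_neg, zero_mul]
    rintro ⟨c, hc⟩
    refine hnot ?_
    rw [bval_append, bval_append, pow_add] at hc
    push_cast at hc
    set t : ℤ := 2 ^ m * c + bval q' - bval q with ht
    have hδt : δ = 2 ^ ℓ * t + bval s - bval r := by rw [ht]; linear_combination hc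
    have hδ' := Finset.mem_Ioo.1 hδ
    have hr0 : (0 : ℤ) ≤ bval r := by positivity
    have hs0 : (0 : ℤ) ≤ bval s := by positivity
    have ht1 : -(b : ℤ) ≤ t := by
      by_contra h
      push Not at h
      nlinarith [hδ'.1, hδ'.2]
    have ht2 : t ≤ b := by
      by_contra h
      push Not at h
      nlinarith [hδ'.1, hδ'.2]
    refine ⟨(t + b).toNat, ?_, ?_⟩
    · have hcast : ((t + b).toNat : ℤ) = t + b := Int.toNat_of_nonneg (by omega)
      have hval : e (t + b).toNat = δ := by
        simp only [he]; rw [hcast, hδt]; ring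
      refine Finset.mem_coe.2 (Finset.mem_filter.2 ⟨Finset.mem_range.2 (by omega), ?_⟩)
      rw [hval]; exact hδ
    · have hcast : ((t + b).toNat : ℤ) = t + b := Int.toNat_of_nonneg (by omega)
      simp only [he]; rw [hcast, hδt]; ring

/-- The rows of an isometric operator are orthonormal. -/
lemma Scales.rows {Z : Type} [Fintype Z] [DecidableEq Z] {S : Op Z} (hS : Scales 1 S) (x x' : Z) :
    ∑ y, S (Pi.single y 1) x * star (S (Pi.single y 1) x') = if x = x' then 1 else 0 := by
  set A := LinearMap.toMatrix' S with hA
  have hA' : ∀ a c, A a c = S (Pi.single c 1) a := fun a c => by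
    rw [hA, LinearMap.toMatrix'_apply]
  have h1 : A.conjTranspose * A = 1 := by
    ext a c
    have := hS.dotProduct (Pi.single a 1) (Pi.single c 1)
    rw [Matrix.mul_apply, Matrix.one_apply]
    simp only [Matrix.conjTranspose_apply, hA']
    refine Eq.trans ?_ (this.trans ?_)
    · rfl
    rw [Pi.star_single, single_dotProduct]
    simp [Pi.single_apply]
  have h2 : A * A.conjTranspose = 1 := mul_eq_one_comm.1 h1
  have := congrFun (congrFun h2 x) x'
  rw [Matrix.mul_apply, Matrix.one_apply] at this
  simpa only [Matrix.conjTranspose_apply, hA'] using this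

lemma scales_blockShift (ℓ m : ℕ) : Scales 1 (blockShift ℓ m) :=
  scales_of_reach scales_mcOps (reach_blockShift ℓ m)

/-- Orthonormality of the rows of block `0` with those of block `t` is the relation at shift `t`. As
`2 * d < 2 ^ m`, shifts less than `2 * d` are distinct modulo `2 ^ m`, so no further terms enter. -/
lemma paraunitary_of_scales {ℓ m d : ℕ} {p : ℕ → Matrix (Fin ℓ → Bool) (Fin ℓ → Bool) ℂ}
    (hz : ∀ j, d ≤ j → p j = 0) (hm : 2 * d < 2 ^ m)
    (h : Scales 1 (polyValue (lowHom ℓ m) (blockShift ℓ m) d p)) : Paraunitary d p := by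
  refine ⟨hz, fun t => ?_⟩
  obtain ht | ht := le_or_gt d t
  · rw [Finset.sum_eq_zero fun j _ => by rw [hz (j + t) (by omega)]; simp]
    split_ifs with h0
    · subst h0
      -- then `d = 0`, and the operator is zero
      have hd : d = 0 := by omega
      subst hd
      ext r r'
      have := h (Pi.single (Fin.append r fun _ => false) 1)
      have h1 : nrm (Pi.single (Fin.append r fun _ : Fin m => false) 1 :
          (Fin (ℓ + m) → Bool) → ℂ) ^ 2 = 1 := by
        rw [nrm_sq, Finset.sum_eq_single (Fin.append r fun _ => false)
          (fun x _ hx => by simp [hx]) (by simp)]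
        simp
      rw [one_mul] at this
      rw [← this, polyValue, Finset.range_zero, Finset.sum_empty, nrm_sq] at h1
      simp at h1
    · rfl
  · set z : Fin m → Bool := fun _ => false
    have hinc : ∀ i j : ℕ, i < 2 * d → j < 2 * d →
        ((incAct m)^[i] z = (incAct m)^[j] z ↔ i = j) := fun i j hi hj => by
      constructor
      · intro h
        have h1 := bval_incAct_iterate m i z
        have h2 := bval_incAct_iterate m j z
        rw [h] at h1
        have h3 := dvd_sub h1 h2
        rw [show (bval z : ℤ) + i - bval ((incAct m)^[j] z) -
          ((bval z : ℤ) + j - bval ((incAct m)^[j] z)) = (i : ℤ) - j by ring] at h3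
        have h4 : (2 * d : ℤ) < 2 ^ m := by exact_mod_cast hm
        have := Int.eq_zero_of_abs_lt_dvd h3 (by rw [abs_lt]; constructor <;> omega)
        omega
      · rintro rfl; rfl
    ext r r'
    have := h.rows (Fin.append r ((incAct m)^[t] z)) (Fin.append r' z)
    simp only [polyValue_apply] at this
    rw [appendEquiv_sum] at this
    have hsingle : ∀ (s s' : Fin ℓ → Bool) (u u' : Fin m → Bool),
        (Pi.single (Fin.append s' u') 1 : (Fin (ℓ + m) → Bool) → ℂ) (Fin.append s u) =
          if s = s' then (if u = u' then 1 else 0) else 0 := fun s s' u u' => by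
      rw [Pi.single_apply, ← ite_and]
      refine if_congr ?_ rfl rfl
      constructor
      · intro h
        have := congrArg (highSplit ℓ m) h
        simpa [highSplit, lowSplit] using this
      · rintro ⟨rfl, rfl⟩; rfl
    simp only [hsingle, mul_ite, mul_one, mul_zero] at this
    have e1 : ∀ (s' : Fin ℓ → Bool) (u' : Fin m → Bool) (r : Fin ℓ → Bool) (w : Fin m → Bool),
        (∑ s, ∑ j ∈ Finset.range d,
          if s = s' then (if (incAct m)^[j] w = u' then p j r s else 0) else 0) =
        ∑ j ∈ Finset.range d, if (incAct m)^[j] w = u' then p j r s' else 0 :=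
      fun s' u' r w => by
        rw [Finset.sum_comm]
        exact Finset.sum_congr rfl fun j _ => by simp
    simp only [e1, star_sum, Finset.sum_mul_sum, apply_ite star, star_zero, ite_mul, zero_mul,
      mul_ite, mul_zero] at this
    have hrhs : (if Fin.append r ((incAct m)^[t] z) = Fin.append r' z then (1 : ℂ) else 0) =
        (if t = 0 then (1 : Matrix (Fin ℓ → Bool) (Fin ℓ → Bool) ℂ) else 0) r r' := by
      have h1 : Fin.append r ((incAct m)^[t] z) = Fin.append r' z ↔ r = r' ∧ t = 0 := by
        rw [← hinc t 0 (by omega) (by omega)]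
        constructor
        · intro h
          have := congrArg (highSplit ℓ m) h
          simpa [highSplit, lowSplit] using this
        · rintro ⟨rfl, h⟩
          rw [h]; rfl
      rw [if_congr h1 rfl rfl, ite_and]
      by_cases ht0 : t = 0 <;> simp [ht0, Matrix.one_apply]
    rw [hrhs] at this
    rw [← this, Matrix.sum_apply]
    simp only [Matrix.mul_apply, Matrix.conjTranspose_apply]
    rw [Finset.sum_comm]
    refine Finset.sum_congr rfl fun s _ => ?_
    rw [Finset.sum_comm]
    refine Finset.sum_congr rfl fun j hj => ?_
    rw [Finset.sum_comm]
    have hj' := Finset.mem_range.1 hj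
    have e2 : ∀ j' ∈ Finset.range d, (∑ u', if (incAct m)^[j'] z = u' then
        (if (incAct m)^[j] ((incAct m)^[t] z) = u' then p j r s * star (p j' r' s) else 0) else 0) =
        if j' = j + t then p j r s * star (p j' r' s) else 0 := fun j' hj' => by
      have hj'' := Finset.mem_range.1 hj'
      rw [Finset.sum_ite_eq, if_pos (Finset.mem_univ _)]
      refine if_congr ?_ rfl rfl
      rw [← iterate_add_apply, hinc _ _ (by omega) (by omega), eq_comm]
    rw [Finset.sum_congr rfl e2, Finset.sum_ite_eq']
    split_ifs with h
    · rfl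
    · rw [hz (j + t) (by simpa using h)]; simp


lemma stencilBlocks_eq_zero (b ℓ : ℕ) (coeff : ZMod (2 ^ ℓ) → ℤ → ℂ) (j : ℕ)
    (hj : 2 * b + 1 ≤ j) : stencilBlocks b ℓ coeff j = 0 := by
  ext r s
  rw [stencilBlocks, if_neg]
  · rfl
  · intro h
    have h1 := (Finset.mem_Ioo.1 h).2
    have hr : (bval r : ℤ) < 2 ^ ℓ := by exact_mod_cast bval_lt r
    have hs : (0 : ℤ) ≤ bval s := by positivity
    have hk : (1 : ℤ) ≤ 2 ^ ℓ := by exact_mod_cast Nat.one_le_two_pow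
    have hj' : (2 * b + 1 : ℤ) ≤ j := by exact_mod_cast hj
    nlinarith

/-- The filter matrices have circuits of multiply controlled gates of linear size. -/
theorem exists_reach_matrix (F : WaveletFilter) : ∃ K, ∀ n, F.n₀ ≤ n →
    Reach (mcOps (Fin n)) (K * (n + 1)) (bitsOp (F.matrix n)) := by
  have hid := fun m => bitsOp_stencil_mul F.b F.ℓ m F.coeff
  have hP : Paraunitary (2 * F.b + 1) (stencilBlocks F.b F.ℓ F.coeff) := by
    -- One size is enough: at least `2 ^ n₀`, so that unitarity is available, and too large for
    -- wrapping. The relations obtained then serve every size.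
    set m := F.n₀ + 2 * (2 * F.b + 1)
    refine paraunitary_of_scales (m := m) (stencilBlocks_eq_zero F.b F.ℓ F.coeff) ?_ ?_
    · exact lt_of_le_of_lt (by omega) (Nat.lt_two_pow_self (n := m))
    · rw [← hid]
      have h1 : Scales 1 (blockShift F.ℓ m ^ F.b) := by
        induction F.b with
        | zero => exact scales_one
        | succ b ih => rw [pow_succ]; simpa using ih.mul (scales_blockShift F.ℓ m)
      simpa using (scales_bitsOp (F.unitary (F.ℓ + m) (by omega))).mul h1
  obtain ⟨K, hK⟩ := exists_reach_polyValue hP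
  refine ⟨K + F.b, fun n hn => ?_⟩
  obtain ⟨m, rfl⟩ := Nat.exists_eq_add_of_le (F.ℓ_le_n₀.trans hn)
  obtain ⟨T', hT', h1, -⟩ := ((reach_blockShift F.ℓ m).pow F.b).exists_inv mcOps_inv
  have : bitsOp (F.matrix (F.ℓ + m)) = polyValue (lowHom F.ℓ m) (blockShift F.ℓ m)
      (2 * F.b + 1) (stencilBlocks F.b F.ℓ F.coeff) * T' := by
    rw [← hid, mul_assoc, h1, mul_one]; rfl
  rw [this]
  exact ((hK m).mul hT').mono (by nlinarith)

/-! ### Permutations of the qubits -/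

lemma reach_swap {Q : Type} [DecidableEq Q] {a b : Q} (h : a ≠ b) :
    Reach (mcOps Q) 3 (permOp fun z : Q → Bool => z ∘ Equiv.swap a b) := by
  have : (permOp fun z : Q → Bool => z ∘ Equiv.swap a b) =
      permOp (cnotAct a b) * (permOp (cnotAct b a) * permOp (cnotAct a b)) := by
    refine op_ext fun X z => ?_
    simp only [Module.End.mul_apply, permOp_apply]
    congr 1
    ext q
    by_cases hqa : q = a
    · subst hqa
      cases hz : z q <;> cases hz' : z b <;> simp [cnotAct, h, h.symm, hz, hz']
    by_cases hqb : q = b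
    · subst hqb; simp [cnotAct, h, h.symm]
    · simp [cnotAct, hqa, hqb, Equiv.swap_apply_of_ne_of_ne hqa hqb]
  rw [this]
  have r1 := reach_of_mem (permOp_cnotAct_mem h)
  have r2 := reach_of_mem (permOp_cnotAct_mem h.symm)
  exact r1.mul (r2.mul r1)

lemma reach_permute {Q : Type} [DecidableEq Q] [Fintype Q] (k : ℕ) : ∀ π : Equiv.Perm Q,
    π.support.card ≤ k → Reach (mcOps Q) (k * 3) (permOp fun z : Q → Bool => z ∘ π) := by
  induction k with
  | zero =>
    intro π hπ
    have : π = 1 := by simpa using hπ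
    subst this
    exact reach_one.mono (Nat.zero_le _)
  | succ k ih =>
    intro π hπ
    by_cases h1 : π = 1
    · subst h1; exact reach_one.mono (Nat.zero_le _)
    · obtain ⟨x, hx⟩ : ∃ x, π x ≠ x := by
        by_contra h
        push Not at h
        exact h1 (Equiv.ext h)
      have h2 := ih (Equiv.swap x (π x) * π)
        (Nat.lt_succ_iff.1 ((Equiv.Perm.card_support_swap_mul hx).trans_le hπ))
      have h3 := reach_swap hx.symm
      have e : (permOp fun z : Q → Bool => z ∘ π) =
          (permOp fun z : Q → Bool => z ∘ Equiv.swap x (π x)) *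
            (permOp fun z : Q → Bool => z ∘ (Equiv.swap x (π x) * π : Equiv.Perm Q)) := by
        refine op_ext fun X z => ?_
        simp only [Module.End.mul_apply, permOp_apply]
        congr 1
        ext q
        simp
      rw [e]
      exact (h3.mul h2).mono (by omega)

/-- The last qubit becomes the first. -/
def rotate {n : ℕ} (z : Fin (n + 1) → Bool) : Fin (n + 1) → Bool :=
  Fin.cons (z (Fin.last n)) (Fin.init z)

lemma reach_rotate (n : ℕ) : Reach (mcOps (Fin (n + 1))) ((n + 1) * 3) (permOp (rotate (n := n))) := by
  have : rotate (n := n) = fun z => z ∘ (finRotate (n + 1)).symm := by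
    ext z i
    refine Fin.cases ?_ (fun i => ?_) i
    · have h : (finRotate (n + 1)).symm 0 = Fin.last n := by
        rw [Equiv.symm_apply_eq, finRotate_last]
      simp [rotate, h]
    · have h : (finRotate (n + 1)).symm i.succ = i.castSucc := by
        rw [Equiv.symm_apply_eq, finRotate_apply, Fin.coeSucc_eq_succ]
      simp [rotate, h, Fin.init]
  rw [this]
  exact reach_permute _ _ ((Finset.card_le_univ _).trans (by simp))

/-! ### The pyramid algorithm -/

/-- The operator of the wavelet transform. -/
def pyramidOp (F : WaveletFilter) : (n : ℕ) → Op (Fin n → Bool)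
  | 0 => 1
  | n + 1 => if n + 1 < F.n₀ then 1 else
      permOp rotate * (lift (consSplit n) (fun b => b == false) (pyramidOp F n) *
        bitsOp (F.matrix (n + 1)))

/-- The least significant digit of an index separates even from odd. Placing the two classes in the
two halves makes this digit the most significant one, which is the rotation of the qubits; the
recursion acts where the digit is `0`. -/
lemma transform_eq (F : WaveletFilter) (n : ℕ) (X : (Fin n → Bool) → ℂ) :
    F.transform n X = pyramidOp F n X := by
  induction n with
  | zero =>
    ext z
    simp [WaveletFilter.transform, WaveletFilter.pyramid, pyramidOp]
  | succ n ih =>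
    ext z
    rw [WaveletFilter.transform, WaveletFilter.pyramid, pyramidOp]
    by_cases h : n + 1 < F.n₀
    · simp [h]
    · rw [if_neg h, if_neg h]
      obtain ⟨y, b, rfl⟩ : ∃ (y : Fin n → Bool) (b : Bool), z = Fin.snoc y b :=
        ⟨Fin.init z, z (Fin.last n), (Fin.snoc_init_self z).symm⟩
      rw [Module.End.mul_apply, Module.End.mul_apply, permOp_apply, rotate, Fin.snoc_last,
        Fin.init_snoc, lift_consSplit_apply, Fin.cons_zero, Fin.tail_cons]
      have hval : (((bitsEquiv (n + 1)).symm (Fin.snoc y b) : Fin (2 ^ (n + 1))) : ℕ) =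
          bval y + 2 ^ n * b.toNat := bval_snoc y b
      have hy := bval_lt y
      cases b
      · rw [Bool.toNat_false, mul_zero, add_zero] at hval
        rw [if_pos rfl, ← ih]
        refine (dif_pos (by rw [hval]; exact hy)).trans ?_
        rw [WaveletFilter.transform]
        congr 1
        · ext j
          rw [bitsOp_apply]
          congr 1
          refine Fin.ext ?_
          change 2 * (j : ℕ) = bval (Fin.cons false (bitsEquiv n j) : Fin (n + 1) → Bool)
          rw [bval_cons]
          simp [bval]
        · exact Fin.ext hval
      · rw [Bool.toNat_true, mul_one] at hval
        rw [if_neg (by simp), bitsOp_apply]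
        refine (dif_neg (by rw [hval]; omega)).trans ?_
        congr 1
        refine Fin.ext ?_
        change 2 * (((bitsEquiv (n + 1)).symm (Fin.snoc y true) : ℕ) - 2 ^ n) + 1 =
          bval (Fin.cons true y : Fin (n + 1) → Bool)
        rw [hval, bval_cons, Nat.add_sub_cancel, Bool.toNat_true]
        ring

/-- The wavelet transform has circuits of multiply controlled gates of quadratic size. -/
theorem exists_reach_transform (F : WaveletFilter) : ∃ K, ∀ n,
    Reach (mcOps (Fin n)) (K * (n + 1) ^ 2) (pyramidOp F n) := by
  obtain ⟨K, hK⟩ := exists_reach_matrix F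
  refine ⟨K + 3, fun n => ?_⟩
  induction n with
  | zero => exact reach_one.mono (Nat.zero_le _)
  | succ n ih =>
    rw [pyramidOp]
    split_ifs with h
    · exact reach_one.mono (Nat.zero_le _)
    · refine ((reach_rotate n).mul (((splits_cons n false).reach ih).mul
        (hK (n + 1) (not_lt.1 h)))).mono ?_
      nlinarith

/-- The number of elementary gates sufficient for the wavelet transform is polynomial. -/
theorem exists_reach_transform_basic (F : WaveletFilter) : ∃ K, ∀ n,
    Reach (basicOps (Fin n)) (K * (n + 1) ^ 7) (pyramidOp F n) := by
  obtain ⟨K, hK⟩ := exists_reach_transform F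
  refine ⟨K * 28, fun n => ((hK n).subst reach_mcOps).mono ?_⟩
  rw [Fintype.card_fin]
  -- Quadratically many multiply controlled gates of cost `O(n ^ 5)` each account for the exponent
  -- `7`.
  have h : ctrlCost n ≤ 28 * (n + 1) ^ 5 := by
    have h1 : n ≤ (n + 1) ^ 5 := (Nat.le_succ n).trans (Nat.le_self_pow (by norm_num) _)
    have h2 : 1 ≤ (n + 1) ^ 5 := Nat.one_le_pow _ _ (by omega)
    have h3 : (n + 1) * n ^ 4 ≤ (n + 1) ^ 5 := by
      rw [pow_succ' (n + 1) 4]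
      exact Nat.mul_le_mul_left _ (Nat.pow_le_pow_left (Nat.le_succ n) 4)
    have h4 : n + 1 ≤ (n + 1) ^ 5 := Nat.le_self_pow (by norm_num) _
    have h5 : phaseCost n = 2 * ((n + 1) * n ^ 4) + 10 * (n + 1) := by unfold phaseCost; ring
    unfold ctrlCost
    rw [h5]
    nlinarith
  calc K * (n + 1) ^ 2 * ctrlCost n ≤ K * (n + 1) ^ 2 * (28 * (n + 1) ^ 5) :=
        Nat.mul_le_mul_left _ h
    _ = K * 28 * (n + 1) ^ 7 := by ring


/-! ### Commutators of unit quaternions -/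

abbrev Quat := Quaternion ℝ

/-- The quaternion with the given coordinates. -/
def quat (a b c d : ℝ) : Quat := ⟨a, b, c, d⟩

@[simp] lemma quat_re (a b c d : ℝ) : (quat a b c d).re = a := rfl
@[simp] lemma quat_imI (a b c d : ℝ) : (quat a b c d).imI = b := rfl
@[simp] lemma quat_imJ (a b c d : ℝ) : (quat a b c d).imJ = c := rfl
@[simp] lemma quat_imK (a b c d : ℝ) : (quat a b c d).imK = d := rfl

lemma quat_norm_sq (x : Quat) : ‖x‖ ^ 2 = x.re ^ 2 + x.imI ^ 2 + x.imJ ^ 2 + x.imK ^ 2 := by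
  rw [sq ‖x‖, ← Quaternion.normSq_eq_norm_mul_self, Quaternion.normSq_def']

lemma quat_norm_eq_one {x : Quat} (h : x.re ^ 2 + x.imI ^ 2 + x.imJ ^ 2 + x.imK ^ 2 = 1) :
    ‖x‖ = 1 := by
  rw [← quat_norm_sq] at h
  nlinarith [norm_nonneg x, sq_nonneg (‖x‖ - 1)]

lemma quat_star_mul {x : Quat} (h : ‖x‖ = 1) : star x * x = 1 := by
  rw [Quaternion.star_mul_self, Quaternion.normSq_eq_norm_mul_self, h]; simp

lemma quat_mul_star {x : Quat} (h : ‖x‖ = 1) : x * star x = 1 := by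
  rw [Quaternion.self_mul_star, Quaternion.normSq_eq_norm_mul_self, h]; simp

lemma quat_norm_sub_one_sq {x : Quat} (h : ‖x‖ = 1) : ‖x - 1‖ ^ 2 = 2 - 2 * x.re := by
  have h1 := quat_norm_sq x
  have h2 := quat_norm_sq (x - 1)
  rw [h] at h1
  simp only [Quaternion.re_sub, Quaternion.imI_sub, Quaternion.imJ_sub, Quaternion.imK_sub,
    Quaternion.re_one, Quaternion.imI_one, Quaternion.imJ_one, Quaternion.imK_one] at h2
  linarith

/-- Quaternions of equal real part and norm are conjugate. -/
lemma exists_intertwiner (x y : Quat) (hre : x.re = y.re) (hn : ‖x‖ = ‖y‖) :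
    ∃ g : Quat, g ≠ 0 ∧ g * x = y * g := by
  have h1 := quat_norm_sq x
  have h2 := quat_norm_sq y
  rw [hn, hre] at h1
  have h3 : x.imI ^ 2 + x.imJ ^ 2 + x.imK ^ 2 = y.imI ^ 2 + y.imJ ^ 2 + y.imK ^ 2 := by linarith
  clear h1 h2
  -- For purely imaginary `x`, `y` of equal norm, `g = ‖x‖ ^ 2 - y * x` satisfies `g * x = y * g`.
  -- It can vanish only for `y = -x`, and then any imaginary quaternion orthogonal to `x` serves.
  by_cases hg : x.imI ^ 2 + x.imJ ^ 2 + x.imK ^ 2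
      + (y.imI * x.imI + y.imJ * x.imJ + y.imK * x.imK) = 0
  · have hs : (x.imI + y.imI) ^ 2 + (x.imJ + y.imJ) ^ 2 + (x.imK + y.imK) ^ 2 = 0 := by
      linear_combination 2 * hg - h3
    have k1 : y.imI = -x.imI := by
      nlinarith [sq_nonneg (x.imI + y.imI), sq_nonneg (x.imJ + y.imJ), sq_nonneg (x.imK + y.imK)]
    have k2 : y.imJ = -x.imJ := by
      nlinarith [sq_nonneg (x.imI + y.imI), sq_nonneg (x.imJ + y.imJ), sq_nonneg (x.imK + y.imK)]
    have k3 : y.imK = -x.imK := by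
      nlinarith [sq_nonneg (x.imI + y.imI), sq_nonneg (x.imJ + y.imJ), sq_nonneg (x.imK + y.imK)]
    by_cases h12 : x.imI = 0 ∧ x.imJ = 0
    · refine ⟨quat 0 1 0 0, fun h => ?_, ?_⟩
      · exact one_ne_zero (α := ℝ) (congrArg (fun q : Quat => q.imI) h)
      · apply Quaternion.ext <;> simp only [Quaternion.re_mul, Quaternion.imI_mul,
          Quaternion.imJ_mul, Quaternion.imK_mul, quat_re, quat_imI, quat_imJ, quat_imK, hre,
          k1, k2, k3, h12.1, h12.2] <;> ring
    · refine ⟨quat 0 x.imJ (-x.imI) 0, fun h => h12 ⟨?_, ?_⟩, ?_⟩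
      · exact neg_eq_zero.1 (congrArg (fun q : Quat => q.imJ) h)
      · exact congrArg (fun q : Quat => q.imI) h
      · apply Quaternion.ext <;> simp only [Quaternion.re_mul, Quaternion.imI_mul,
          Quaternion.imJ_mul, Quaternion.imK_mul, quat_re, quat_imI, quat_imJ, quat_imK, hre,
          k1, k2, k3] <;> ring
  · refine ⟨quat (x.imI ^ 2 + x.imJ ^ 2 + x.imK ^ 2
      + (y.imI * x.imI + y.imJ * x.imJ + y.imK * x.imK)) (-(y.imJ * x.imK - y.imK * x.imJ))
      (-(y.imK * x.imI - y.imI * x.imK)) (-(y.imI * x.imJ - y.imJ * x.imI)),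
      fun h => hg (congrArg (fun q : Quat => q.re) h), ?_⟩
    apply Quaternion.ext <;> simp only [Quaternion.re_mul, Quaternion.imI_mul,
          Quaternion.imJ_mul, Quaternion.imK_mul, quat_re, quat_imI, quat_imJ, quat_imK, hre]
    · ring
    · linear_combination x.imI * h3
    · linear_combination x.imJ * h3
    · linear_combination x.imK * h3

/-- The conjugating quaternion can be taken to be a unit. -/
lemma exists_unit_conj (x y : Quat) (hre : x.re = y.re) (hn : ‖x‖ = ‖y‖) :
    ∃ g : Quat, ‖g‖ = 1 ∧ y = g * x * star g := by
  obtain ⟨g, hg, h⟩ := exists_intertwiner x y hre hn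
  have hn0 : ‖g‖ ≠ 0 := norm_ne_zero_iff.2 hg
  have h1 : ‖(‖g‖⁻¹ : ℝ) • g‖ = 1 := by
    rw [norm_smul, norm_inv, norm_norm, inv_mul_cancel₀ hn0]
  refine ⟨(‖g‖⁻¹ : ℝ) • g, h1, ?_⟩
  rw [smul_mul_assoc, h, ← mul_smul_comm, mul_assoc, quat_mul_star h1, mul_one]

/-- A unit quaternion is the commutator of two units which are close to `1`. -/
lemma exists_commutator (x : Quat) (hx : ‖x‖ = 1) :
    ∃ v w : Quat, ‖v‖ = 1 ∧ ‖w‖ = 1 ∧ x = v * w * star v * star w ∧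
      ‖v - 1‖ ^ 2 ≤ ‖x - 1‖ ∧ ‖w - 1‖ ^ 2 ≤ ‖x - 1‖ := by
  have hsq := quat_norm_sub_one_sq hx
  set D := ‖x - 1‖ with hD
  have hD0 : 0 ≤ D := norm_nonneg _
  have hD2 : D ≤ 2 := by
    calc D ≤ ‖x‖ + ‖(1 : Quat)‖ := norm_sub_le _ _
      _ = 2 := by rw [hx, norm_one]; norm_num
  have hb2 : √(D / 2) ^ 2 = D / 2 := Real.sq_sqrt (by positivity)
  have ha2 : √(1 - D / 2) ^ 2 = 1 - D / 2 := Real.sq_sqrt (by linarith)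
  set b := √(D / 2) with hb
  set a := √(1 - D / 2) with ha
  have ha0 : 0 ≤ a := Real.sqrt_nonneg _
  have ha1 : a ≤ 1 := by nlinarith
  -- Rotations through equal angles about orthogonal axes: their commutator has real part `1 - 2 b ^
  -- 4`, which equals that of `x` for `b ^ 2 = D / 2`. Hence it is conjugate to `x`, and the
  -- conjugation is applied to both factors.
  set v := quat a b 0 0 with hv
  set w := quat a 0 b 0 with hw
  have nv : ‖v‖ = 1 := quat_norm_eq_one (by simp [hv]; linarith)
  have nw : ‖w‖ = 1 := quat_norm_eq_one (by simp [hw]; linarith)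
  have hre : (v * w * star v * star w).re = x.re := by
    have : x.re = 1 - D ^ 2 / 2 := by linarith
    rw [this]
    simp only [hv, hw, Quaternion.re_mul, Quaternion.imI_mul, Quaternion.imJ_mul,
      Quaternion.imK_mul, quat_re, quat_imI, quat_imJ, quat_imK, Quaternion.re_star,
      Quaternion.imI_star, Quaternion.imJ_star, Quaternion.imK_star]
    have e1 : D = 2 * b ^ 2 := by linarith
    have e2 : a ^ 2 = 1 - b ^ 2 := by linarith
    rw [e1]
    linear_combination (a ^ 2 + 1 + b ^ 2) * e2
  obtain ⟨g, hg, hgx⟩ := exists_unit_conj (v * w * star v * star w) x hre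
    (by simp only [norm_mul, norm_star, nv, nw, hx]; norm_num)
  have hgs := quat_star_mul hg
  have hgs' := quat_mul_star hg
  have key : ∀ u : Quat, ‖u‖ = 1 → u.re = a → ‖g * u * star g - 1‖ ^ 2 ≤ D := by
    intro u hu hua
    have : g * u * star g - 1 = g * (u - 1) * star g := by
      rw [mul_sub, sub_mul, mul_one, hgs']
    rw [this, norm_mul, norm_mul, norm_star, hg, one_mul, mul_one, quat_norm_sub_one_sq hu, hua]
    nlinarith
  refine ⟨g * v * star g, g * w * star g, ?_, ?_, ?_, key v nv rfl, key w nw rfl⟩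
  · simp only [norm_mul, norm_star, hg, nv]; norm_num
  · simp only [norm_mul, norm_star, hg, nw]; norm_num
  · rw [hgx]
    simp only [star_mul, star_star, mul_assoc]
    simp only [← mul_assoc (star g) g, hgs, one_mul]

/-- The commutator depends on its first argument with a small Lipschitz constant if the second one
is close to `1`. -/
lemma norm_commutator_sub {v v' w : Quat} (hv : ‖v‖ = 1) (hv' : ‖v'‖ = 1) (hw : ‖w‖ = 1) :
    ‖v' * w * star v' * star w - v * w * star v * star w‖ ≤ 2 * ‖v' - v‖ * ‖w - 1‖ := by
  have hs := quat_star_mul hv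
  have hs' := quat_mul_star hv
  set x := star v * v' with hx
  have nx : ‖x‖ = 1 := by rw [hx, norm_mul, norm_star, hv, hv']; norm_num
  have hv'x : v' = v * x := by rw [hx, ← mul_assoc, hs', one_mul]
  -- The difference is, up to unit factors, `x * w - w * x = (x - 1) * (w - 1) - (w - 1) * (x - 1)`,
  -- which is small in both variables.
  have e : v' * w * star v' * star w - v * w * star v * star w
      = v * ((x - 1) * (w - 1) - (w - 1) * (x - 1)) * star x * star v * star w := by
    have : (x - 1) * (w - 1) - (w - 1) * (x - 1) = x * w - w * x := by noncomm_ring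
    rw [this, hv'x]
    have hxs : x * star x = 1 := quat_mul_star nx
    simp only [mul_sub, sub_mul, star_mul, mul_assoc]
    congr 1
    rw [← mul_assoc x (star x), hxs, one_mul]
  have hn : ‖x - 1‖ = ‖v' - v‖ := by
    rw [hv'x]
    have : v * x - v = v * (x - 1) := by rw [mul_sub, mul_one]
    rw [this, norm_mul, hv, one_mul]
  rw [e]
  simp only [norm_mul, norm_star, hv, hw, nx, mul_one, one_mul]
  calc _ ≤ ‖(x - 1) * (w - 1)‖ + ‖(w - 1) * (x - 1)‖ := norm_sub_le _ _
    _ = 2 * ‖v' - v‖ * ‖w - 1‖ := by rw [norm_mul, norm_mul, hn]; ring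

lemma norm_commutator_sub_le {v v' w w' : Quat} (hv : ‖v‖ = 1) (hv' : ‖v'‖ = 1) (hw : ‖w‖ = 1)
    (hw' : ‖w'‖ = 1) {ε δ : ℝ} (h1 : ‖v' - v‖ ≤ ε) (h2 : ‖w' - w‖ ≤ ε)
    (h3 : ‖v - 1‖ ≤ δ) (h4 : ‖w - 1‖ ≤ δ) :
    ‖v' * w' * star v' * star w' - v * w * star v * star w‖ ≤ 2 * ε * (2 * δ + ε) := by
  have hε : 0 ≤ ε := (norm_nonneg _).trans h1
  have hδ : 0 ≤ δ := (norm_nonneg _).trans h3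
  have a1 := norm_commutator_sub hv hv' hw
  have a2 : ‖v' * w' * star v' * star w' - v' * w * star v' * star w‖ ≤ 2 * ‖w' - w‖ * ‖v' - 1‖ := by
    have := norm_commutator_sub hw hw' hv'
    rw [← norm_star] at this
    simpa only [star_sub, star_mul, star_star, mul_assoc] using this
  have a3 : ‖v' - 1‖ ≤ ε + δ := by
    calc ‖v' - 1‖ = ‖(v' - v) + (v - 1)‖ := by congr 1; abel
      _ ≤ _ := (norm_add_le _ _).trans (add_le_add h1 h3)
  calc _ ≤ ‖v' * w' * star v' * star w' - v' * w * star v' * star w‖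
        + ‖v' * w * star v' * star w - v * w * star v * star w‖ := norm_sub_le_norm_sub_add_norm_sub _ _ _
    _ ≤ 2 * ε * (ε + δ) + 2 * ε * δ := by
        refine add_le_add (a2.trans ?_) (a1.trans ?_) <;> gcongr
    _ = _ := by ring


/-! ### Density of the group generated by two quaternions -/

lemma quat_mul (a b c d a' b' c' d' : ℝ) : quat a b c d * quat a' b' c' d' =
    quat (a * a' - b * b' - c * c' - d * d') (a * b' + b * a' + c * d' - d * c')
      (a * c' - b * d' + c * a' + d * b') (a * d' + b * c' - c * b' + d * a') := by
  apply Quaternion.ext <;> simp only [Quaternion.re_mul, Quaternion.imI_mul, Quaternion.imJ_mul,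
    Quaternion.imK_mul, quat_re, quat_imI, quat_imJ, quat_imK]

lemma quat_add (a b c d a' b' c' d' : ℝ) : quat a b c d + quat a' b' c' d' =
    quat (a + a') (b + b') (c + c') (d + d') := rfl

lemma star_quat (a b c d : ℝ) : star (quat a b c d) = quat a (-b) (-c) (-d) := by
  apply Quaternion.ext <;> simp only [Quaternion.re_star, Quaternion.imI_star,
    Quaternion.imJ_star, Quaternion.imK_star, quat_re, quat_imI, quat_imJ, quat_imK]

lemma smul_quat (r a b c d : ℝ) : r • quat a b c d = quat (r * a) (r * b) (r * c) (r * d) := rfl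

lemma one_eq_quat : (1 : Quat) = quat 1 0 0 0 := rfl

lemma eq_quat (x : Quat) : x = quat x.re x.imI x.imJ x.imK := rfl

/-- The unit quaternion of the Hadamard gate. -/
def quatH : Quat := quat 0 (√2 / 2) 0 (√2 / 2)

/-- The unit quaternion of the `π / 8` gate. -/
def quatT : Quat := quat (Real.cos (Real.pi / 8)) 0 0 (Real.sin (Real.pi / 8))

/-- The two quaternions and their inverses. -/
def letters : Set Quat := {quatH, star quatH, quatT, star quatT}

lemma sqrt_two_half_sq : (√2 / 2) ^ 2 = (1 / 2 : ℝ) := by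
  rw [div_pow, Real.sq_sqrt (by norm_num)]; norm_num

lemma norm_quatH : ‖quatH‖ = 1 :=
  quat_norm_eq_one (by simp only [quatH, quat_re, quat_imI, quat_imJ, quat_imK,
    sqrt_two_half_sq]; norm_num)

lemma norm_quatT : ‖quatT‖ = 1 :=
  quat_norm_eq_one (by
    simp only [quatT, quat_re, quat_imI, quat_imJ, quat_imK]
    linear_combination Real.sin_sq_add_cos_sq (Real.pi / 8))

lemma norm_of_mem_letters {x : Quat} (h : x ∈ letters) : ‖x‖ = 1 := by
  rcases h with rfl | rfl | rfl | rfl <;> simp [norm_quatH, norm_quatT]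

lemma star_mem_letters {x : Quat} (h : x ∈ letters) : star x ∈ letters := by
  rcases h with rfl | rfl | rfl | rfl <;> simp [letters]

lemma Reach.quat_norm {l : ℕ} {x : Quat} (h : Reach letters l x) : ‖x‖ = 1 := by
  obtain ⟨L, -, h2, rfl⟩ := h
  induction L with
  | nil => simp
  | cons a L ih =>
    rw [List.prod_cons, norm_mul, norm_of_mem_letters (h2 a (by simp)),
      ih fun s hs => h2 s (by simp [hs]), one_mul]

lemma Reach.quat_star {l : ℕ} {x : Quat} (h : Reach letters l x) : Reach letters l (star x) := by
  obtain ⟨L, h1, h2, rfl⟩ := h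
  refine Reach.mono ?_ h1
  clear h1
  induction L with
  | nil => simpa using reach_one
  | cons a L ih =>
    rw [List.prod_cons, star_mul]
    exact (ih fun s hs => h2 s (by simp [hs])).mul
      (reach_of_mem (star_mem_letters (h2 a (by simp))))

/-- The closed monoid generated by the letters. -/
def wordClosure : Submonoid Quat := (Submonoid.closure letters).topologicalClosure

lemma mem_wordClosure_of_letters {x : Quat} (h : x ∈ letters) : x ∈ wordClosure :=
  Submonoid.le_topologicalClosure _ (Submonoid.subset_closure h)

lemma isClosed_wordClosure : IsClosed (wordClosure : Set Quat) :=
  Submonoid.isClosed_topologicalClosure _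

lemma norm_of_mem_wordClosure {x : Quat} (h : x ∈ wordClosure) : ‖x‖ = 1 := by
  have : closure (Submonoid.closure letters : Set Quat) ⊆ {x | ‖x‖ = 1} := by
    refine closure_minimal (fun y hy => ?_) (isClosed_eq continuous_norm continuous_const)
    obtain ⟨K, hK⟩ := exists_reach_of_mem_closure hy
    exact hK.quat_norm
  exact this h

lemma star_mem_wordClosure {x : Quat} (h : x ∈ wordClosure) : star x ∈ wordClosure := by
  have : closure (Submonoid.closure letters : Set Quat) ⊆ {x | star x ∈ wordClosure} := by
    refine closure_minimal (fun y hy => ?_) (isClosed_wordClosure.preimage continuous_star)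
    obtain ⟨K, hK⟩ := exists_reach_of_mem_closure hy
    obtain ⟨L, -, h2, h3⟩ := hK.quat_star
    refine Submonoid.le_topologicalClosure _ ?_
    change star y ∈ _
    rw [← h3]
    exact Submonoid.list_prod_mem _ fun s hs => Submonoid.subset_closure (h2 s hs)
  exact this h

/-- Rotations about the axis `m` through arbitrarily small angles are in the closed monoid. -/
def IsAxis (m : Quat) : Prop :=
  m.re = 0 ∧ ∀ η : ℝ, 0 < η → ∃ a b : ℝ, 0 ≤ a ∧ b ≠ 0 ∧ |b| < η ∧ a • (1 : Quat) + b • m ∈ wordClosure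

lemma quat_re_mul_comm (x y : Quat) : (x * y).re = (y * x).re := by
  simp only [Quaternion.re_mul]; ring

lemma IsAxis.conj {m : Quat} (h : IsAxis m) {g : Quat} (hg : g ∈ wordClosure) :
    IsAxis (g * m * star g) := by
  have hs := quat_star_mul (norm_of_mem_wordClosure hg)
  have hs' := quat_mul_star (norm_of_mem_wordClosure hg)
  refine ⟨?_, fun η hη => ?_⟩
  · rw [quat_re_mul_comm, ← mul_assoc, hs, one_mul, h.1]
  · obtain ⟨a, b, h1, h2, h3, h4⟩ := h.2 η hη
    refine ⟨a, b, h1, h2, h3, ?_⟩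
    have := mul_mem (mul_mem hg h4) (star_mem_wordClosure hg)
    simpa only [mul_add, add_mul, mul_smul_comm, smul_mul_assoc, mul_one, hs'] using this

/-- If `1` is the point of the closed monoid nearest to `w`, then `w` is orthogonal to all axes. -/
lemma IsAxis.orthogonal {m : Quat} (h : IsAxis m) {w : Quat} (hw : ‖w‖ = 1)
    (hmax : ∀ g ∈ wordClosure, (star g * w).re ≤ w.re) : (star m * w).re = 0 := by
  have hwre : |w.re| ≤ 1 := by
    have := quat_norm_sq w
    rw [hw] at this
    rw [← sq_le_one_iff_abs_le_one]
    nlinarith [sq_nonneg w.imI, sq_nonneg w.imJ, sq_nonneg w.imK]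
  have hm := h.1
  set r := (star m * w).re with hr
  have key : ∀ η : ℝ, 0 < η → |r| ≤ η * ‖m‖ ^ 2 := by
    intro η hη
    obtain ⟨a, b, h1, h2, h3, h4⟩ := h.2 η hη
    have hn := quat_norm_sq (a • (1 : Quat) + b • m)
    have hn2 := quat_norm_sq m
    rw [norm_of_mem_wordClosure h4] at hn
    simp only [Quaternion.re_add, Quaternion.imI_add, Quaternion.imJ_add, Quaternion.imK_add,
      Quaternion.re_smul, Quaternion.imI_smul, Quaternion.imJ_smul, Quaternion.imK_smul,
      Quaternion.re_one, Quaternion.imI_one, Quaternion.imJ_one, Quaternion.imK_one, hm,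
      smul_eq_mul] at hn
    have hab : a ^ 2 + b ^ 2 * ‖m‖ ^ 2 = 1 := by rw [hn2, hm]; linear_combination -hn
    have e1 : (star (a • (1 : Quat) + b • m) * w).re = a * w.re + b * r := by
      rw [hr]
      simp only [Quaternion.star_smul, star_add, star_one, add_mul, smul_mul_assoc, one_mul,
        Quaternion.re_add, Quaternion.re_smul, smul_eq_mul]
    have e2 : (star (star (a • (1 : Quat) + b • m)) * w).re = a * w.re - b * r := by
      rw [hr, star_star]
      simp only [add_mul, smul_mul_assoc, one_mul, Quaternion.re_add, Quaternion.re_smul,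
        smul_eq_mul, Quaternion.re_mul, Quaternion.re_star, Quaternion.imI_star,
        Quaternion.imJ_star, Quaternion.imK_star, hm]
      ring
    have k1 := hmax _ h4
    have k2 := hmax _ (star_mem_wordClosure h4)
    rw [e1] at k1
    rw [e2] at k2
    -- Moving by `± b` along the axis changes the real part to first order by `± b r`, whereas the
    -- loss is only `1 - a ≤ 1 - a ^ 2 = b ^ 2 ‖m‖ ^ 2`. So `r` must vanish as `b → 0`.
    have k3 : |b| * |r| ≤ |b| * (|b| * ‖m‖ ^ 2) := by
      have ha1 : a ≤ 1 := by nlinarith [mul_nonneg (sq_nonneg b) (sq_nonneg ‖m‖)]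
      have : |b * r| ≤ (1 - a) * w.re := abs_le.2 ⟨by linarith, by linarith⟩
      have h5 : (1 - a) * w.re ≤ (1 - a) * 1 :=
        mul_le_mul_of_nonneg_left ((le_abs_self _).trans hwre) (by linarith)
      rw [abs_mul] at this
      rw [← mul_assoc, abs_mul_abs_self]
      nlinarith
    exact (le_of_mul_le_mul_left k3 (abs_pos.2 h2)).trans (by gcongr)
  by_contra hr0
  have hp : 0 < |r| := abs_pos.2 hr0
  have := key (|r| / (2 * (‖m‖ ^ 2 + 1))) (by positivity)
  rw [div_mul_eq_mul_div, le_div_iff₀ (by positivity)] at this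
  nlinarith [sq_nonneg ‖m‖, mul_nonneg hp.le (sq_nonneg ‖m‖)]

/-! ### A rotation through an angle incommensurable with `π` -/

lemma not_isIntegral_half : ¬ IsIntegral ℤ ((1 : ℝ) / 2) := by
  intro h
  have h1 : IsIntegral ℤ ((1 : ℚ) / 2) := by
    rw [← isIntegral_algebraMap_iff (algebraMap ℚ ℝ).injective (R := ℤ)]
    simpa using h
  obtain ⟨k, hk⟩ := IsIntegrallyClosed.isIntegral_iff.1 h1
  have h2 : (2 * k : ℚ) = 1 := by
    have : (k : ℚ) = 1 / 2 := by simpa using hk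
    rw [this]; norm_num
  have h3 : 2 * k = 1 := by exact_mod_cast h2
  omega

lemma cos_sq_pi_div_eight : Real.cos (Real.pi / 8) ^ 2 = 1 / 2 + √2 / 4 := by
  rw [Real.cos_sq, show 2 * (Real.pi / 8) = Real.pi / 4 by ring, Real.cos_pi_div_four]
  ring

lemma sin_sq_pi_div_eight : Real.sin (Real.pi / 8) ^ 2 = 1 / 2 - √2 / 4 := by
  rw [Real.sin_sq, cos_sq_pi_div_eight]; ring

lemma sin_pi_div_eight_pos : 0 < Real.sin (Real.pi / 8) :=
  Real.sin_pos_of_pos_of_lt_pi (by positivity) (by linarith [Real.pi_pos])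

lemma cos_pi_div_eight_pos : 0 < Real.cos (Real.pi / 8) :=
  Real.cos_pos_of_mem_Ioo ⟨by linarith [Real.pi_pos], by linarith [Real.pi_pos]⟩

/-- An angle with cosine `1 / 2 + √2 / 4` is not a rational multiple of `π`. -/
lemma sin_mul_ne_zero {θ : ℝ} (hθ : Real.cos θ = 1 / 2 + √2 / 4) {k : ℤ} (hk : k ≠ 0) :
    Real.sin (k * θ) ≠ 0 := by
  intro h
  obtain ⟨n, hn⟩ := Real.sin_eq_zero_iff.1 h
  have hk' : (k : ℝ) ≠ 0 := by exact_mod_cast hk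
  have hθ' : θ = ((n / k : ℚ) : ℝ) * Real.pi := by
    push_cast
    field_simp
    linarith
  -- Twice the cosine of a rational multiple of `π` is an algebraic integer, but here it is `1 + √2
  -- / 2`, and `(√2 / 2) ^ 2 = 1 / 2` is not integral.
  have h1 : IsIntegral ℤ (2 * Real.cos θ) := by
    rw [hθ']; exact Real.isIntegral_two_mul_cos_rat_mul_pi (n / k : ℚ)
  have h2 : IsIntegral ℤ (√2 / 2) := by
    have : √2 / 2 = 2 * Real.cos θ - 1 := by rw [hθ]; ring
    rw [this]
    exact h1.sub isIntegral_one
  have h3 := h2.mul h2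
  rw [← sq, sqrt_two_half_sq] at h3
  exact not_isIntegral_half h3

/-- Multiples of an angle which is not a rational multiple of `π` come arbitrarily near to `0`. -/
lemma exists_small_sin {θ : ℝ} (hθ : Real.cos θ = 1 / 2 + √2 / 4) {η : ℝ} (hη : 0 < η) :
    ∃ k : ℕ, 0 ≤ Real.cos (k * θ) ∧ Real.sin (k * θ) ≠ 0 ∧ |Real.sin (k * θ)| < η := by
  -- Dirichlet approximation of `θ / (2π)` with error at most `1 / (n + 1)`. The bound `1` for the
  -- remaining angle guarantees a nonnegative cosine.
  obtain ⟨n, hn⟩ := exists_nat_gt (2 * Real.pi / min η 1)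
  have hη' : 0 < min η 1 := lt_min hη one_pos
  have hn0 : 0 < n := by
    have : (0 : ℝ) < n := lt_trans (by positivity) hn
    exact_mod_cast this
  obtain ⟨j, k, hk0, -, h⟩ := Real.exists_int_int_abs_mul_sub_le (θ / (2 * Real.pi)) hn0
  have hx : |k * θ - j * (2 * Real.pi)| < min η 1 := by
    have e : k * θ - j * (2 * Real.pi) = (2 * Real.pi) * (k * (θ / (2 * Real.pi)) - j) := by
      field_simp
    rw [e, abs_mul, abs_of_pos (by positivity)]
    calc _ ≤ 2 * Real.pi * (1 / (n + 1)) := by gcongr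
      _ < min η 1 := by
        rw [mul_one_div, div_lt_iff₀ (by positivity)]
        rw [div_lt_iff₀ hη'] at hn
        nlinarith
  have hs : Real.sin (k * θ) = Real.sin (k * θ - j * (2 * Real.pi)) :=
    (Real.sin_sub_int_mul_two_pi _ _).symm
  have hc : Real.cos (k * θ) = Real.cos (k * θ - j * (2 * Real.pi)) :=
    (Real.cos_sub_int_mul_two_pi _ _).symm
  lift k to ℕ using hk0.le
  refine ⟨k, ?_, ?_, ?_⟩
  · have := hx.trans_le (min_le_right _ _)
    rw [abs_lt] at this
    have h3 := Real.pi_gt_three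
    simp only [Int.cast_natCast] at hc this
    rw [hc]
    exact Real.cos_nonneg_of_mem_Icc ⟨by linarith, by linarith⟩
  · simpa using sin_mul_ne_zero hθ hk0.ne'
  · simp only [Int.cast_natCast] at hs hx
    rw [hs]
    exact (Real.abs_sin_le_abs).trans_lt (hx.trans_le (min_le_left _ _))

/-- The imaginary part of the product of the two conjugate generators of order eight. -/
def axisQuat : Quat := quat 0 (Real.cos (Real.pi / 8) * Real.sin (Real.pi / 8))
  (Real.sin (Real.pi / 8) ^ 2) (Real.cos (Real.pi / 8) * Real.sin (Real.pi / 8))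

lemma quatT_mul_conj : quatT * (quatH * quatT * star quatH)
    = (1 / 2 + √2 / 4 : ℝ) • (1 : Quat) + (1 : ℝ) • axisQuat := by
  rw [← cos_sq_pi_div_eight]
  have h2 := sqrt_two_half_sq
  set c := Real.cos (Real.pi / 8)
  set s := Real.sin (Real.pi / 8)
  simp only [quatT, quatH, axisQuat, one_eq_quat, quat_mul, star_quat, smul_quat, quat_add]
  congr 1
  · linear_combination 2 * c ^ 2 * h2
  · linear_combination 2 * c * s * h2
  · linear_combination 2 * s ^ 2 * h2
  · linear_combination 2 * c * s * h2

/-- The quaternion `T * (H T H*)` is `cos θ + axisQuat` with `axisQuat ^ 2 = -sin θ ^ 2`. Its powers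
obey de Moivre's formula, and multiples of `θ` come near `0` modulo `2π` without reaching it. -/
lemma isAxis_axisQuat : IsAxis axisQuat := by
  have h2 : √2 ^ 2 = 2 := Real.sq_sqrt (by norm_num)
  have hlt : √2 < 2 := by nlinarith [Real.sqrt_nonneg 2]
  set θ := Real.arccos (1 / 2 + √2 / 4) with hθ
  have hcos : Real.cos θ = 1 / 2 + √2 / 4 :=
    Real.cos_arccos (by linarith [Real.sqrt_nonneg 2]) (by linarith)
  have hsin : Real.sin θ ≠ 0 := by
    simpa using sin_mul_ne_zero hcos (k := 1) one_ne_zero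
  have hsin2 : Real.sin θ ^ 2 = 2 * (1 / 2 + √2 / 4) * (1 / 2 - √2 / 4) + (1 / 2 - √2 / 4) ^ 2 := by
    rw [Real.sin_sq, hcos]; ring
  have hmm : axisQuat * axisQuat = (-(Real.sin θ ^ 2)) • (1 : Quat) := by
    rw [hsin2, ← sin_sq_pi_div_eight, ← cos_sq_pi_div_eight]
    simp only [axisQuat, one_eq_quat, quat_mul, smul_quat]
    congr 1 <;> ring
  have hpow : ∀ k : ℕ, (Real.cos θ • (1 : Quat) + (1 : ℝ) • axisQuat) ^ k
      = Real.cos (k * θ) • (1 : Quat) + (Real.sin (k * θ) / Real.sin θ) • axisQuat := by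
    intro k
    induction k with
    | zero => simp
    | succ k ih =>
      rw [pow_succ, ih]
      simp only [mul_add, add_mul, smul_mul_smul_comm, one_mul, mul_one, hmm, smul_smul]
      push_cast
      rw [add_mul, one_mul, Real.cos_add, Real.sin_add]
      match_scalars
      · field_simp
        ring
      · field_simp
  refine ⟨rfl, fun η hη => ?_⟩
  obtain ⟨k, h3, h4, h5⟩ := exists_small_sin hcos (η := η * |Real.sin θ|)
    (mul_pos hη (abs_pos.2 hsin))
  refine ⟨_, _, h3, div_ne_zero h4 hsin, ?_, ?_⟩
  · rw [abs_div, div_lt_iff₀ (abs_pos.2 hsin)]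
    exact h5
  · rw [← hpow, hcos, ← quatT_mul_conj]
    have hH : quatH ∈ wordClosure := mem_wordClosure_of_letters (by simp [letters])
    have hT : quatT ∈ wordClosure := mem_wordClosure_of_letters (by simp [letters])
    exact pow_mem (mul_mem hT (mul_mem (mul_mem hH hT) (star_mem_wordClosure hH))) k

/-- Every unit quaternion is a limit of words. -/
lemma mem_wordClosure {u : Quat} (hu : ‖u‖ = 1) : u ∈ wordClosure := by
  have hH : quatH ∈ wordClosure := mem_wordClosure_of_letters (by simp [letters])
  have hT : quatT ∈ wordClosure := mem_wordClosure_of_letters (by simp [letters])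
  have : ProperSpace Quat := FiniteDimensional.proper ℝ Quat
  have hcpt : IsCompact (wordClosure : Set Quat) := by
    refine Metric.isCompact_of_isClosed_isBounded isClosed_wordClosure ?_
    refine (Metric.isBounded_closedBall (x := (0 : Quat)) (r := 1)).subset fun x hx => ?_
    simpa using (norm_of_mem_wordClosure hx).le
  have hcont : Continuous fun g : Quat => (star g * u).re :=
    Quaternion.continuous_re.comp (by fun_prop)
  -- As `(star g * u).re` is the inner product of unit vectors, `g` is a point of the closed monoid
  -- nearest to `u`. After translation, `1` is nearest to `w`, and `w = 1` has to be shown.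
  obtain ⟨g, hg, hmax⟩ := hcpt.exists_isMaxOn ⟨1, one_mem wordClosure⟩ hcont.continuousOn
  have hgn := norm_of_mem_wordClosure hg
  set w := star g * u with hw
  have hwn : ‖w‖ = 1 := by rw [hw, norm_mul, norm_star, hgn, hu, one_mul]
  have hmax' : ∀ γ ∈ wordClosure, (star γ * w).re ≤ w.re := by
    intro γ hγ
    have := hmax (mul_mem hg hγ)
    simpa only [Set.mem_ofPred_eq, star_mul, mul_assoc] using this
  -- The axis and its conjugates under `H` and `T` are linearly independent, so the imaginary part
  -- of `w` vanishes. Since `H ^ 2 = -1`, the last comparison excludes `w = -1`.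
  have o1 := isAxis_axisQuat.orthogonal hwn hmax'
  have o2 := (isAxis_axisQuat.conj hH).orthogonal hwn hmax'
  have o3 := (isAxis_axisQuat.conj hT).orthogonal hwn hmax'
  have o4 := hmax' (quatH * quatH) (mul_mem hH hH)
  have h2 := sqrt_two_half_sq
  have hc0 := cos_pi_div_eight_pos
  have hs0 := sin_pi_div_eight_pos
  rw [eq_quat w] at o1 o2 o3 o4
  simp only [axisQuat, quatH, quatT, quat_mul, star_quat, quat_re] at o1 o2 o3 o4
  set c := Real.cos (Real.pi / 8)
  set s := Real.sin (Real.pi / 8)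
  have p1 : s * (c * (w.imI + w.imK) + s * w.imJ) = 0 := by linear_combination o1
  have p2 : s * (c * (w.imI + w.imK) - s * w.imJ) = 0 := by
    linear_combination o2 - 2 * (s * (c * (w.imI + w.imK) - s * w.imJ)) * h2
  have q2 : w.imJ = 0 := by
    have : s * s * w.imJ = 0 := by linear_combination (p1 - p2) / 2
    simpa [hs0.ne'] using this
  have q3 : w.imK = -w.imI := by
    have : s * c * (w.imI + w.imK) = 0 := by linear_combination (p1 + p2) / 2
    have : w.imI + w.imK = 0 := by simpa [hs0.ne', hc0.ne'] using this
    linarith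
  rw [q2, q3] at o3
  have q1 : w.imI = 0 := by
    have : s * s * s * c * w.imI = 0 := by linear_combination -o3 / 4
    simpa [hs0.ne', hc0.ne'] using this
  rw [q1, neg_zero] at q3
  have hq := quat_norm_sq w
  rw [hwn, q1, q2, q3] at hq
  rw [q1, q2, q3] at o4
  have hre : w.re = 1 := by
    have : 0 ≤ w.re := by nlinarith
    nlinarith
  have hw1 : w = 1 := by rw [eq_quat w, hre, q1, q2, q3]; rfl
  have : u = g := by
    rw [← mul_one g, ← hw1, hw, ← mul_assoc, quat_mul_star hgn, one_mul]
  exact this ▸ hg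

/-- Words of a fixed length approximate all unit quaternions to a given precision. -/
lemma exists_uniform_length {ε : ℝ} (hε : 0 < ε) :
    ∃ l : ℕ, ∀ u : Quat, ‖u‖ = 1 → ∃ v, Reach letters l v ∧ ‖v - u‖ < ε := by
  have : ProperSpace Quat := FiniteDimensional.proper ℝ Quat
  have hcpt : IsCompact {u : Quat | ‖u‖ = 1} := by
    simpa [Metric.sphere, dist_zero_right] using isCompact_sphere (0 : Quat) 1
  let U : ℕ → Set Quat := fun l => ⋃ v ∈ {v | Reach letters l v}, Metric.ball v ε
  have hU : ∀ l, IsOpen (U l) := fun l => isOpen_biUnion fun v _ => Metric.isOpen_ball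
  have hmono : Monotone U := by
    intro l l' h
    exact Set.biUnion_subset_biUnion_left fun v hv => hv.mono h
  have hcov : {u : Quat | ‖u‖ = 1} ⊆ ⋃ l, U l := by
    intro u hu
    have := mem_wordClosure hu
    obtain ⟨v, hv, hvu⟩ := Metric.mem_closure_iff.1 this ε hε
    obtain ⟨l, hl⟩ := exists_reach_of_mem_closure hv
    exact Set.mem_iUnion.2 ⟨l, Set.mem_biUnion (x := v) hl hvu⟩
  obtain ⟨l, hl⟩ := hcpt.elim_directed_cover U hU hcov hmono.directed_le
  refine ⟨l, fun u hu => ?_⟩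
  obtain ⟨v, hv, hvu⟩ := Set.mem_iUnion₂.1 (hl hu)
  refine ⟨v, hv, ?_⟩
  rw [← dist_eq_norm, dist_comm]
  exact hvu

/-- The recursion of Solovay and Kitaev. -/
lemma exists_word_of_level {l : ℕ}
    (hl : ∀ u : Quat, ‖u‖ = 1 → ∃ v, Reach letters l v ∧ ‖v - u‖ < (Real.exp (-1 / 2) / 6) ^ 2)
    (k : ℕ) (u : Quat) (hu : ‖u‖ = 1) :
    ∃ v, Reach letters (5 ^ k * l) v ∧ ‖v - u‖ ≤ (Real.exp (-(3 / 2) ^ k / 2) / 6) ^ 2 := by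
  induction k generalizing u with
  | zero =>
    obtain ⟨v, h1, h2⟩ := hl u hu
    exact ⟨v, by simpa using h1, by simpa using h2.le⟩
  | succ k ih =>
    set δ := Real.exp (-(3 / 2) ^ k / 2) / 6 with hδ
    have hδ0 : 0 < δ := by positivity
    have hδ1 : δ ≤ 1 := by
      have : Real.exp (-(3 / 2) ^ k / 2) ≤ 1 :=
        Real.exp_le_one_iff.2 (by
          have : (0 : ℝ) ≤ (3 / 2) ^ k := by positivity
          linarith)
      rw [hδ]; linarith
    -- The precisions are chosen so that `δ ^ 2 ↦ 6 δ ^ 3` is exactly the passage from one level to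
    -- the next.
    have hnext : (Real.exp (-(3 / 2) ^ (k + 1) / 2) / 6) ^ 2 = 6 * δ ^ 3 := by
      have : Real.exp (-(3 / 2) ^ (k + 1) / 2) ^ 2 = Real.exp (-(3 / 2) ^ k / 2) ^ 3 := by
        rw [← Real.exp_nat_mul, ← Real.exp_nat_mul]
        congr 1
        push_cast
        ring
      rw [hδ, div_pow (Real.exp _), this]
      ring
    obtain ⟨v₀, hv₀, hv₀u⟩ := ih u hu
    have n₀ := hv₀.quat_norm
    set x := u * star v₀ with hx
    have nx : ‖x‖ = 1 := by rw [hx, norm_mul, norm_star, hu, n₀, one_mul]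
    have hxv : x * v₀ = u := by rw [hx, mul_assoc, quat_star_mul n₀, mul_one]
    have hx1 : ‖x - 1‖ ≤ δ ^ 2 := by
      have : (x - 1) * v₀ = u - v₀ := by rw [sub_mul, hxv, one_mul]
      rw [← mul_one ‖x - 1‖, ← n₀, ← norm_mul, this, norm_sub_rev]
      exact hv₀u
    -- The correction `x = u * star v₀` is within `δ ^ 2` of `1`, hence a commutator of units within
    -- `δ`. The four letters of the commutator and `v₀` are five words of the preceding level.
    obtain ⟨v, w, nv, nw, hvw, hv1, hw1⟩ := exists_commutator x nx
    obtain ⟨v', hv', hvv'⟩ := ih v nv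
    obtain ⟨w', hw', hww'⟩ := ih w nw
    refine ⟨v' * w' * star v' * star w' * v₀,
      ((((hv'.mul hw').mul hv'.quat_star).mul hw'.quat_star).mul hv₀).mono (le_of_eq (by ring)), ?_⟩
    have e : v' * w' * star v' * star w' * v₀ - u
        = (v' * w' * star v' * star w' - v * w * star v * star w) * v₀ := by
      rw [sub_mul, ← hvw, hxv]
    rw [e, norm_mul, n₀, mul_one, hnext]
    calc _ ≤ 2 * δ ^ 2 * (2 * δ + δ ^ 2) :=
          norm_commutator_sub_le nv hv'.quat_norm nw hw'.quat_norm hvv' hww'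
            (abs_le_of_sq_le_sq' (hv1.trans hx1) hδ0.le).2
            (abs_le_of_sq_le_sq' (hw1.trans hx1) hδ0.le).2
      _ ≤ 6 * δ ^ 3 := by nlinarith [pow_pos hδ0 3]

/-- Unit quaternions are approximated by words of polylogarithmic length. -/
lemma exists_short_word : ∃ K : ℕ, ∀ u : Quat, ‖u‖ = 1 → ∀ ε : ℝ, 0 < ε → ε ≤ 1 →
    ∃ (l : ℕ) (v : Quat), Reach letters l v ∧ (l : ℝ) ≤ K * (1 + Real.log (1 / ε)) ^ 4 ∧
      ‖v - u‖ ≤ ε := by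
  obtain ⟨l, hl⟩ := exists_uniform_length (ε := (Real.exp (-1 / 2) / 6) ^ 2) (by positivity)
  refine ⟨5 * l, fun u hu ε hε hε1 => ?_⟩
  have hlog : 0 ≤ Real.log (1 / ε) := Real.log_nonneg (by rw [le_div_iff₀ hε]; linarith)
  set y := 1 + Real.log (1 / ε) with hy
  obtain ⟨n, hn1, hn2⟩ := exists_nat_pow_near (x := y) (y := 3 / 2) (by linarith) (by norm_num)
  obtain ⟨v, hv, hvu⟩ := exists_word_of_level hl (n + 1) u hu
  refine ⟨_, v, hv, ?_, hvu.trans ?_⟩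
  · have h5 : (5 : ℝ) ^ n ≤ y ^ 4 := by
      -- The exponent `4` of the logarithm comes from `5 ≤ (3 / 2) ^ 4 = 81 / 16`.
      calc (5 : ℝ) ^ n ≤ ((3 / 2) ^ 4) ^ n := by gcongr; norm_num
        _ = ((3 / 2) ^ n) ^ 4 := by rw [← pow_mul, ← pow_mul, mul_comm]
        _ ≤ y ^ 4 := by gcongr
    push_cast
    rw [pow_succ]
    calc (5 : ℝ) ^ n * 5 * l = 5 * l * 5 ^ n := by ring
      _ ≤ 5 * l * y ^ 4 := by gcongr
  · rw [div_pow, ← Real.exp_nat_mul]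
    have h1 : Real.exp (((2 : ℕ) : ℝ) * (-(3 / 2) ^ (n + 1) / 2)) ≤ ε := by
      rw [← Real.le_log_iff_exp_le hε]
      rw [one_div, Real.log_inv] at hy
      push_cast
      linarith
    have h2 := Real.exp_pos (((2 : ℕ) : ℝ) * (-(3 / 2) ^ (n + 1) / 2))
    linarith


/-! ### One-qubit gates as unit quaternions -/

/-- The matrix of a quaternion. -/
def quatMatrix (x : Quat) : Matrix Bool Bool ℂ := fun a b =>
  if a then (if b then ⟨x.re, x.imK⟩ else ⟨x.imJ, -x.imI⟩)
  else (if b then ⟨-x.imJ, -x.imI⟩ else ⟨x.re, -x.imK⟩)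

lemma quatMatrix_mul (x y : Quat) : quatMatrix (x * y) = quatMatrix x * quatMatrix y := by
  ext a b
  cases a <;> cases b <;> apply Complex.ext <;>
    simp [quatMatrix, Matrix.mul_apply, Quaternion.re_mul, Quaternion.imI_mul,
      Quaternion.imJ_mul, Quaternion.imK_mul] <;> ring

lemma quatMatrix_one : quatMatrix 1 = 1 := by
  rw [one_eq_quat]
  ext a b
  cases a <;> cases b <;> apply Complex.ext <;> simp [quatMatrix]

lemma quatMatrix_sub (x y : Quat) : quatMatrix (x - y) = quatMatrix x - quatMatrix y := by
  ext a b
  cases a <;> cases b <;> apply Complex.ext <;>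
    simp [quatMatrix] <;> ring

lemma quatMatrix_conjTranspose (x : Quat) : (quatMatrix x).conjTranspose = quatMatrix (star x) := by
  ext a b
  cases a <;> cases b <;> apply Complex.ext <;>
    simp [quatMatrix]

lemma quatMatrix_coe (r : ℝ) : quatMatrix (r : Quat) = (r : ℂ) • (1 : Matrix Bool Bool ℂ) := by
  ext a b
  cases a <;> cases b <;> apply Complex.ext <;> simp [quatMatrix]

section
variable {Q : Type} [DecidableEq Q] [Fintype Q]

lemma scales_oneOp_quatMatrix (q : Q) (x : Quat) : Scales ‖x‖ (oneOp q (quatMatrix x)) := by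
  refine scales_oneOp q (norm_nonneg _) ?_
  rw [quatMatrix_conjTranspose, ← quatMatrix_mul, Quaternion.star_mul_self, quatMatrix_coe,
    Quaternion.normSq_eq_norm_mul_self, sq]

lemma det_bool (A : Matrix Bool Bool ℂ) :
    A.det = A false false * A true true - A false true * A true false := by
  rw [← Matrix.det_submatrix_equiv_self finTwoEquiv, Matrix.det_fin_two]
  rfl

/-- Every unitary matrix of size two is a unit quaternion times a phase. -/
lemma exists_quatMatrix {U : Matrix Bool Bool ℂ} (hU : U ∈ Matrix.unitaryGroup Bool ℂ) :
    ∃ (z : ℂ) (x : Quat), ‖z‖ = 1 ∧ ‖x‖ = 1 ∧ U = z • quatMatrix x := by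
  have hdet : ‖U.det‖ = 1 := by
    have := Matrix.det_of_mem_unitary hU
    simpa using CStarRing.norm_of_mem_unitary this
  obtain ⟨w, hw, hww⟩ := exists_sqrt hdet
  have hw0 : w ≠ 0 := fun h => by simp [h] at hw
  have hws : star w = w⁻¹ := by
    refine eq_inv_of_mul_eq_one_left ?_
    rw [Complex.star_def, mul_comm, Complex.mul_conj, Complex.normSq_eq_norm_sq, hw]
    norm_num
  -- Division by a square root of the determinant leads to SU(2), where the second column is
  -- determined by the first.
  set V := w⁻¹ • U with hV
  have hVdet : V.det = 1 := by
    rw [hV, Matrix.det_smul, ← hww]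
    simp [sq]
    field_simp
  have hVU : V.conjTranspose * V = 1 := by
    rw [hV, Matrix.conjTranspose_smul, ← Matrix.star_eq_conjTranspose, star_inv₀, hws, inv_inv,
      Matrix.smul_mul, Matrix.mul_smul, smul_smul, mul_inv_cancel₀ hw0, one_smul,
      Matrix.mem_unitaryGroup_iff'.1 hU]
  rw [det_bool] at hVdet
  have h1 := congrFun (congrFun hVU false) false
  have h2 := congrFun (congrFun hVU false) true
  simp only [Matrix.mul_apply, Fintype.sum_bool, Matrix.conjTranspose_apply, Matrix.one_apply_eq,
    ne_eq, Bool.false_eq_true, not_false_eq_true, Matrix.one_apply_ne] at h1 h2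
  have e1 : V true true = star (V false false) := by
    linear_combination -V true true * h1 + star (V false false) * hVdet
      + V true false * h2
  have e2 : V false true = -star (V true false) := by
    linear_combination -V false true * h1 - star (V true false) * hVdet
      + V false false * h2
  have hUV : U = w • V := by rw [hV, smul_smul, mul_inv_cancel₀ hw0, one_smul]
  refine ⟨w, quat (V false false).re (-(V true false).im) (V true false).re (-(V false false).im),
    hw, quat_norm_eq_one ?_, ?_⟩
  · have := congrArg Complex.re h1
    simp at this
    simp only [quat_re, quat_imI, quat_imJ, quat_imK]
    linear_combination this
  · rw [hUV]
    congr 1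
    ext a b
    cases a <;> cases b <;> simp [quatMatrix, e1, e2] <;> apply Complex.ext <;> simp

/-- The gates of the two generators agree with quaternions up to a phase. -/
lemma exists_circuit_of_letter (q : Q) {x : Quat} (hx : x ∈ letters) :
    ∃ (C : QCircuit Q) (z : ℂ), C.length ≤ 7 ∧ ‖z‖ = 1 ∧ circOp C = z • oneOp q (quatMatrix x) := by
  have hH : hadamardMatrix = Complex.I • quatMatrix quatH := by
    ext a b
    cases a <;> cases b <;> simp [hadamardMatrix, quatMatrix, quatH] <;> apply Complex.ext <;> simp
  have hsH : star quatH = -quatH := by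
    rw [quatH, star_quat, neg_zero]
    apply Quaternion.ext <;> simp
  have hsH' : quatMatrix (star quatH) = -quatMatrix quatH := by
    have h0 : quatMatrix (0 : Quat) = 0 := by rw [← sub_self (0 : Quat), quatMatrix_sub, sub_self]
    rw [hsH, ← zero_sub, quatMatrix_sub, h0, zero_sub]
  set E := Complex.exp ((Real.pi / 8 : ℝ) * Complex.I) with hEdef
  have hE1 : ‖E‖ = 1 := Complex.norm_exp_ofReal_mul_I _
  have hE : E = ⟨Real.cos (Real.pi / 8), Real.sin (Real.pi / 8)⟩ :=
    Complex.ext (Complex.exp_ofReal_mul_I_re _) (Complex.exp_ofReal_mul_I_im _)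
  have hωE : omega = E * E := by
    rw [omega, hEdef, ← Complex.exp_add]
    congr 1
    push_cast
    ring
  have hT : Matrix.diagonal (fun b => if b then omega else 1) = E • quatMatrix quatT := by
    rw [hωE, hE, quatT]
    have hcs := Real.sin_sq_add_cos_sq (Real.pi / 8)
    generalize Real.cos (Real.pi / 8) = c at hcs
    generalize Real.sin (Real.pi / 8) = s at hcs
    ext a b
    cases a <;> cases b <;> apply Complex.ext <;> simp [quatMatrix]
    · linear_combination -hcs
    · ring
  -- The inverse of the `π / 8` gate is its seventh power; this is the source of the bound `7` for
  -- the length.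
  have hT7 : Matrix.diagonal (fun b => if b then omega ^ 7 else 1) =
      star E • quatMatrix (star quatT) := by
    have h1 : star omega = omega ^ 7 := by
      have h2 : star omega * omega = 1 := by
        rw [Complex.star_def, mul_comm, Complex.mul_conj, Complex.normSq_eq_norm_sq, norm_omega]
        norm_num
      calc star omega = star omega * omega * omega ^ 7 := by
            rw [mul_assoc, ← pow_succ', omega_pow_eight, mul_one]
        _ = omega ^ 7 := by rw [h2, one_mul]
    rw [← quatMatrix_conjTranspose, ← Matrix.conjTranspose_smul, ← hT,
      Matrix.diagonal_conjTranspose]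
    congr 1
    ext b
    cases b <;> simp [← h1]
  have hhad : circOp [QGate.hadamard q] = oneOp q hadamardMatrix :=
    (circOp_singleton _).trans (gateOp_hadamard q)
  obtain rfl | rfl | rfl | rfl := hx
  · exact ⟨[QGate.hadamard q], Complex.I, by simp, by simp, by rw [hhad, hH, oneOp_smul]⟩
  · refine ⟨[QGate.hadamard q], -Complex.I, by simp, by simp, ?_⟩
    rw [hhad, hH, ← oneOp_smul, hsH', neg_smul, smul_neg, neg_neg]
  · refine ⟨[QGate.tgate q], E, by simp, hE1, ?_⟩
    rw [circOp_singleton, gateOp_tgate, hT, oneOp_smul]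
  · refine ⟨tpow 7 q, star E, by simp [tpow], by rw [norm_star, hE1], ?_⟩
    rw [← oneOp_smul, ← hT7, circOp_tpow, oneOp_diagonal]

/-! ### Approximation by circuits -/

/-- The circuit `C` approximates `S` up to a phase. -/
def Approx (C : QCircuit Q) (S : Op (Q → Bool)) (ε : ℝ) : Prop :=
  ∃ z : ℂ, ‖z‖ = 1 ∧ ∀ X, nrm (circOp C X - z • S X) ≤ ε * nrm X

/-- The circuit operator and `T` are both isometric, so neither error is amplified, and the phases
multiply. -/
lemma Approx.mul {C D : QCircuit Q} {S T : Op (Q → Bool)} {ε δ : ℝ} (hS : Approx C S ε)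
    (hT : Approx D T δ) (h1 : Scales 1 T) : Approx (C ++ D) (T * S) (ε + δ) := by
  obtain ⟨z, hz, hzS⟩ := hS
  obtain ⟨w, hw, hwT⟩ := hT
  refine ⟨w * z, by simp [hz, hw], fun X => ?_⟩
  have e : circOp (C ++ D) X - (w * z) • (T * S) X
      = (circOp D (circOp C X) - w • T (circOp C X)) + w • T (circOp C X - z • S X) := by
    rw [circOp_append, map_sub, map_smul, smul_sub, smul_smul, Module.End.mul_apply,
      Module.End.mul_apply]
    abel
  rw [e]
  refine (nrm_add_le _ _).trans ?_
  have k1 := hwT (circOp C X)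
  rw [scales_circOp C X, one_mul] at k1
  rw [nrm_smul, hw, one_mul, h1, one_mul]
  linarith [hzS X]

lemma approx_of_eq {C : QCircuit Q} {S : Op (Q → Bool)} {z : ℂ} (hz : ‖z‖ = 1)
    (h : circOp C = z • S) {ε : ℝ} (hε : 0 ≤ ε) : Approx C S ε :=
  ⟨z, hz, fun X => by
    rw [h, LinearMap.smul_apply, sub_self]
    have : nrm (0 : (Q → Bool) → ℂ) = 0 := by simp [nrm]
    rw [this]
    exact mul_nonneg hε (nrm_nonneg _)⟩

lemma exists_circuit_of_reach (q : Q) {l : ℕ} {x : Quat} (hx : Reach letters l x) :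
    ∃ (C : QCircuit Q) (z : ℂ), C.length ≤ 7 * l ∧ ‖z‖ = 1 ∧
      circOp C = z • oneOp q (quatMatrix x) := by
  obtain ⟨L, h1, h2, rfl⟩ := hx
  suffices ∃ (C : QCircuit Q) (z : ℂ), C.length ≤ 7 * L.length ∧ ‖z‖ = 1 ∧
      circOp C = z • oneOp q (quatMatrix L.prod) from
    let ⟨C, z, h, h'⟩ := this; ⟨C, z, h.trans (Nat.mul_le_mul_left 7 h1), h'⟩
  clear h1
  induction L with
  | nil => exact ⟨[], 1, by simp, by simp, by simp [quatMatrix_one, oneOp_one]⟩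
  | cons a L ih =>
    obtain ⟨C, z, k1, k2, k3⟩ := ih fun s hs => h2 s (by simp [hs])
    obtain ⟨D, w, j1, j2, j3⟩ := exists_circuit_of_letter q (h2 a (by simp))
    refine ⟨C ++ D, w * z, by simp; omega, by simp [k2, j2], ?_⟩
    rw [circOp_append, k3, j3, smul_mul_smul_comm, oneOp_mul, ← quatMatrix_mul, List.prod_cons]

/-- The one-qubit case of the theorem of Solovay and Kitaev. -/
lemma exists_approx_oneOp : ∃ K : ℕ, ∀ (Q : Type) [DecidableEq Q] [Fintype Q] (q : Q),
    ∀ U ∈ Matrix.unitaryGroup Bool ℂ, ∀ ε : ℝ, 0 < ε → ε ≤ 1 → ∃ C : QCircuit Q,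
      (C.length : ℝ) ≤ K * (1 + Real.log (1 / ε)) ^ 4 ∧ Approx C (oneOp q U) ε := by
  obtain ⟨K, hK⟩ := exists_short_word
  refine ⟨7 * K, fun Q _ _ q U hU ε hε hε1 => ?_⟩
  obtain ⟨z, x, hz, hx, rfl⟩ := exists_quatMatrix hU
  obtain ⟨l, v, h1, h2, h3⟩ := hK x hx ε hε hε1
  obtain ⟨C, w, k1, k2, k3⟩ := exists_circuit_of_reach q h1
  have hz0 : z ≠ 0 := fun h => by simp [h] at hz
  refine ⟨C, ?_, w * z⁻¹, by simp [k2, hz], fun X => ?_⟩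
  · have : (C.length : ℝ) ≤ 7 * l := by exact_mod_cast k1
    push_cast
    linarith
  · rw [k3, oneOp_smul, LinearMap.smul_apply, LinearMap.smul_apply, smul_smul, mul_assoc,
      inv_mul_cancel₀ hz0, mul_one, ← smul_sub, nrm_smul, k2, one_mul, ← LinearMap.sub_apply,
      ← oneOp_sub, ← quatMatrix_sub, scales_oneOp_quatMatrix]
    exact mul_le_mul_of_nonneg_right h3 (nrm_nonneg _)

end

lemma exists_approx_basicOps : ∃ K : ℕ, ∀ (Q : Type) [DecidableEq Q] [Fintype Q],
    ∀ S ∈ basicOps Q, ∀ ε : ℝ, 0 < ε → ε ≤ 1 → ∃ C : QCircuit Q,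
      (C.length : ℝ) ≤ K * (1 + Real.log (1 / ε)) ^ 4 ∧ Approx C S ε := by
  obtain ⟨K, hK⟩ := exists_approx_oneOp
  refine ⟨K + 37, fun Q _ _ S hS ε hε hε1 => ?_⟩
  have hlog : 0 ≤ Real.log (1 / ε) := Real.log_nonneg (by rw [le_div_iff₀ hε]; linarith)
  have hp : 1 ≤ (1 + Real.log (1 / ε)) ^ 4 := one_le_pow₀ (by linarith)
  push_cast
  obtain ⟨q, U, hU, rfl⟩ | ⟨g, rfl⟩ | ⟨z, hz, rfl⟩ := hS
  · obtain ⟨C, h1, h2⟩ := hK Q q U hU ε hε hε1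
    exact ⟨C, by nlinarith, h2⟩
  · refine ⟨g.circuit, ?_, approx_of_eq (z := 1) (by simp) (by rw [g.circOp_circuit, one_smul]) hε.le⟩
    have : (g.circuit.length : ℝ) ≤ 37 := by exact_mod_cast g.length_circuit
    nlinarith [(Nat.cast_nonneg K : (0 : ℝ) ≤ K)]
  · have hz0 : z ≠ 0 := fun h => by simp [h] at hz
    refine ⟨[], ?_, approx_of_eq (z := z⁻¹) (by simp [hz]) (by simp [smul_smul, hz0]) hε.le⟩
    simp only [List.length_nil, Nat.cast_zero]
    positivity

lemma exists_approx_reach : ∃ K : ℕ, ∀ (Q : Type) [DecidableEq Q] [Fintype Q] (S : Op (Q → Bool))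
    (m : ℕ), Reach (basicOps Q) m S → ∀ ε : ℝ, 0 < ε → ε ≤ 1 → ∃ C : QCircuit Q,
      (C.length : ℝ) ≤ K * ((1 + m) * (1 + Real.log (1 / ε))) ^ 5 ∧ Approx C S ε := by
  obtain ⟨K, hK⟩ := exists_approx_basicOps
  refine ⟨K, fun Q _ _ S m hS ε hε hε1 => ?_⟩
  obtain ⟨L, h1, h2, rfl⟩ := hS
  have hlog : 0 ≤ Real.log (1 / ε) := Real.log_nonneg (by rw [le_div_iff₀ hε]; linarith)
  -- Equal shares of the error for at most `m` factors; the summand `1` covers `m = 0`.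
  set η := ε / (1 + m) with hη
  have hη0 : 0 < η := by positivity
  have hη1 : η ≤ 1 := by rw [hη, div_le_one (by positivity)]; linarith [(Nat.cast_nonneg m : (0 : ℝ) ≤ m)]
  set B := (K : ℝ) * (1 + Real.log (1 / η)) ^ 4 with hB
  have hlogη : Real.log (1 / η) ≤ m + Real.log (1 / ε) := by
    have : 1 / η = (1 + m) * (1 / ε) := by rw [hη]; field_simp
    rw [this, Real.log_mul (by positivity) (by positivity)]
    have := Real.log_le_sub_one_of_pos (x := 1 + m) (by positivity)
    linarith
  have hlogη0 : 0 ≤ Real.log (1 / η) := Real.log_nonneg (by rw [le_div_iff₀ hη0]; linarith)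
  have hB0 : 0 ≤ B := by positivity
  suffices ∃ C : QCircuit Q, (C.length : ℝ) ≤ L.length * B ∧ Approx C L.prod (L.length * η) by
    obtain ⟨C, k1, z, hz, k2⟩ := this
    have hm : (L.length : ℝ) ≤ m := by exact_mod_cast h1
    refine ⟨C, k1.trans ?_, z, hz, fun X => (k2 X).trans ?_⟩
    · set y := 1 + Real.log (1 / ε)
      have hy : 1 ≤ y := by linarith
      have hm0 : (0 : ℝ) ≤ m := Nat.cast_nonneg m
      have h3 : 1 + Real.log (1 / η) ≤ (1 + m) * y := by nlinarith
      calc L.length * B ≤ (1 + m) * y * B := by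
            refine mul_le_mul_of_nonneg_right ?_ hB0
            nlinarith
        _ ≤ (1 + m) * y * (K * ((1 + m) * y) ^ 4) := by
            rw [hB]; gcongr
        _ = _ := by
            generalize (1 + (m : ℝ)) * y = t
            ring
    · refine mul_le_mul_of_nonneg_right ?_ (nrm_nonneg X)
      rw [hη, mul_div_assoc', div_le_iff₀ (by positivity)]
      nlinarith
  clear h1
  induction L with
  | nil => exact ⟨[], by simp, approx_of_eq (z := 1) (by simp) (by simp) (by simp)⟩
  | cons a L ih =>
    obtain ⟨C, k1, k2⟩ := ih fun s hs => h2 s (by simp [hs])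
    obtain ⟨D, j1, j2⟩ := hK Q a (h2 a (by simp)) η hη0 hη1
    refine ⟨C ++ D, ?_, ?_⟩
    · simp only [List.length_append, List.length_cons]
      push_cast
      linarith
    · have := k2.mul j2 (scales_basicOps a (h2 a (by simp)))
      rw [List.prod_cons]
      convert this using 1
      simp only [List.length_cons]
      push_cast
      ring

/-- Approximation of the wavelet transform by circuits of polynomial length. -/
theorem exists_approx_transform (F : WaveletFilter) : ∃ K : ℕ, ∀ (n : ℕ) (ε : ℝ), 0 < ε → ε ≤ 1 →
    ∃ C : QCircuit (Fin n), (C.length : ℝ) ≤ K * ((n + 1) ^ 7 * (1 + Real.log (1 / ε))) ^ 5 ∧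
      Approx C (pyramidOp F n) ε := by
  obtain ⟨K, hK⟩ := exists_approx_reach
  obtain ⟨m, hm⟩ := exists_reach_transform_basic F
  refine ⟨K * (1 + m) ^ 5, fun n ε hε hε1 => ?_⟩
  obtain ⟨C, h1, h2⟩ := hK _ _ _ (hm n) ε hε hε1
  refine ⟨C, h1.trans ?_, h2⟩
  have hlog : 0 ≤ Real.log (1 / ε) := Real.log_nonneg (by rw [le_div_iff₀ hε]; linarith)
  have h7 : (1 : ℝ) ≤ (n + 1) ^ 7 := one_le_pow₀ (by linarith [(Nat.cast_nonneg n : (0 : ℝ) ≤ n)])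
  push_cast
  calc (K : ℝ) * ((1 + m * (n + 1) ^ 7) * (1 + Real.log (1 / ε))) ^ 5
      ≤ K * (((1 + m) * (n + 1) ^ 7) * (1 + Real.log (1 / ε))) ^ 5 := by
        gcongr
        nlinarith
    _ = _ := by rw [mul_assoc (1 + (m : ℝ)), mul_pow (1 + (m : ℝ)), mul_assoc]


/-! ### Boolean straight-line programs -/

/-- `Slp K W`: a straight-line program with `K` steps computes the Boolean functions in `W`, among
which are the input bits. -/
inductive Slp {n : ℕ} : ℕ → Set ((Fin n → Bool) → Bool) → Prop
  | inputs : Slp 0 (Set.range fun i x => x i)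
  | one {K : ℕ} {W : Set ((Fin n → Bool) → Bool)} (h : Slp K W) :
      Slp (K + 1) (insert (fun _ => true) W)
  | nand {K : ℕ} {W : Set ((Fin n → Bool) → Bool)} (h : Slp K W) {f g : (Fin n → Bool) → Bool}
      (hf : f ∈ W) (hg : g ∈ W) : Slp (K + 1) (insert (fun x => !(f x && g x)) W)

/-- The number of steps needed for an arbitrary function of `c` given bits. -/
def slpCost : ℕ → ℕ
  | 0 => 2
  | c + 1 => 2 * slpCost c + 4

lemma slpCost_mono : Monotone slpCost := monotone_nat_of_le_succ fun c => by
  rw [slpCost]; omega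

section
variable {n : ℕ}

/-- A function determined by some functions that are already computed can be computed. -/
lemma Slp.extend (ws : List ((Fin n → Bool) → Bool)) : ∀ {K : ℕ} {W : Set ((Fin n → Bool) → Bool)}
    (_ : Slp K W) (_ : ∀ w ∈ ws, w ∈ W) (h : (Fin n → Bool) → Bool)
    (_ : ∀ x x', (∀ w ∈ ws, w x = w x') → h x = h x'),
    ∃ K' W', Slp K' W' ∧ K' ≤ K + slpCost ws.length ∧ W ⊆ W' ∧ h ∈ W' := by
  classical
  induction ws with
  | nil =>
    intro K W hW _ h hdet
    have hc : ∀ x x', h x = h x' := fun x x' => hdet x x' (by simp)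
    have h1 := hW.one
    cases hb : h (fun _ => false) with
    | true =>
      refine ⟨_, _, h1, by simp [slpCost], Set.subset_insert _ _, ?_⟩
      have : h = fun _ => true := funext fun x => (hc x _).trans hb
      rw [this]
      exact Set.mem_insert _ _
    | false =>
      refine ⟨_, _, h1.nand (Set.mem_insert _ _) (Set.mem_insert _ _), by simp [slpCost],
        (Set.subset_insert _ _).trans (Set.subset_insert _ _), ?_⟩
      have : h = fun _ => !(true && true) := funext fun x => (hc x _).trans hb
      rw [this]
      exact Set.mem_insert _ _
  | cons w ws ih =>
    intro K W hW hws h hdet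
    -- Shannon expansion in `w`: `r b` depends only on the other given bits and agrees with `h`
    -- where `w = b`. The existential quantifier makes it defined also for combinations of bits that
    -- do not occur. Four NANDs then select by `w`.
    let r : Bool → (Fin n → Bool) → Bool := fun b x =>
      decide (∃ x', w x' = b ∧ (∀ v ∈ ws, v x' = v x) ∧ h x' = true)
    have hr : ∀ x, r (w x) x = h x := by
      intro x
      have : (∃ x', w x' = w x ∧ (∀ v ∈ ws, v x' = v x) ∧ h x' = true) ↔ h x = true := by
        constructor
        · rintro ⟨x', h1, h2, h3⟩
          rw [← h3]
          refine hdet _ _ fun v hv => ?_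
          obtain rfl | hv := List.mem_cons.1 hv
          · exact h1.symm
          · exact (h2 v hv).symm
        · exact fun h1 => ⟨x, rfl, fun _ _ => rfl, h1⟩
      simp only [r, this, Bool.decide_eq_true]
    have hrdet : ∀ b x x', (∀ v ∈ ws, v x = v x') → r b x = r b x' := by
      intro b x x' hx
      simp only [r]
      congr 1
      refine propext (exists_congr fun y => and_congr_right fun _ => and_congr_left fun _ => ?_)
      exact forall₂_congr fun v hv => by rw [hx v hv]
    obtain ⟨K1, W1, s1, k1, i1, m1⟩ := ih hW (fun v hv => hws v (by simp [hv])) (r true) (hrdet true)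
    obtain ⟨K2, W2, s2, k2, i2, m2⟩ := ih s1 (fun v hv => i1 (hws v (by simp [hv]))) (r false)
      (hrdet false)
    have hw : w ∈ W2 := i2 (i1 (hws w (by simp)))
    have t1 := s2.nand hw (i2 m1)
    have t2 := t1.nand (Set.mem_insert_of_mem _ hw) (Set.mem_insert_of_mem _ hw)
    have t3 := t2.nand (Set.mem_insert _ _)
      (Set.mem_insert_of_mem _ (Set.mem_insert_of_mem _ m2))
    have t4 := t3.nand (Set.mem_insert_of_mem _ (Set.mem_insert_of_mem _ (Set.mem_insert _ _)))
      (Set.mem_insert _ _)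
    refine ⟨_, _, t4, ?_, ?_, ?_⟩
    · simp only [List.length_cons, slpCost]; omega
    · exact (i1.trans i2).trans ((Set.subset_insert _ _).trans ((Set.subset_insert _ _).trans
        ((Set.subset_insert _ _).trans (Set.subset_insert _ _))))
    · convert Set.mem_insert _ _ using 1
      funext x
      rw [← hr x]
      cases w x <;> simp

/-- Finitely many functions, each determined by few functions that are already computed. -/
lemma Slp.layer {τ : Type} (T : Finset τ) (h : τ → (Fin n → Bool) → Bool) (c : ℕ) {K : ℕ}
    {W : Set ((Fin n → Bool) → Bool)} (hW : Slp K W)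
    (hT : ∀ t ∈ T, ∃ ws : List ((Fin n → Bool) → Bool), ws.length ≤ c ∧ (∀ w ∈ ws, w ∈ W) ∧
      ∀ x x', (∀ w ∈ ws, w x = w x') → h t x = h t x') :
    ∃ K' W', Slp K' W' ∧ K' ≤ K + T.card * slpCost c ∧ W ⊆ W' ∧ ∀ t ∈ T, h t ∈ W' := by
  classical
  induction T using Finset.induction_on with
  | empty => exact ⟨K, W, hW, by simp, subset_rfl, by simp⟩
  | insert a T ha ih =>
    obtain ⟨K1, W1, s1, k1, i1, m1⟩ := ih fun t ht => hT t (Finset.mem_insert_of_mem ht)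
    obtain ⟨ws, j1, j2, j3⟩ := hT a (Finset.mem_insert_self _ _)
    obtain ⟨K2, W2, s2, k2, i2, m2⟩ := s1.extend ws (fun w hw => i1 (j2 w hw)) (h a) j3
    refine ⟨K2, W2, s2, ?_, i1.trans i2, fun t ht => ?_⟩
    · rw [Finset.card_insert_of_notMem ha, Nat.succ_mul]
      have := slpCost_mono j1
      omega
    · obtain rfl | ht := Finset.mem_insert.1 ht
      · exact m2
      · exact i2 (m1 t ht)

/-- The qubits of a straight-line program: inputs and one work qubit for each step. -/
def stepValue {K : ℕ} (A : Fin K → (Fin n → Bool) → Bool) (x : Fin n → Bool) : Fin n ⊕ Fin K → Bool :=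
  Sum.elim x fun k => A k x

/-- Reversible computation of a straight-line program. -/
lemma Slp.exists_run {K : ℕ} {W : Set ((Fin n → Bool) → Bool)} (hW : Slp K W) {Q : Type}
    [DecidableEq Q] (inp : Fin n → Q) (anc : Fin K → Q) (hinj : Injective (Sum.elim inp anc)) :
    ∃ (G : List (CGate Q)) (A : Fin K → (Fin n → Bool) → Bool), G.length ≤ 2 * K ∧
      (∀ y : Q → Bool, (∀ k, y (anc k) = false) → (∀ k, run G y (anc k) = A k (y ∘ inp)) ∧
        ∀ q, (∀ k, q ≠ anc k) → run G y q = y q) ∧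
      ∀ w ∈ W, ∃ s, ∀ x, w x = stepValue A x s := by
  -- Common to both kinds of program step: at most two gates write the new value into a fresh work
  -- qubit, the only one they change.
  have step : ∀ {K : ℕ} (anc : Fin (K + 1) → Q) (hinj : Injective (Sum.elim inp anc))
      (G : List (CGate Q)) (A : Fin K → (Fin n → Bool) → Bool) (_ : G.length ≤ 2 * K)
      (_ : ∀ y : Q → Bool, (∀ k : Fin K, y (anc k.castSucc) = false) →
        (∀ k : Fin K, run G y (anc k.castSucc) = A k (y ∘ inp)) ∧
        ∀ q, (∀ k : Fin K, q ≠ anc k.castSucc) → run G y q = y q)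
      {W : Set ((Fin n → Bool) → Bool)} (_ : ∀ w ∈ W, ∃ s, ∀ x, w x = stepValue A x s)
      (H : List (CGate Q)) (h : (Fin n → Bool) → Bool) (_ : H.length ≤ 2)
      (_ : ∀ (y : Q → Bool) (x : Fin n → Bool), y (anc (Fin.last K)) = false → y ∘ inp = x →
        (∀ k : Fin K, y (anc k.castSucc) = A k x) → run H y = update y (anc (Fin.last K)) (h x)),
      ∃ (G : List (CGate Q)) (A : Fin (K + 1) → (Fin n → Bool) → Bool), G.length ≤ 2 * (K + 1) ∧
      (∀ y : Q → Bool, (∀ k, y (anc k) = false) → (∀ k, run G y (anc k) = A k (y ∘ inp)) ∧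
        ∀ q, (∀ k, q ≠ anc k) → run G y q = y q) ∧
      ∀ w ∈ insert h W, ∃ s, ∀ x, w x = stepValue A x s := by
    intro K anc hinj G A hG hrun W hW H h hH hrunH
    have hanc : Injective anc := fun a b hab => Sum.inr_injective (hinj hab)
    have hne : ∀ i k, inp i ≠ anc k := fun i k hik => Sum.inl_ne_inr (hinj hik)
    refine ⟨G ++ H, Fin.snoc A h, by rw [List.length_append]; omega, fun y hy => ?_, ?_⟩
    · obtain ⟨h1, h2⟩ := hrun y fun k => hy _
      have h3 := hrunH (run G y) (y ∘ inp)
        ((h2 _ fun k hk => Fin.castSucc_ne_last k (hanc hk).symm).trans (hy _))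
        (funext fun i => h2 _ fun k => hne i _) h1
      rw [run_append, h3]
      refine ⟨fun k => ?_, fun q hq => ?_⟩
      · induction k using Fin.lastCases with
        | last => simp
        | cast k =>
          rw [update_of_ne (hanc.ne (Fin.castSucc_ne_last k)), h1, Fin.snoc_castSucc]
      · rw [update_of_ne (hq _), h2 _ fun k => hq _]
    · intro w hw
      obtain rfl | hw := Set.mem_insert_iff.1 hw
      · exact ⟨Sum.inr (Fin.last K), fun x => by simp [stepValue]⟩
      · obtain ⟨s, hs⟩ := hW w hw
        obtain i | k := s
        · exact ⟨Sum.inl i, hs⟩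
        · exact ⟨Sum.inr k.castSucc, fun x => by rw [hs]; simp [stepValue]⟩
  induction hW with
  | inputs =>
    refine ⟨[], fun k => k.elim0, by simp, fun y _ => ⟨fun k => k.elim0, fun q _ => rfl⟩, ?_⟩
    rintro _ ⟨i, rfl⟩
    exact ⟨Sum.inl i, fun x => rfl⟩
  | @one K W hW ih =>
    obtain ⟨G, A, h1, h2, h3⟩ := ih (fun k => anc k.castSucc) (by
      have := hinj.comp (Sum.map_injective.2 ⟨injective_id, Fin.castSucc_injective K⟩)
      convert this using 1
      ext s; cases s <;> rfl)
    refine step anc hinj G A h1 h2 h3 [CGate.not (anc (Fin.last K))] _ (by simp) ?_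
    intro y x hy _ _
    simp [CGate.act, notAct, hy]
  | @nand K W hW f g hf hg ih =>
    obtain ⟨G, A, h1, h2, h3⟩ := ih (fun k => anc k.castSucc) (by
      have := hinj.comp (Sum.map_injective.2 ⟨injective_id, Fin.castSucc_injective K⟩)
      convert this using 1
      ext s; cases s <;> rfl)
    obtain ⟨s, hs⟩ := h3 f hf
    obtain ⟨t, ht⟩ := h3 g hg
    let pos : Fin n ⊕ Fin K → Q := fun s => Sum.elim inp anc (Sum.map id Fin.castSucc s)
    have hpos : Injective pos :=
      hinj.comp (Sum.map_injective.2 ⟨injective_id, Fin.castSucc_injective K⟩)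
    have hl : ∀ s, pos s ≠ anc (Fin.last K) := by
      intro s hs
      have := @hinj _ (Sum.inr (Fin.last K)) hs
      obtain i | k := s
      · exact Sum.inl_ne_inr this
      · exact Fin.castSucc_ne_last k (Sum.inr_injective this)
    have hval : ∀ (y : Q → Bool) (x : Fin n → Bool), y ∘ inp = x →
        (∀ k : Fin K, y (anc k.castSucc) = A k x) → ∀ s, y (pos s) = stepValue A x s := by
      rintro y x hx hA (i | k)
      · exact congrFun hx i
      · exact hA k
    -- If both arguments sit in the same qubit, the Toffoli gate is not available, and a controlled
    -- NOT replaces it.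
    by_cases hst : s = t
    · refine step anc hinj G A h1 h2 h3
        [CGate.not (anc (Fin.last K)), CGate.cnot (pos s) (anc (Fin.last K)) (hl s)] _ (by simp) ?_
      intro y x hy hx hA
      simp [CGate.act, notAct, cnotAct, hy, hl, hs, ht, ← hst, hval y x hx hA]
    · refine step anc hinj G A h1 h2 h3
        [CGate.not (anc (Fin.last K)),
          CGate.tof (pos s) (pos t) (anc (Fin.last K)) (hpos.ne hst) (hl s) (hl t)] _ (by simp) ?_
      intro y x hy hx hA
      simp [CGate.act, notAct, tofAct, hy, hl, hs, ht, hval y x hx hA]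

end


/-! ### Preparing the state of a function computed by a straight-line program -/

section
variable {Q : Type} [DecidableEq Q] [Fintype Q]

/-- The amplitude of a label moves along `run L`; its new value at `y` is therefore read at the
preimage, given by the reversed list. -/
lemma circOp_flatMap_circuit (L : List (CGate Q)) (X : (Q → Bool) → ℂ) (y : Q → Bool) :
    circOp (L.flatMap CGate.circuit) X y = X (run L.reverse y) := by
  induction L generalizing X with
  | nil => simp
  | cons g L ih =>
    rw [List.flatMap_cons, circOp_append, Module.End.mul_apply, ih, g.circOp_circuit,
      List.reverse_cons, run_append]
    rfl

lemma circOp_hadamards (l : List Q) (hl : l.Nodup) (y : Q → Bool) [Decidable (∀ q ∉ l, y q = false)] :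
    circOp (l.map QGate.hadamard) (zeroState Q) y =
      if ∀ q ∉ l, y q = false then ((1 / √2 : ℝ) : ℂ) ^ l.length else 0 := by
  classical
  induction l using List.reverseRecOn generalizing y with
  | nil => simp [zeroState, funext_iff]
  | append_singleton l i ih =>
    rw [List.nodup_append] at hl
    obtain ⟨h1, -, h2⟩ := hl
    have hi : i ∉ l := fun hi => h2 i hi i (by simp) rfl
    rw [List.map_append, circOp_append, Module.End.mul_apply, List.map_singleton, circOp_singleton,
      gateOp_hadamard, oneOp_apply, Fintype.sum_bool, ih h1, ih h1, if_neg fun h => by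
        have := h i hi
        simp at this]
    have : (∀ q ∉ l, update y i false q = false) ↔ ∀ q ∉ l ++ [i], y q = false := by
      refine forall_congr' fun q => ?_
      by_cases hq : q = i
      · subst hq; simp
      · simp [hq]
    simp only [this, hadamardMatrix, Bool.and_false, mul_zero, zero_add, Bool.false_eq_true, if_false,
      mul_ite, List.length_append, List.length_singleton]
    split_ifs <;> simp [pow_succ']

end

section
variable {n m K : ℕ}

/-- The label of a basis state with all work qubits in the state `0`. -/
def cleanLabel (K : ℕ) (x : Fin n → Bool) (v : Fin m → Bool) : Fin n ⊕ (Fin m ⊕ Fin K) → Bool :=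
  Sum.elim x (Sum.elim v fun _ => false)

lemma run_copies {Q : Type} [DecidableEq Q] (src dst : Fin m → Q) (hdst : Injective dst)
    (hsd : ∀ i j, src i ≠ dst j) (l : List (Fin m)) (hl : l.Nodup) (y : Q → Bool) :
    (∀ i, run (l.map fun i => CGate.cnot (src i) (dst i) (hsd i i)) y (dst i) =
      if i ∈ l then xor (y (dst i)) (y (src i)) else y (dst i)) ∧
    ∀ q, (∀ i, q ≠ dst i) →
      run (l.map fun i => CGate.cnot (src i) (dst i) (hsd i i)) y q = y q := by
  induction l generalizing y with
  | nil => simp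
  | cons a l ih =>
    obtain ⟨ha, hl⟩ := List.nodup_cons.1 hl
    obtain ⟨h1, h2⟩ := ih hl ((CGate.cnot (src a) (dst a) (hsd a a)).act y)
    constructor
    · intro i
      rw [List.map_cons, run_cons, h1]
      by_cases hia : i = a
      · subst hia
        simp [ha, CGate.act, cnotAct]
      · simp [hia, CGate.act, cnotAct, hdst.ne hia, hsd]
    · intro q hq
      rw [List.map_cons, run_cons, h2 q hq]
      simp [CGate.act, cnotAct, hq a]

/-- Reversible computation of a function without garbage. -/
lemma Slp.exists_clean_run {W : Set ((Fin n → Bool) → Bool)} (hW : Slp K W)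
    (f : (Fin n → Bool) → Fin m → Bool) (hf : ∀ i, (fun x => f x i) ∈ W) :
    ∃ L : List (CGate (Fin n ⊕ (Fin m ⊕ Fin K))), L.length ≤ 4 * K + m ∧
      ∀ x, run L (cleanLabel K x fun _ => false) = cleanLabel K x (f x) := by
  let anc : Fin K → Fin n ⊕ (Fin m ⊕ Fin K) := fun k => Sum.inr (Sum.inr k)
  let dst : Fin m → Fin n ⊕ (Fin m ⊕ Fin K) := fun i => Sum.inr (Sum.inl i)
  have hinj : Injective (Sum.elim (Sum.inl : Fin n → Fin n ⊕ (Fin m ⊕ Fin K)) anc) := by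
    rintro (i | k) (j | l) h <;> simp_all [anc]
  obtain ⟨G, A, h1, h2, h3⟩ := hW.exists_run Sum.inl anc hinj
  choose s hs using fun i => h3 _ (hf i)
  let src : Fin m → Fin n ⊕ (Fin m ⊕ Fin K) := fun i => Sum.elim Sum.inl anc (s i)
  have hsd : ∀ i j, src i ≠ dst j := by
    intro i j
    simp only [src, dst]
    cases s i <;> simp [anc]
  let D := (List.finRange m).map fun i => CGate.cnot (src i) (dst i) (hsd i i)
  -- Compute, copy, uncompute. The copies lie in qubits which `G` leaves alone, so copying after `G`
  -- has the same effect as running `G` with the values already present.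
  refine ⟨G ++ (D ++ G.reverse), ?_, fun x => ?_⟩
  · simp only [List.length_append, List.length_reverse, D, List.length_map, List.length_finRange]
    omega
  have hG : ∀ v : Fin m → Bool, (∀ k, run G (cleanLabel K x v) (anc k) = A k x) ∧
      ∀ q, (∀ k, q ≠ anc k) → run G (cleanLabel K x v) q = cleanLabel K x v q :=
    fun v => h2 (cleanLabel K x v) fun k => rfl
  rw [run_append, run_append]
  suffices run D (run G (cleanLabel K x fun _ => false)) = run G (cleanLabel K x (f x)) by
    rw [this, run_reverse_run]
  obtain ⟨c1, c2⟩ := run_copies src dst (fun i j h => Sum.inl_injective (Sum.inr_injective h)) hsd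
    (List.finRange m) (List.nodup_finRange m) (run G (cleanLabel K x fun _ => false))
  have hsrc : ∀ i, run G (cleanLabel K x fun _ => false) (src i) = f x i := by
    intro i
    rw [hs i x]
    simp only [src]
    obtain j | k := s i
    · exact (hG _).2 _ fun k => Sum.inl_ne_inr
    · exact (hG _).1 k
  funext q
  obtain i | i | k := q
  · rw [c2 _ (fun j => Sum.inl_ne_inr), (hG _).2 _ (fun k => Sum.inl_ne_inr),
      (hG _).2 _ (fun k => Sum.inl_ne_inr)]
    rfl
  · have hne : ∀ k, (Sum.inr (Sum.inl i) : Fin n ⊕ (Fin m ⊕ Fin K)) ≠ anc k :=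
      fun k h => Sum.inl_ne_inr (Sum.inr_injective h)
    refine (c1 i).trans ?_
    rw [if_pos (List.mem_finRange i), hsrc, (hG _).2 _ hne, (hG _).2 _ hne]
    exact Bool.false_xor _
  · rw [c2 _ (fun j h => Sum.inr_ne_inl (Sum.inr_injective h))]
    exact ((hG _).1 k).trans ((hG _).1 k).symm

lemma sqrt_two_pow (n : ℕ) : √((2 : ℝ) ^ n) = √2 ^ n := by
  rw [← Real.sqrt_sq (pow_nonneg (Real.sqrt_nonneg 2) n), ← pow_mul, mul_comm, pow_mul,
    Real.sq_sqrt (by norm_num)]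

/-- The state recording a function is prepared by a circuit whose length is proportional to that of
a straight-line program. -/
lemma Slp.exists_preparation {W : Set ((Fin n → Bool) → Bool)} (hW : Slp K W)
    (f : Fin (2 ^ n) → Fin m → Bool) (hf : ∀ i, (fun x => f ((bitsEquiv n).symm x) i) ∈ W) :
    ∃ P : QCircuit (Fin n ⊕ (Fin m ⊕ Fin K)), P.length ≤ n + 37 * (4 * K + m) ∧
      circuitOutput P = withCleanWork K (functionState n f) := by
  classical
  obtain ⟨L, h1, h2⟩ := hW.exists_clean_run (fun x => f ((bitsEquiv n).symm x)) hf
  let l : List (Fin n ⊕ (Fin m ⊕ Fin K)) := (List.finRange n).map Sum.inl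
  have hl : l.Nodup := (List.nodup_finRange n).map Sum.inl_injective
  refine ⟨l.map QGate.hadamard ++ L.flatMap CGate.circuit, ?_, ?_⟩
  · have h3 : (L.flatMap CGate.circuit).length ≤ 37 * L.length := by
      clear h1 h2
      induction L with
      | nil => simp
      | cons g L ih =>
        rw [List.flatMap_cons, List.length_append, List.length_cons]
        have := g.length_circuit
        omega
    simp only [List.length_append, l, List.length_map, List.length_finRange]
    omega
  · have h : circuitOutput (l.map QGate.hadamard ++ L.flatMap CGate.circuit) =
      WithLp.toLp 2 (circOp (l.map QGate.hadamard ++ L.flatMap CGate.circuit) (zeroState _)) := rfl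
    rw [h, circOp_append, Module.End.mul_apply]
    ext y
    change circOp (L.flatMap CGate.circuit) _ y = _
    rw [circOp_flatMap_circuit, circOp_hadamards l hl]
    have hmem : (∀ q ∉ l, run L.reverse y q = false) ↔
        ∃ x, run L.reverse y = cleanLabel K x fun _ => false := by
      constructor
      · intro h
        refine ⟨fun i => run L.reverse y (Sum.inl i), funext fun q => ?_⟩
        obtain i | i | k := q
        · rfl
        · exact h _ (by simp [l])
        · exact h _ (by simp [l])
      · rintro ⟨x, hx⟩ q hq
        rw [hx]
        obtain i | i | k := q
        · exact absurd (by simp [l]) hq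
        · rfl
        · rfl
    -- The Hadamard gates produce equal amplitudes at the labels `(x, 0, 0)`, and these are carried
    -- to `(x, f x, 0)`.
    have hiff : (∀ q ∉ l, run L.reverse y q = false) ↔
        (∀ i, y (Sum.inr (Sum.inr i)) = false) ∧
          f ((bitsEquiv n).symm (dataOf y).1) = (dataOf y).2 := by
      rw [hmem]
      constructor
      · rintro ⟨x, hx⟩
        have : y = cleanLabel K x (f ((bitsEquiv n).symm x)) := by
          rw [← h2, ← hx]
          conv_lhs => rw [← run_reverse_run L.reverse y, List.reverse_reverse]
        subst this
        exact ⟨fun _ => rfl, rfl⟩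
      · rintro ⟨hw, hv⟩
        refine ⟨(dataOf y).1, ?_⟩
        rw [← run_reverse_run L (cleanLabel K (dataOf y).1 fun _ => false), h2, hv]
        congr 1
        funext q
        obtain i | i | k := q
        · rfl
        · rfl
        · exact hw k
    have hlen : ((1 / √2 : ℝ) : ℂ) ^ l.length = ((1 / √(2 ^ n) : ℝ) : ℂ) := by
      rw [sqrt_two_pow, ← one_div_pow]
      simp [l]
    rw [hlen, if_congr hiff rfl rfl, ite_and]
    rfl

end


/-! ### Locality of stack machines -/

section
open Turing Turing.TM2
variable {K Λ σ : Type} {Γ : K → Type}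

/-- A bound for the number of stack operations in a statement. -/
def stmtDepth : Stmt Γ Λ σ → ℕ
  | .push _ _ q => stmtDepth q + 1
  | .peek _ _ q => stmtDepth q + 1
  | .pop _ _ q => stmtDepth q + 1
  | .load _ q => stmtDepth q
  | .branch _ q₁ q₂ => max (stmtDepth q₁) (stmtDepth q₂)
  | .goto _ => 0
  | .halt => 0

/-- The stack symbols that a statement can push. -/
def pushed : Stmt Γ Λ σ → Set (Σ k, Γ k)
  | .push k f q => Set.range (fun v => ⟨k, f v⟩) ∪ pushed q
  | .peek _ _ q => pushed q
  | .pop _ _ q => pushed q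
  | .load _ q => pushed q
  | .branch _ q₁ q₂ => pushed q₁ ∪ pushed q₂
  | .goto _ => ∅
  | .halt => ∅

lemma finite_pushed [Finite σ] (q : Stmt Γ Λ σ) : (pushed q).Finite := by
  induction q with
  | push k f q ih => exact (Set.finite_range _).union ih
  | peek k f q ih => exact ih
  | pop k f q ih => exact ih
  | load f q ih => exact ih
  | branch f q₁ q₂ ih₁ ih₂ => exact ih₁.union ih₂
  | goto f => exact Set.finite_empty
  | halt => exact Set.finite_empty

/-- The stacks agree near the top and near the position `i`. -/
def Agree (d i : ℕ) (S S' : ∀ k, List (Γ k)) : Prop :=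
  ∀ k j, (j < d ∨ (i ≤ j + d ∧ j ≤ i + d)) → (S k)[j]? = (S' k)[j]?

lemma Agree.mono {d e i : ℕ} {S S' : ∀ k, List (Γ k)} (h : Agree d i S S') (hde : e ≤ d) :
    Agree e i S S' := fun k j hj => h k j (by omega)

lemma Agree.head {d i : ℕ} {S S' : ∀ k, List (Γ k)} (h : Agree (d + 1) i S S') (k : K) :
    (S k).head? = (S' k).head? := by
  rw [List.head?_eq_getElem?, List.head?_eq_getElem?]
  exact h k 0 (by omega)

variable [DecidableEq K]

lemma Agree.push {d i : ℕ} {S S' : ∀ k, List (Γ k)} (h : Agree (d + 1) i S S') (k : K) (a : Γ k) :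
    Agree d i (update S k (a :: S k)) (update S' k (a :: S' k)) := by
  intro k' j hj
  by_cases hk : k' = k
  · subst hk
    rw [update_self, update_self]
    cases j with
    | zero => rfl
    | succ j =>
      rw [List.getElem?_cons_succ, List.getElem?_cons_succ]
      exact h k' j (by omega)
  · rw [update_of_ne hk, update_of_ne hk]
    exact h k' j (by omega)

lemma Agree.pop {d i : ℕ} {S S' : ∀ k, List (Γ k)} (h : Agree (d + 1) i S S') (k : K) :
    Agree d i (update S k (S k).tail) (update S' k (S' k).tail) := by
  intro k' j hj
  by_cases hk : k' = k
  · subst hk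
    rw [update_self, update_self, List.getElem?_tail, List.getElem?_tail]
    exact h k' (j + 1) (by omega)
  · rw [update_of_ne hk, update_of_ne hk]
    exact h k' j (by omega)

/-- Positions are counted from the top. Each stack operation moves contents by at most one place and
inspects only the top, so agreement shrinks by one layer per operation. -/
lemma stepAux_agree (q : Stmt Γ Λ σ) {i : ℕ} (v : σ) {S S' : ∀ k, List (Γ k)}
    (h : Agree (stmtDepth q) i S S') : (stepAux q v S).l = (stepAux q v S').l ∧
      (stepAux q v S).var = (stepAux q v S').var ∧
      ∀ k, ((stepAux q v S).stk k)[i]? = ((stepAux q v S').stk k)[i]? := by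
  induction q generalizing v S S' with
  | push k f q ih => exact ih v (h.push k (f v))
  | peek k f q ih =>
    simp only [stepAux, h.head k]
    exact ih _ (h.mono (Nat.le_succ _))
  | pop k f q ih =>
    simp only [stepAux, h.head k]
    exact ih _ (h.pop k)
  | load f q ih => exact ih _ h
  | branch f q₁ q₂ ih₁ ih₂ =>
    simp only [stepAux]
    cases f v
    · exact ih₂ v (h.mono (le_max_right _ _))
    · exact ih₁ v (h.mono (le_max_left _ _))
  | goto f => exact ⟨rfl, rfl, fun k => h k i (by omega)⟩
  | halt => exact ⟨rfl, rfl, fun k => h k i (by omega)⟩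

lemma length_stepAux_le (q : Stmt Γ Λ σ) (v : σ) (S : ∀ k, List (Γ k)) (k : K) :
    ((stepAux q v S).stk k).length ≤ (S k).length + stmtDepth q := by
  induction q generalizing v S with
  | push k' f q ih =>
    refine (ih v _).trans ?_
    rw [stmtDepth]
    by_cases hk : k = k'
    · subst hk; rw [update_self, List.length_cons]; omega
    · rw [update_of_ne hk]; omega
  | peek k' f q ih => exact (ih _ _).trans (by rw [stmtDepth]; omega)
  | pop k' f q ih =>
    refine (ih _ _).trans ?_
    rw [stmtDepth]
    by_cases hk : k = k'
    · subst hk; rw [update_self, List.length_tail]; omega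
    · rw [update_of_ne hk]; omega
  | load f q ih => exact ih _ _
  | branch f q₁ q₂ ih₁ ih₂ =>
    have h1 := ih₁ v S
    have h2 := ih₂ v S
    rw [stmtDepth]
    simp only [stepAux]
    cases f v
    · exact h2.trans (by gcongr; exact le_max_right _ _)
    · exact h1.trans (by gcongr; exact le_max_left _ _)
  | goto f => exact le_rfl
  | halt => exact le_rfl

/-- All stack symbols belong to `A`. -/
def StackIn (A : Set (Σ k, Γ k)) (S : ∀ k, List (Γ k)) : Prop :=
  ∀ k, ∀ a ∈ S k, (⟨k, a⟩ : Σ k, Γ k) ∈ A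

lemma stackIn_stepAux {A : Set (Σ k, Γ k)} (q : Stmt Γ Λ σ) (hq : pushed q ⊆ A) (v : σ)
    {S : ∀ k, List (Γ k)} (h : StackIn A S) : StackIn A (stepAux q v S).stk := by
  induction q generalizing v S with
  | push k f q ih =>
    refine ih (Set.subset_union_right.trans hq) v fun k' a ha => ?_
    by_cases hk : k' = k
    · subst hk
      rw [update_self] at ha
      obtain rfl | ha := List.mem_cons.1 ha
      · exact hq (Or.inl ⟨v, rfl⟩)
      · exact h _ _ ha
    · rw [update_of_ne hk] at ha
      exact h _ _ ha
  | peek k f q ih => exact ih hq _ h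
  | pop k f q ih =>
    refine ih hq _ fun k' a ha => ?_
    by_cases hk : k' = k
    · subst hk
      rw [update_self] at ha
      exact h _ _ (List.mem_of_mem_tail ha)
    · rw [update_of_ne hk] at ha
      exact h _ _ ha
  | load f q ih => exact ih hq _ h
  | branch f q₁ q₂ ih₁ ih₂ =>
    simp only [stepAux]
    cases f v
    · exact ih₂ (Set.subset_union_right.trans hq) v h
    · exact ih₁ (Set.subset_union_left.trans hq) v h
  | goto f => exact h
  | halt => exact h

/-- One step of the machine, which does nothing after halting. -/
def idle (M : Λ → Stmt Γ Λ σ) (c : Cfg Γ Λ σ) : Cfg Γ Λ σ := (step M c).getD c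

lemma idle_none (M : Λ → Stmt Γ Λ σ) {c : Cfg Γ Λ σ} (h : c.l = none) : idle M c = c := by
  obtain ⟨l, v, S⟩ := c
  subst h
  rfl

lemma idle_some (M : Λ → Stmt Γ Λ σ) {c : Cfg Γ Λ σ} {l : Λ} (h : c.l = some l) :
    idle M c = stepAux (M l) c.var c.stk := by
  obtain ⟨l, v, S⟩ := c
  subst h
  rfl

lemma idle_iterate_eq (M : Λ → Stmt Γ Λ σ) (s : ℕ) (c c' : Cfg Γ Λ σ)
    (h : (flip bind (step M))^[s] (some c) = some c') : (idle M)^[s] c = c' := by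
  induction s generalizing c with
  | zero => exact Option.some_injective _ h
  | succ s ih =>
    rw [iterate_succ_apply] at h ⊢
    have e : flip bind (step M) (some c) = step M c := rfl
    rw [e] at h
    cases hc : step M c with
    | none =>
      rw [hc, iterate_fixed (rfl : flip bind (step M) none = none)] at h
      exact absurd h (by simp)
    | some d =>
      rw [hc] at h
      rw [idle, hc]
      exact ih d h

lemma idle_iterate_eq_of_le (M : Λ → Stmt Γ Λ σ) {s T : ℕ} {c c' : Cfg Γ Λ σ} (hc' : c'.l = none)
    (h : (flip bind (step M))^[s] (some c) = some c') (hs : s ≤ T) : (idle M)^[T] c = c' := by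
  obtain ⟨t, rfl⟩ := Nat.exists_eq_add_of_le' hs
  rw [iterate_add_apply, idle_iterate_eq M s c c' h, iterate_fixed (idle_none M hc')]

lemma length_idle_iterate_le (M : Λ → Stmt Γ Λ σ) {d : ℕ} (hd : ∀ l, stmtDepth (M l) ≤ d)
    (c : Cfg Γ Λ σ) (k : K) (T : ℕ) :
    (((idle M)^[T] c).stk k).length ≤ (c.stk k).length + T * d := by
  induction T with
  | zero => simp
  | succ T ih =>
    rw [iterate_succ_apply']
    refine le_trans ?_ ((Nat.add_le_add_right ih d).trans (by rw [Nat.succ_mul]; omega))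
    cases hl : ((idle M)^[T] c).l with
    | none => rw [idle_none M hl]; omega
    | some l =>
      rw [idle_some M hl]
      exact (length_stepAux_le _ _ _ _).trans (Nat.add_le_add_left (hd l) _)

lemma stackIn_idle_iterate {A : Set (Σ k, Γ k)} (M : Λ → Stmt Γ Λ σ) (hA : ∀ l, pushed (M l) ⊆ A)
    {c : Cfg Γ Λ σ} (hc : StackIn A c.stk) (T : ℕ) : StackIn A ((idle M)^[T] c).stk := by
  induction T with
  | zero => exact hc
  | succ T ih =>
    rw [iterate_succ_apply']
    cases hl : ((idle M)^[T] c).l with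
    | none => rwa [idle_none M hl]
    | some l => rw [idle_some M hl]; exact stackIn_stepAux _ (hA l) _ ih

end

/-! ### Machine configurations as bits -/

section
open Turing Turing.TM2
variable {K Λ σ : Type} {Γ : K → Type} {A : Set (Σ k, Γ k)}

/-- The bits describing a configuration: its label, its internal state, and the symbol at each
position of each stack. -/
abbrev CfgAtom (Λ σ : Type) {K : Type} {Γ : K → Type} (A : Set (Σ k, Γ k)) : Type :=
  Option Λ ⊕ (σ ⊕ (A × ℕ))

open Classical in
/-- The value of one of the bits describing a configuration. -/
def cfgBit (c : Cfg Γ Λ σ) : CfgAtom Λ σ A → Bool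
  | Sum.inl l => decide (c.l = l)
  | Sum.inr (Sum.inl v) => decide (c.var = v)
  | Sum.inr (Sum.inr (p, j)) => decide ((c.stk p.1.1)[j]? = some p.1.2)

/-- The stack position to which a bit belongs. -/
def atomPos : CfgAtom Λ σ A → ℕ
  | Sum.inl _ => 0
  | Sum.inr (Sum.inl _) => 0
  | Sum.inr (Sum.inr (_, j)) => j

variable [Fintype Λ] [Fintype σ] [Fintype A]

/-- The bits belonging to the given stack positions. -/
def cfgAtoms (Λ σ : Type) [Fintype Λ] [Fintype σ] {K : Type} {Γ : K → Type} (A : Set (Σ k, Γ k))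
    [Fintype A] (J : Finset ℕ) : Finset (CfgAtom Λ σ A) :=
  Finset.univ.disjSum (Finset.univ.disjSum (Finset.univ ×ˢ J))

lemma card_cfgAtoms (J : Finset ℕ) : (cfgAtoms Λ σ A J).card =
    Fintype.card Λ + 1 + Fintype.card σ + Fintype.card A * J.card := by
  simp [cfgAtoms, Finset.card_disjSum, Finset.card_product, add_assoc]

lemma cfgAtoms_mono {J J' : Finset ℕ} (h : J ⊆ J') : cfgAtoms Λ σ A J ⊆ cfgAtoms Λ σ A J' :=
  Finset.disjSum_mono le_rfl (Finset.disjSum_mono le_rfl (Finset.product_subset_product_right h))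

/-- The bits record only symbols of the finite set `A`; `StackIn` ensures that nothing else occurs,
so the bits determine the symbols, and an empty position is one where all bits are `0`. -/
lemma agree_of_cfgBit {J : Finset ℕ} {c c' : Cfg Γ Λ σ} (hc : StackIn A c.stk)
    (hc' : StackIn A c'.stk) (h : ∀ t ∈ cfgAtoms Λ σ A J, cfgBit c t = cfgBit c' t) :
    c.l = c'.l ∧ c.var = c'.var ∧ ∀ k, ∀ j ∈ J, (c.stk k)[j]? = (c'.stk k)[j]? := by
  classical
  refine ⟨?_, ?_, fun k j hj => ?_⟩
  · have := h (Sum.inl c'.l) (by simp [cfgAtoms])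
    simpa [cfgBit] using this
  · have := h (Sum.inr (Sum.inl c'.var)) (by simp [cfgAtoms])
    simpa [cfgBit] using this
  · have key : ∀ (a : Γ k) (ha : (⟨k, a⟩ : Σ k, Γ k) ∈ A),
        (c.stk k)[j]? = some a ↔ (c'.stk k)[j]? = some a := by
      intro a ha
      have := h (Sum.inr (Sum.inr (⟨⟨k, a⟩, ha⟩, j))) (by simp [cfgAtoms, hj])
      simpa [cfgBit] using this
    ext a
    constructor
    · exact fun h1 => (key a (hc k a (List.mem_of_getElem? h1))).1 h1
    · exact fun h1 => (key a (hc' k a (List.mem_of_getElem? h1))).2 h1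

variable [DecidableEq K]

/-- The stack positions on which the next value of the bits of position `i` depends. -/
def window (d i : ℕ) : Finset ℕ := Finset.range d ∪ Finset.Icc (i - d) (i + d)

lemma card_window_le (d i : ℕ) : (window d i).card ≤ 3 * d + 1 := by
  refine (Finset.card_union_le _ _).trans ?_
  rw [Finset.card_range, Nat.card_Icc]
  omega

lemma cfgBit_idle_eq (M : Λ → Stmt Γ Λ σ) {d : ℕ} (hd : ∀ l, stmtDepth (M l) ≤ d)
    {c c' : Cfg Γ Λ σ} (hc : StackIn A c.stk) (hc' : StackIn A c'.stk) (t : CfgAtom Λ σ A)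
    (h : ∀ u ∈ cfgAtoms Λ σ A (window d (atomPos t)), cfgBit c u = cfgBit c' u) :
    cfgBit (idle M c) t = cfgBit (idle M c') t := by
  classical
  obtain ⟨h1, h2, h3⟩ := agree_of_cfgBit hc hc' h
  have hag : Agree d (atomPos t) c.stk c'.stk := by
    intro k j hj
    refine h3 k j ?_
    simp only [window, Finset.mem_union, Finset.mem_range, Finset.mem_Icc]
    omega
  have key : (idle M c).l = (idle M c').l ∧ (idle M c).var = (idle M c').var ∧
      ∀ k, ((idle M c).stk k)[atomPos t]? = ((idle M c').stk k)[atomPos t]? := by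
    cases hl : c.l with
    | none =>
      rw [idle_none M hl, idle_none M (h1.symm.trans hl)]
      exact ⟨h1, h2, fun k => hag k _ (by omega)⟩
    | some l =>
      rw [idle_some M hl, idle_some M (h1.symm.trans hl), h2]
      exact stepAux_agree _ _ (hag.mono (hd l))
  obtain l | v | ⟨p, j⟩ := t
  · simp [cfgBit, key.1]
  · simp [cfgBit, key.2.1]
  · have := key.2.2 p.1.1
    simp only [atomPos] at this
    simp [cfgBit, this]

/-- The initial configuration with the given word on the stack `k₀`. -/
def initCfg (main : Λ) (v₀ : σ) (k₀ : K) (w : List (Γ k₀)) : Cfg Γ Λ σ :=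
  ⟨some main, v₀, update (fun _ => []) k₀ w⟩

lemma stackIn_initCfg {main : Λ} {v₀ : σ} {k₀ : K} {w : List (Γ k₀)}
    (hw : ∀ a ∈ w, (⟨k₀, a⟩ : Σ k, Γ k) ∈ A) : StackIn A (initCfg main v₀ k₀ w).stk := by
  intro k a ha
  by_cases hk : k = k₀
  · subst hk
    simp only [initCfg, update_self] at ha
    exact hw a ha
  · simp [initCfg, update_of_ne hk] at ha

/-- A stack machine is simulated by straight-line programs. -/
theorem exists_slp_of_machine (M : Λ → Stmt Γ Λ σ) {d : ℕ} (hd : ∀ l, stmtDepth (M l) ≤ d)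
    (hM : ∀ l, pushed (M l) ⊆ A) (main : Λ) (v₀ : σ) (k₀ : K) (sym : Bool → Γ k₀)
    (hsym : ∀ b, (⟨k₀, sym b⟩ : Σ k, Γ k) ∈ A) {N : ℕ → ℕ}
    (hN : ∀ B, N B = Fintype.card Λ + 1 + Fintype.card σ + Fintype.card A * B) (n T : ℕ) :
    ∀ B, ∃ (L : ℕ) (W : Set ((Fin n → Bool) → Bool)), Slp L W ∧
      L ≤ (T + 1) * (N (B + T * (d + 1)) * slpCost (N (3 * d + 1))) ∧
      ∀ t ∈ cfgAtoms Λ σ A (Finset.range B), (fun x : Fin n → Bool =>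
        cfgBit ((idle M)^[T] (initCfg main v₀ k₀ ((List.ofFn x).map sym))) t) ∈ W := by
  have hstack : ∀ (s : ℕ) (x : Fin n → Bool),
      StackIn A ((idle M)^[s] (initCfg main v₀ k₀ ((List.ofFn x).map sym))).stk := by
    intro s x
    refine stackIn_idle_iterate M hM (stackIn_initCfg fun a ha => ?_) s
    obtain ⟨b, -, rfl⟩ := List.mem_map.1 ha
    exact hsym b
  have hNmono : Monotone N := by
    intro B B' h
    rw [hN, hN]
    gcongr
  have hcard : ∀ B, (cfgAtoms Λ σ A (Finset.range B)).card = N B := fun B => by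
    rw [card_cfgAtoms, hN, Finset.card_range]
  induction T with
  | zero =>
    intro B
    have hdet : ∀ t ∈ cfgAtoms Λ σ A (Finset.range B), ∃ ws : List ((Fin n → Bool) → Bool),
        ws.length ≤ N (3 * d + 1) ∧ (∀ w ∈ ws, w ∈ Set.range fun (i : Fin n) (x : Fin n → Bool) => x i) ∧
        ∀ x x', (∀ w ∈ ws, w x = w x') →
          cfgBit (initCfg main v₀ k₀ ((List.ofFn x).map sym)) t =
            cfgBit (initCfg main v₀ k₀ ((List.ofFn x').map sym)) t := by
      intro t _
      have hpos : 1 ≤ N (3 * d + 1) := by rw [hN]; omega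
      obtain l | v | ⟨p, j⟩ := t
      · exact ⟨[], by simp, by simp, fun x x' _ => rfl⟩
      · exact ⟨[], by simp, by simp, fun x x' _ => rfl⟩
      · refine ⟨if h : j < n then [fun x => x ⟨j, h⟩] else [], ?_, ?_, ?_⟩
        · split_ifs <;> simp [hpos]
        · intro w hw
          split_ifs at hw with h
          · exact ⟨⟨j, h⟩, (List.mem_singleton.1 hw).symm⟩
          · simp at hw
        · intro x x' hx
          have : ((initCfg main v₀ k₀ ((List.ofFn x).map sym) : Cfg Γ Λ σ).stk p.1.1)[j]? =
              ((initCfg main v₀ k₀ ((List.ofFn x').map sym) : Cfg Γ Λ σ).stk p.1.1)[j]? := by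
            obtain ⟨⟨k, a⟩, hp⟩ := p
            simp only [initCfg]
            by_cases hk : k = k₀
            · subst hk
              rw [update_self, update_self, List.getElem?_map, List.getElem?_map,
                List.getElem?_ofFn, List.getElem?_ofFn]
              split_ifs with h
              · have := hx (fun x => x ⟨j, h⟩) (by simp [h])
                rw [this]
              · rfl
            · rw [update_of_ne hk, update_of_ne hk]
          simp only [cfgBit]
          exact decide_eq_decide.2 (by rw [this])
    obtain ⟨L, W, h1, h2, -, h3⟩ := Slp.inputs.layer (cfgAtoms Λ σ A (Finset.range B))
      (fun t (x : Fin n → Bool) => cfgBit (initCfg main v₀ k₀ ((List.ofFn x).map sym)) t)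
      (N (3 * d + 1)) hdet
    refine ⟨L, W, h1, ?_, h3⟩
    rw [hcard] at h2
    simpa using h2
  | succ T ih =>
    intro B
    -- The positions below `B` after a step depend on positions below `B + d + 1` before it. Going
    -- back in time the region grows linearly, which keeps the program polynomial, while the cost
    -- per bit stays constant.
    obtain ⟨L, W, h1, h2, h3⟩ := ih (B + (d + 1))
    have hdet : ∀ t ∈ cfgAtoms Λ σ A (Finset.range B), ∃ ws : List ((Fin n → Bool) → Bool),
        ws.length ≤ N (3 * d + 1) ∧ (∀ w ∈ ws, w ∈ W) ∧ ∀ x x', (∀ w ∈ ws, w x = w x') →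
          cfgBit ((idle M)^[T + 1] (initCfg main v₀ k₀ ((List.ofFn x).map sym))) t =
            cfgBit ((idle M)^[T + 1] (initCfg main v₀ k₀ ((List.ofFn x').map sym))) t := by
      intro t ht
      refine ⟨(cfgAtoms Λ σ A (window d (atomPos t))).toList.map fun u (x : Fin n → Bool) =>
        cfgBit ((idle M)^[T] (initCfg main v₀ k₀ ((List.ofFn x).map sym))) u, ?_, ?_, ?_⟩
      · rw [List.length_map, Finset.length_toList, card_cfgAtoms, hN]
        have := card_window_le d (atomPos t)
        gcongr
      · intro w hw
        obtain ⟨u, hu, rfl⟩ := List.mem_map.1 hw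
        refine h3 u (cfgAtoms_mono ?_ (Finset.mem_toList.1 hu))
        have hB : atomPos t < B + 1 := by
          obtain l | v | ⟨p, j⟩ := t
          · exact Nat.succ_pos _
          · exact Nat.succ_pos _
          · simp [cfgAtoms] at ht
            simp only [atomPos]
            omega
        intro j hj
        simp only [window, Finset.mem_union, Finset.mem_range, Finset.mem_Icc] at hj ⊢
        omega
      · intro x x' hx
        simp only [iterate_succ_apply']
        refine cfgBit_idle_eq M hd (hstack T x) (hstack T x') t fun u hu => ?_
        exact hx _ (List.mem_map.2 ⟨u, Finset.mem_toList.2 hu, rfl⟩)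
    obtain ⟨L', W', h1', h2', -, h3'⟩ := h1.layer (cfgAtoms Λ σ A (Finset.range B))
      (fun t (x : Fin n → Bool) =>
        cfgBit ((idle M)^[T + 1] (initCfg main v₀ k₀ ((List.ofFn x).map sym))) t)
      (N (3 * d + 1)) hdet
    refine ⟨L', W', h1', h2'.trans ?_, h3'⟩
    have e : B + (d + 1) + T * (d + 1) = B + (T + 1) * (d + 1) := by ring
    rw [e] at h2
    rw [hcard, Nat.succ_mul (T + 1)]
    exact Nat.add_le_add h2 (Nat.mul_le_mul_right _ (hNmono (Nat.le_add_right _ _)))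

end


/-! ### Functions computable in polynomial time -/

lemma initList_eq (tm : Turing.FinTM2) (w : List (tm.Γ tm.k₀)) :
    Turing.initList tm w = initCfg tm.main tm.initialState tm.k₀ w := by
  rw [Turing.initList, initCfg]
  congr 1
  funext k
  by_cases h : k = tm.k₀
  · subst h
    simp
  · simp [h]

lemma haltList_stk (tm : Turing.FinTM2) (w : List (tm.Γ tm.k₁)) :
    (Turing.haltList tm w).stk tm.k₁ = w := by
  simp [Turing.haltList]

/-- A circuit preparing the state that records a function computable in polynomial time. -/
theorem exists_preparation {m : ℕ → ℕ} {f : ∀ n, Fin (2 ^ n) → Fin (m n) → Bool}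
    (hf : PolyTimeComputable f) : ∃ q : Polynomial ℕ, ∀ n : ℕ,
      ∃ (a : ℕ) (P : QCircuit (Fin n ⊕ (Fin (m n) ⊕ Fin a))), a ≤ q.eval n ∧ P.length ≤ q.eval n ∧
        circuitOutput P = withCleanWork a (functionState n (f n)) := by
  classical
  obtain ⟨h⟩ := hf
  let tm := h.tm
  let := tm.kFin
  let := tm.ΛFin
  let := tm.σFin
  let M : tm.Λ → Turing.TM2.Stmt tm.Γ tm.Λ tm.σ := tm.m
  let sym : Bool → tm.Γ tm.k₀ := h.inputAlphabet.invFun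
  let out : Bool → tm.Γ tm.k₁ := h.outputAlphabet.invFun
  -- All symbols that can ever occur: those pushed by one of the finitely many statements, and the
  -- codes of input and output bits.
  let A : Set (Σ k, tm.Γ k) := (⋃ l, pushed (M l)) ∪
    (Set.range (fun b => ⟨tm.k₀, sym b⟩) ∪ Set.range fun b => ⟨tm.k₁, out b⟩)
  have hA : A.Finite := (Set.finite_iUnion fun l => finite_pushed _).union
    ((Set.finite_range _).union (Set.finite_range _))
  let : Fintype A := hA.fintype
  let d := Finset.univ.sup fun l => stmtDepth (M l)
  have hd : ∀ l, stmtDepth (M l) ≤ d := fun l =>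
    Finset.le_sup (f := fun l => stmtDepth (M l)) (Finset.mem_univ l)
  let c₁ := Fintype.card tm.Λ + 1 + Fintype.card tm.σ
  let c₂ := Fintype.card A
  let C := slpCost (c₁ + c₂ * (3 * d + 1))
  let mb : Polynomial ℕ := Polynomial.X + h.time * (d : Polynomial ℕ)
  let Kp : Polynomial ℕ := (h.time + 1) *
    (((c₁ : Polynomial ℕ) + c₂ * (mb + h.time * (d + 1 : Polynomial ℕ))) * C)
  refine ⟨Polynomial.X + 37 * (4 * Kp + mb) + Kp, fun n => ?_⟩
  have hfinal : ∀ t : Fin (2 ^ n), (idle M)^[h.time.eval n]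
      (initCfg tm.main tm.initialState tm.k₀ ((List.ofFn (bitsEquiv n t)).map sym)) =
        Turing.haltList tm ((List.ofFn (f n t)).map out) := by
    intro t
    have ho := h.outputsFun ⟨n, t⟩
    have h1 := ho.evals_in_steps
    have h2 : ho.steps ≤ h.time.eval n :=
      ho.steps_le_m.trans_eq (congrArg (fun k => h.time.eval k) List.length_ofFn)
    generalize ho.steps = s at h1 h2
    rw [initList_eq] at h1
    exact idle_iterate_eq_of_le M rfl h1 h2
  have hout : ∀ t : Fin (2 ^ n), ((idle M)^[h.time.eval n]
      (initCfg tm.main tm.initialState tm.k₀ ((List.ofFn (bitsEquiv n t)).map sym))).stk tm.k₁ =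
        (List.ofFn (f n t)).map out := fun t => by
    rw [hfinal]; exact haltList_stk tm _
  -- The number of values bits is polynomially bounded because each step can lengthen a stack by at
  -- most `d`.
  have hm : m n ≤ n + h.time.eval n * d := by
    have t : Fin (2 ^ n) := ⟨0, by positivity⟩
    have h1 := length_idle_iterate_le M hd (initCfg tm.main tm.initialState tm.k₀
      ((List.ofFn (bitsEquiv n t)).map sym)) tm.k₁ (h.time.eval n)
    rw [hout, List.length_map, List.length_ofFn] at h1
    refine h1.trans (Nat.add_le_add_right ?_ _)
    simp only [initCfg]
    by_cases hk : tm.k₁ = tm.k₀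
    · have : ∀ (k : tm.K) (_ : k = tm.k₀) (w : List (tm.Γ tm.k₀)),
          (update (fun _ => [] : ∀ k, List (tm.Γ k)) tm.k₀ w k).length ≤ w.length := by
        rintro k rfl w
        rw [update_self]
      exact (this _ hk _).trans (by simp)
    · rw [update_of_ne hk]; simp
  obtain ⟨L, W, hW, hL, hbits⟩ := exists_slp_of_machine (A := A) M hd
    (fun l => (Set.subset_iUnion (fun l => pushed (M l)) l).trans Set.subset_union_left) tm.main
    tm.initialState tm.k₀ sym (fun b => Or.inr (Or.inl ⟨b, rfl⟩)) (N := fun B => c₁ + c₂ * B)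
    (fun B => rfl) n (h.time.eval n) (m n)
  have hmb : mb.eval n = n + h.time.eval n * d := by simp [mb]
  have hLK : L ≤ Kp.eval n := by
    have : Kp.eval n = (h.time.eval n + 1) *
        ((c₁ + c₂ * (mb.eval n + h.time.eval n * (d + 1))) * C) := by
      simp [Kp]
    rw [this, hmb]
    refine hL.trans ?_
    gcongr
  have hWf : ∀ i, (fun x => f n ((bitsEquiv n).symm x) i) ∈ W := by
    intro i
    have hb := hbits (Sum.inr (Sum.inr (⟨⟨tm.k₁, out true⟩, Or.inr (Or.inr ⟨true, rfl⟩)⟩, i)))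
      (by simp [cfgAtoms])
    convert hb using 1
    funext x
    have ho := hout ((bitsEquiv n).symm x)
    rw [Equiv.apply_symm_apply] at ho
    simp only [cfgBit, ho, List.getElem?_map, List.getElem?_ofFn, i.isLt, dif_pos, Option.map_some]
    have hinj : ∀ b, out b = out true ↔ b = true := fun b => h.outputAlphabet.symm.injective.eq_iff
    simp [hinj]
  obtain ⟨P, hP1, hP2⟩ := hW.exists_preparation (f n) hWf
  have heval : (Polynomial.X + 37 * (4 * Kp + mb) + Kp : Polynomial ℕ).eval n =
      n + 37 * (4 * Kp.eval n + mb.eval n) + Kp.eval n := by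
    simp
  refine ⟨L, P, ?_, ?_, hP2⟩
  · rw [heval]; omega
  · rw [heval, hmb]; omega


/-! ### Data and value registers -/

section
variable {n : ℕ} {B : Type} [Fintype B]

lemma norm_sq_eq_sum_slices {ι : Type} [Fintype ι] (v : EuclideanSpace ℂ (ι × B)) :
    ‖v‖ ^ 2 = ∑ b, nrm (fun t => v (t, b)) ^ 2 := by
  rw [EuclideanSpace.norm_sq_eq, Fintype.sum_prod_type_right]
  simp only [nrm_sq]

lemma norm_onFirst_of_scales {Z : Type} [Fintype Z] {S : Op Z} (hS : Scales 1 S)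
    (v : EuclideanSpace ℂ (Z × B)) : ‖onFirst S v‖ = ‖v‖ := by
  have h : ‖onFirst S v‖ ^ 2 = ‖v‖ ^ 2 := by
    rw [norm_sq_eq_sum_slices, norm_sq_eq_sum_slices]
    refine Finset.sum_congr rfl fun b _ => ?_
    have := hS fun t => v (t, b)
    rw [one_mul] at this
    rw [← this]
    rfl
  exact (pow_left_inj₀ (norm_nonneg _) (norm_nonneg _) two_ne_zero).1 h

/-- Both operators act separately on the slices belonging to the basis vectors of `V`, and squared
norms add over slices. The phase is fixed before `B` and the vector are chosen. -/
lemma Approx.onFirst {Q : Type} [DecidableEq Q] [Fintype Q] {C : QCircuit Q} {S : Op (Q → Bool)}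
    {ε : ℝ} (h : Approx C S ε) (hε : 0 ≤ ε) : ∃ z : ℂ, ‖z‖ = 1 ∧
      ∀ (B : Type) [Fintype B] (v : EuclideanSpace ℂ ((Q → Bool) × B)),
        ‖onFirst (circuitMap C) v - z • onFirst S v‖ ≤ ε * ‖v‖ := by
  obtain ⟨z, hz, h⟩ := h
  refine ⟨z, hz, fun B _ v => ?_⟩
  refine abs_le_of_sq_le_sq' ?_ (mul_nonneg hε (norm_nonneg v)) |>.2
  rw [mul_pow, norm_sq_eq_sum_slices, norm_sq_eq_sum_slices, Finset.mul_sum]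
  refine Finset.sum_le_sum fun b _ => ?_
  rw [← mul_pow]
  exact pow_le_pow_left₀ (nrm_nonneg _) (h fun t => v (t, b)) 2

lemma norm_functionState [DecidableEq B] (f : Fin (2 ^ n) → B) : ‖functionState n f‖ = 1 := by
  have h : ‖functionState n f‖ ^ 2 = 1 := by
    rw [EuclideanSpace.norm_sq_eq, Fintype.sum_prod_type]
    have h1 : ∀ t : Fin n → Bool, ∑ b, ‖functionState n f (t, b)‖ ^ 2 = 1 / 2 ^ n := by
      intro t
      rw [Finset.sum_eq_single (f ((bitsEquiv n).symm t))]
      · simp only [functionState, if_true, Complex.norm_real, Real.norm_eq_abs, sq_abs]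
        rw [div_pow, Real.sq_sqrt (by positivity), one_pow]
      · intro b _ hb
        simp [functionState, hb.symm]
      · simp
    simp [h1]
  exact (pow_eq_one_iff_of_nonneg (norm_nonneg _) two_ne_zero).1 h

end

/-! ### Measurements -/

lemma exists_measurementLaw {ι κ : Type} [Fintype ι] [Fintype κ] [DecidableEq κ] (g : ι → κ)
    (ψ : EuclideanSpace ℂ ι) (hψ : ‖ψ‖ = 1) : ∃ μ : PMF κ, IsMeasurementLaw g ψ μ := by
  refine ⟨PMF.ofFintype (fun k => ENNReal.ofReal (‖(WithLp.toLp 2 fun j => if g j = k then ψ j else 0 :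
    EuclideanSpace ℂ ι)‖ ^ 2)) ?_, fun k => rfl⟩
  rw [← ENNReal.ofReal_sum_of_nonneg fun _ _ => by positivity]
  have : ∑ k, ‖(WithLp.toLp 2 fun j => if g j = k then ψ j else 0 : EuclideanSpace ℂ ι)‖ ^ 2 = 1 := by
    simp only [EuclideanSpace.norm_sq_eq]
    rw [Finset.sum_comm]
    have h := EuclideanSpace.norm_sq_eq ψ
    rw [hψ, one_pow] at h
    rw [h]
    refine Finset.sum_congr rfl fun j _ => ?_
    rw [Finset.sum_eq_single (g j)] <;> simp +contextual [eq_comm]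
  rw [this, ENNReal.ofReal_one]

lemma norm_sq_toLp_single {ι : Type} [Fintype ι] (ψ : ι → ℂ) (i : ι)
    (h : ∀ j, j ≠ i → ψ j = 0) : ‖(WithLp.toLp 2 ψ : EuclideanSpace ℂ ι)‖ ^ 2 = ‖ψ i‖ ^ 2 := by
  rw [EuclideanSpace.norm_sq_eq, Finset.sum_eq_single i] <;> simp +contextual [h]

lemma IsMeasurementLaw.apply_id {ι : Type} [Fintype ι] [DecidableEq ι] {ψ : EuclideanSpace ℂ ι}
    {μ : PMF ι} (h : IsMeasurementLaw id ψ μ) (i : ι) : μ i = ENNReal.ofReal (‖ψ i‖ ^ 2) := by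
  exact (h i).trans (congrArg ENNReal.ofReal
    ((norm_sq_toLp_single _ i fun j hj => if_neg hj).trans (by simp)))

section
variable {n m a : ℕ}

lemma dataOf_elim (x : Fin n → Bool) (j : Fin m → Bool) (w : Fin a → Bool) :
    dataOf (Sum.elim x (Sum.elim j w)) = (x, j) := rfl

lemma IsMeasurementLaw.apply_dataOf {ψ : EuclideanSpace ℂ ((Fin n → Bool) × (Fin m → Bool))}
    {μ : PMF ((Fin n → Bool) × (Fin m → Bool))}
    (h : IsMeasurementLaw dataOf (withCleanWork a ψ) μ) (k : (Fin n → Bool) × (Fin m → Bool)) :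
    μ k = ENNReal.ofReal (‖ψ k‖ ^ 2) := by
  rw [h k, norm_sq_toLp_single _ (Sum.elim k.1 (Sum.elim k.2 fun _ => false))]
  · simp [withCleanWork, dataOf_elim]
  · intro y hy
    by_contra hne
    refine hy ?_
    rw [ite_eq_right_iff, Classical.not_imp] at hne
    obtain ⟨h1, h2⟩ := hne
    have h3 : ∀ i, y (Sum.inr (Sum.inr i)) = false := by
      by_contra hc
      exact h2 (if_neg hc)
    subst h1
    funext s
    obtain s | s | s := s
    · rfl
    · rfl
    · exact h3 s

lemma norm_circuitOutput {Q : Type} [Fintype Q] [DecidableEq Q] (C : QCircuit Q) :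
    ‖circuitOutput C‖ = 1 := by
  have h := scales_circOp C (zeroState Q)
  have h0 : nrm (zeroState Q) ^ 2 = 1 := by
    refine (norm_sq_toLp_single _ (fun _ => false) fun j hj => if_neg hj).trans ?_
    simp
  rw [(pow_eq_one_iff_of_nonneg (nrm_nonneg _) two_ne_zero).1 h0, one_mul] at h
  exact h

end

/-! ### Circuits in a larger register -/

section
variable {Q R : Type} [DecidableEq Q] [Fintype Q] [DecidableEq R] [Fintype R]

lemma elim_update_inl (y : Q ⊕ R → Bool) (q : Q) (b : Bool) :
    update y (Sum.inl q) b = Sum.elim (update (y ∘ Sum.inl) q b) (y ∘ Sum.inr) := by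
  rw [← Sum.update_elim_inl, Sum.elim_comp_inl_inr]

lemma gateOp_map_inl (g : QGate Q) (X : (Q ⊕ R → Bool) → ℂ) (y : Q ⊕ R → Bool) :
    gateOp (g.map Embedding.inl) X y =
      gateOp g (fun t => X (Sum.elim t (y ∘ Sum.inr))) (y ∘ Sum.inl) := by
  have hy : Sum.elim (y ∘ Sum.inl) (y ∘ Sum.inr) = y := Sum.elim_comp_inl_inr y
  cases g with
  | not q =>
    simp only [QGate.map, gateOp_not, permOp_apply, notAct]
    rw [← elim_update_inl]; rfl
  | hadamard q =>
    simp only [QGate.map, gateOp_hadamard, oneOp_apply, ← elim_update_inl]; rfl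
  | tgate q =>
    simp only [QGate.map, gateOp_tgate, oneOp_apply, ← elim_update_inl]; rfl
  | cnot c t h =>
    simp only [QGate.map, gateOp_cnot, permOp_apply, cnotAct]
    rw [← elim_update_inl]; rfl
  | cphase c t h =>
    simp only [QGate.map, gateOp_cphase, diagOp_apply, hy]; rfl

lemma circOp_map_inl (C : QCircuit Q) (X : (Q ⊕ R → Bool) → ℂ) (y : Q ⊕ R → Bool) :
    circOp (C.map (QGate.map Embedding.inl)) X y =
      circOp C (fun t => X (Sum.elim t (y ∘ Sum.inr))) (y ∘ Sum.inl) := by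
  induction C generalizing X with
  | nil => simp
  | cons g C ih =>
    rw [List.map_cons, circOp_cons, Module.End.mul_apply, ih, circOp_cons, Module.End.mul_apply]
    refine congrFun (congrArg (circOp C) (funext fun t => ?_)) _
    rw [gateOp_map_inl]
    rfl

end

lemma circuitOutput_append_map {n m a : ℕ} {P : QCircuit (Fin n ⊕ (Fin m ⊕ Fin a))}
    {ψ : EuclideanSpace ℂ ((Fin n → Bool) × (Fin m → Bool))}
    (hP : circuitOutput P = withCleanWork a ψ) (C : QCircuit (Fin n)) :
    circuitOutput (P ++ C.map (QGate.map Embedding.inl)) =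
      withCleanWork a (onFirst (circuitMap C) ψ) := by
  have hP' : circOp P (zeroState _) = (withCleanWork a ψ).ofLp := congrArg WithLp.ofLp hP
  have h : circuitOutput (P ++ C.map (QGate.map Embedding.inl)) =
      WithLp.toLp 2 (circOp (P ++ C.map (QGate.map Embedding.inl)) (zeroState _)) := rfl
  rw [h, circOp_append, Module.End.mul_apply, hP']
  ext y
  change circOp (C.map (QGate.map Embedding.inl)) _ y = _
  rw [circOp_map_inl]
  by_cases hy : ∀ i, y (Sum.inr (Sum.inr i)) = false
  · simp only [withCleanWork, comp_apply, Sum.elim_inr, hy, implies_true, if_true]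
    rfl
  · simp only [withCleanWork, comp_apply, Sum.elim_inr, hy, if_false]
    exact congrFun (map_zero (circOp C)) _

/-! ### The approximating circuits -/

theorem exists_circuits (F : WaveletFilter) :
    ∃ (p : MvPolynomial (Fin 2) ℝ) (C : (n : ℕ) → ℝ → QCircuit (Fin n)),
      ∀ (n : ℕ) (ε : ℝ), 0 < ε →
        ((C n ε).length : ℝ) ≤ MvPolynomial.eval ![(n : ℝ), Real.log (1 / ε)] p ∧
        ∃ z : ℂ, ‖z‖ = 1 ∧
          ∀ (B : Type) [Fintype B] [DecidableEq B] (f : Fin (2 ^ n) → B),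
            ‖onFirst (circuitMap (C n ε)) (functionState n f) -
              z • onFirst (F.transform n) (functionState n f)‖ < ε := by
  obtain ⟨K, hK⟩ := exists_approx_transform F
  have hC : ∀ (n : ℕ) (ε : ℝ), ∃ C : QCircuit (Fin n), 0 < ε →
      -- The precision `min ε 1 / 2` lies in the range of the approximation theorem and makes the
      -- final inequality strict.
      (C.length : ℝ) ≤ K * ((n + 1) ^ 7 * (1 + Real.log (1 / (min ε 1 / 2)))) ^ 5 ∧
        Approx C (pyramidOp F n) (min ε 1 / 2) := by
    intro n ε
    by_cases hε : 0 < ε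
    · obtain ⟨C, h⟩ := hK n (min ε 1 / 2) (half_pos (lt_min hε one_pos))
        (by linarith [min_le_right ε 1])
      exact ⟨C, fun _ => h⟩
    · exact ⟨[], fun h => absurd h hε⟩
  choose C hC using hC
  refine ⟨MvPolynomial.C (K : ℝ) * ((MvPolynomial.X 0 + 1) ^ 7 *
    (3 + MvPolynomial.X 1 ^ 2)) ^ 5, C, fun n ε hε => ?_⟩
  obtain ⟨h1, h2⟩ := hC n ε hε
  have hm : 0 < min ε 1 := lt_min hε one_pos
  constructor
  -- The square is used since `log (1 / ε)` is negative for `ε > 1`, where the polynomial must still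
  -- bound the length.
  · have hlog : Real.log (1 / (min ε 1 / 2)) ≤ 2 + Real.log (1 / ε) ^ 2 := by
      have e : 1 / (min ε 1 / 2) = 2 * (1 / min ε 1) := by field_simp
      rw [e, Real.log_mul two_ne_zero (by positivity)]
      have := Real.log_two_lt_d9
      rcases min_cases ε 1 with ⟨h, -⟩ | ⟨h, -⟩ <;> rw [h]
      · nlinarith [sq_nonneg (Real.log (1 / ε) - 1)]
      · simp
        nlinarith [sq_nonneg (Real.log ε)]
    have hlog0 : 0 ≤ Real.log (1 / (min ε 1 / 2)) :=
      Real.log_nonneg (by rw [le_div_iff₀ (by positivity)]; linarith [min_le_right ε 1])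
    refine h1.trans ?_
    simp only [map_mul, map_pow, map_add, MvPolynomial.eval_C, MvPolynomial.eval_X, map_one,
      map_ofNat, Matrix.cons_val_zero, Matrix.cons_val_one]
    gcongr (K : ℝ) * (((n : ℝ) + 1) ^ 7 * ?_) ^ 5
    linarith
  · obtain ⟨z, hz, h3⟩ := h2.onFirst (half_pos hm).le
    refine ⟨z, hz, fun B _ _ f => ?_⟩
    have h4 := h3 B (functionState n f)
    rw [norm_functionState, mul_one] at h4
    have e : F.transform n = pyramidOp F n := funext fun X => transform_eq F n X
    rw [e]
    linarith [min_le_left ε 1]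

end WaveletCircuits
end

open WaveletCircuits in
theorem corollary1 (F : WaveletFilter) :
    ∃ (p : MvPolynomial (Fin 2) ℝ) (C : (n : ℕ) → ℝ → QCircuit (Fin n)),
      (∀ n : ℕ, F.n₀ ≤ n → ∀ ε : ℝ, 0 < ε →
        ((C n ε).length : ℝ) ≤ MvPolynomial.eval ![(n : ℝ), Real.log (1 / ε)] p ∧
        (∃ z : ℂ, ‖z‖ = 1 ∧
          ∀ (B : Type) [Fintype B] [DecidableEq B] (f : Fin (2 ^ n) → B),
            ‖onFirst (circuitMap (C n ε)) (functionState n f) -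
              z • onFirst (F.transform n) (functionState n f)‖ < ε) ∧
        (∀ (B : Type) [Fintype B] [DecidableEq B] (f : Fin (2 ^ n) → B),
          ∃ μ : PMF ((Fin n → Bool) × B),
            IsMeasurementLaw id (onFirst (circuitMap (C n ε)) (functionState n f)) μ ∧
            ∀ (i : Fin n → Bool) (j : B), μ (i, j) = ENNReal.ofReal
              (‖onFirst (circuitMap (C n ε)) (functionState n f) (i, j)‖ ^ 2))) ∧
      (∀ (m : ℕ → ℕ) (f : ∀ n, Fin (2 ^ n) → Fin (m n) → Bool), PolyTimeComputable f →
        ∃ q : Polynomial ℕ, ∀ n : ℕ, F.n₀ ≤ n →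
          ∃ (a : ℕ) (P : QCircuit (Fin n ⊕ (Fin (m n) ⊕ Fin a))),
            a ≤ q.eval n ∧ P.length ≤ q.eval n ∧
            circuitOutput P = withCleanWork a (functionState n (f n)) ∧
            ∀ ε : ℝ, 0 < ε →
              circuitOutput (P ++ (C n ε).map (QGate.map Function.Embedding.inl)) =
                withCleanWork a (onFirst (circuitMap (C n ε)) (functionState n (f n))) ∧
              ∃ μ : PMF ((Fin n → Bool) × (Fin (m n) → Bool)),
                IsMeasurementLaw dataOf
                  (circuitOutput (P ++ (C n ε).map (QGate.map Function.Embedding.inl))) μ ∧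
                ∀ (i : Fin n → Bool) (j : Fin (m n) → Bool), μ (i, j) = ENNReal.ofReal
                  (‖onFirst (circuitMap (C n ε)) (functionState n (f n)) (i, j)‖ ^ 2)) := by
  obtain ⟨p, C, hC⟩ := exists_circuits F
  refine ⟨p, C, fun n _ ε hε => ⟨(hC n ε hε).1, (hC n ε hε).2, fun B _ _ f => ?_⟩, fun m f hf => ?_⟩
  · have hn : ‖onFirst (circuitMap (C n ε)) (functionState n f)‖ = 1 :=
      (norm_onFirst_of_scales (scales_circOp _) _).trans (norm_functionState f)
    obtain ⟨μ, hμ⟩ := exists_measurementLaw id _ hn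
    exact ⟨μ, hμ, fun i j => hμ.apply_id (i, j)⟩
  · obtain ⟨q, hq⟩ := exists_preparation hf
    refine ⟨q, fun n _ => ?_⟩
    obtain ⟨a, P, ha, hP, hout⟩ := hq n
    refine ⟨a, P, ha, hP, hout, fun ε _ => ?_⟩
    have h := circuitOutput_append_map hout (C n ε)
    obtain ⟨μ, hμ⟩ := exists_measurementLaw dataOf _ (norm_circuitOutput (P ++ (C n ε).map (QGate.map Function.Embedding.inl)))
    refine ⟨h, μ, hμ, fun i j => ?_⟩
    rw [h] at hμ
    exact hμ.apply_dataOf (i, j)
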